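/- **Setting.** Let $W=P_{Y_1Y_2Z|X_1X_2}$ be a memoryless two-way wiretap channel with finite alphabets, and let $P_{V_1}P_{X_1|V_1}P_{V_2}P_{X_2|V_2}$ be a product input distribution. All logarithms are natural. For $s\in(0,1]$ put $D_{1+s}(P\|Q)=\frac1s\log\sum_xP(x)^{1+s}Q(x)^{-s}$ (also for $-1<s<0$), $I^{\uparrow}_{1+s}(Z;X)=D_{1+s}(P_{ZX}\|P_Z\times P_X)$, and let $I^{\downarrow}_{1/(1+s)}(A;B|C)$ be defined by $e^{-sI^{\downarrow}_{1/(1+s)}(A;B|C)}=\sum_cP_C(c)\,e^{-s\min_QD_{1/(1+s)}(P_{AB|C=c}\|Q\times P_{B|C=c})}$. For $i=1,2$ let $R_{i,s},R_{i,k},R_{i,e},R_{i,o}\ge0$, and put $\tilde R_i=R_{i,s}+R_{i,k}$, $\tilde R_{i,r}=R_{i,e}+R_{i,o}$. **Codes.** A non-adaptive code $\mathcal C_n$ of length $n$ consists, for each user $i$, of codewords $v_i^n$ indexed by $(m_s,m_k,m_e,m_o)$ with $e^{nR_{i,s}},e^{nR_{i,k}},e^{nR_{i,e}},e^{nR_{i,o}}$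 values of the parts (the codeword is sent through $P_{X_i|V_i}$), and of a decoder that estimates the other user's index from the own channel inputs and outputs. Its $t$-round key-exchange code $\mathcal C_n^t$ is the adaptive code of length $nt$ in which User $i$ has the uniform message $\mathbf M_i$ made of $m_{i,s}^j$ ($1\le j\le t$) and $m_{i,e}^j$ ($2\le j\le t$), and sends in round $j$ the codeword with index $(m_{i,s}^j,\,m_{i,k}^j,\,m_{i,e}^j\oplus\hat k^{j-1},\,m_{i,o}^j)$. Here $m_{i,k}^j,m_{i,o}^j$ are fresh uniform private randomness, and $\hat k^{j-1}$ is the other user's key of round $j-1$ as decoded by User $i$, reduced to the range of $m_{i,e}$; in round $1$ the third part is uniform private randomness. The receiver removes the mask with its own key. Let $P_e(\mathcal C_n^t)$ be the average probability that some message is decoded wrongly, $\mathbf Z$ the eavesdropper's $nt$ outputs, $I(\cdot\,;\mathbf Z|\mathcal C_n^t)$ the leakage of this code, and $I^{*}(\cdot\,;\mathbf Z)$ the leakage of the same protocol when each $\hat k^{j-1}$ is replaced by the true key of the other user. Put $$E_n(s)=e^{ns(\tilde R_1+\tilde R_{1,r}-I^{\downarrow}_{1/(1+s)}(Y_2;V_1|X_2))}+e^{ns(\tilde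 R_2+\tilde R_{2,r}-I^{\downarrow}_{1/(1+s)}(Y_1;V_2|X_1))},$$ $$L_n(s;a_1,a_2)=e^{ns(I^{\uparrow}_{1+s}(Z;V_1)-a_1)}+e^{ns(I^{\uparrow}_{1+s}(Z;V_2)-a_2)}+e^{ns(I^{\uparrow}_{1+s}(Z;V_1V_2)-a_1-a_2)},$$ and $\kappa(\eta,M)=2h(\min(\eta,\tfrac12))+\eta\log M$ with the binary entropy $h$. **Claim (exact sizes).** Let $n\ge1$, and let all $e^{nR_{i,\cdot}}$ be integers such that $e^{nR_{1,e}}$ divides $e^{nR_{2,k}}$ and $e^{nR_{2,e}}$ divides $e^{nR_{1,k}}$. 1. There is a non-adaptive code $\mathcal C_n$ such that for all $t\ge1$ and $s\in(0,1]$: $$P_e(\mathcal C_n^t)\le 2tE_n(s),\qquad I^{*}(\mathbf M_1,\mathbf M_2;\mathbf Z)\le\frac{2t}{s}L_n(s;\tilde R_{1,r},\tilde R_{2,r}),$$ $$I(\mathbf M_1,\mathbf M_2;\mathbf Z|\mathcal C_n^t)\le I^{*}(\mathbf M_1,\mathbf M_2;\mathbf Z)+\kappa(2tE_n(s),|\mathcal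 M_1||\mathcal M_2|),$$ where $\mathcal M_i$ is the set of values of $\mathbf M_i$. 2. There is a non-adaptive code $\mathcal C_n$ such that for all $t\ge1$ and $s\in(0,1]$: $$P_e(\mathcal C_n^t)\le 3tE_n(s),$$ $$I^{*}(\mathbf M_1;\mathbf Z)\le\frac{3t}{s}L_n(s;\tilde R_{1,r},\tilde R_{2,r}+R_{2,s}),\qquad I^{*}(\mathbf M_2;\mathbf Z)\le\frac{3t}{s}L_n(s;\tilde R_{1,r}+R_{1,s},\tilde R_{2,r}),$$ $$I(\mathbf M_i;\mathbf Z|\mathcal C_n^t)\le I^{*}(\mathbf M_i;\mathbf Z)+\kappa(3tE_n(s),|\mathcal M_i|)\quad(i=1,2).$$ 3. The overall rate $\frac{1}{nt}\log|\mathcal M_i|$ tends to $R_{i,s}+R_{i,e}$ as $t\to\infty$, for $i=1,2$. **Claim (arbitrary rates).** Let the rates be any nonnegative reals with $R_{1,k},R_{2,k}>0$, $R_{1,e}\le R_{2,k}$, $R_{2,e}\le R_{1,k}$. Then there are integer part sizes depending on $n$, with the same divisibility, whose rates tend to the given rates as $n\to\infty$, such that for all sufficiently large $n$ there are codes $\mathcal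 C_n$ with these sizes that satisfy the bounds of 1, respectively of 2, with the given real rates in the exponents, for all $t\ge1$ and $s\in(0,1]$; and $\frac1{nt}\log|\mathcal M_i|\to R_{i,s}+R_{i,e}$ as $n,t\to\infty$. -/

import Mathlib

open Filter
open scoped Topology

noncomputable section

namespace TwoWayWiretap

/-! ### Distributions on finite sets, mutual information, Rényi quantities

All logarithms are natural, as the code sizes are written as powers of `e`. -/

open scoped Classical in
/-- The law of `f a` when `a` has law `p`. -/
def push {A B : Type*} [Fintype A] (f : A → B) (p : A → ℝ) (b : B) : ℝ :=
  ∑ a with f a = b, p a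

/-- Mutual information `I(A;B)` of a joint law `p` of `(A, B)`. -/
def mutualInfo {A B : Type*} [Fintype A] [Fintype B] (p : A × B → ℝ) : ℝ :=
  ∑ ab, p ab * Real.log (p ab / (push Prod.fst p ab.1 * push Prod.snd p ab.2))

/-- The sum `∑ₓ P(x)^{1+s} Q(x)^{-s}` inside the Rényi relative entropy. -/
def renyiSum {A : Type*} [Fintype A] (s : ℝ) (P Q : A → ℝ) : ℝ :=
  ∑ a, P a ^ (1 + s) * Q a ^ (-s)

/-- Rényi relative entropy `D_{1+s}(P‖Q) = (1/s) log ∑ₓ P(x)^{1+s} Q(x)^{-s}`. It is used for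
`s > 0` with `P ≪ Q`, and for `-1 < s < 0` with a positive sum (for a vanishing sum the
divergence is `+∞`). -/
def renyiDiv {A : Type*} [Fintype A] (s : ℝ) (P Q : A → ℝ) : ℝ :=
  1 / s * Real.log (renyiSum s P Q)

/-- Rényi mutual information `I↑_{1+s}(A;B) = D_{1+s}(P_{AB} ‖ P_A × P_B)`. -/
def renyiInfoUp {A B : Type*} [Fintype A] [Fintype B] (s : ℝ) (p : A × B → ℝ) : ℝ :=
  renyiDiv s p (fun ab => push Prod.fst p ab.1 * push Prod.snd p ab.2)

/-- Marginal of the last variable of a joint law of `(A, B, C)`. -/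
def margC {A B C : Type*} [Fintype A] [Fintype B] [Fintype C] (p : A × B × C → ℝ) : C → ℝ :=
  push (fun x => x.2.2) p

/-- Conditional law of `(A, B)` given `C = c`. -/
def condC {A B C : Type*} [Fintype A] [Fintype B] [Fintype C] (p : A × B × C → ℝ) (c : C) :
    A × B → ℝ :=
  fun ab => p (ab.1, ab.2, c) / margC p c

/-- `min_Q D_{1/(1+s)}(p ‖ Q × P_B)` over all distributions `Q` of `A`, for a joint law `p` of
`(A, B)`. Here `1/(1+s) = 1 + (-s/(1+s))`; the `Q` with a vanishing sum have divergence `+∞`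
and so do not contribute to the minimum. -/
def minRenyi {A B : Type*} [Fintype A] [Fintype B] (s : ℝ) (p : A × B → ℝ) : ℝ :=
  sInf {d : ℝ | ∃ Q ∈ stdSimplex ℝ A,
    0 < renyiSum (-s / (1 + s)) p (fun ab => Q ab.1 * push Prod.snd p ab.2) ∧
    d = renyiDiv (-s / (1 + s)) p (fun ab => Q ab.1 * push Prod.snd p ab.2)}

/-- Conditional Rényi mutual information `I↓_{1/(1+s)}(A;B|C)`, given by
`exp(-s I↓) = ∑_c P_C(c) exp(-s min_Q D_{1/(1+s)}(P_{AB|C=c} ‖ Q × P_{B|C=c}))`. -/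
def renyiInfoDown {A B C : Type*} [Fintype A] [Fintype B] [Fintype C] (s : ℝ)
    (p : A × B × C → ℝ) : ℝ :=
  -(1 / s) * Real.log (∑ c, margC p c * Real.exp (-s * minRenyi s (condC p c)))

/-! ### Channel, input laws, adaptive codes -/

/-- A law of `V` together with a prefix channel from `V` to `X`, for one user. -/
structure InputLaw (V X : Type*) [Fintype V] [Fintype X] where
  law : stdSimplex ℝ V
  chan : V → stdSimplex ℝ X

/-- One user's part of an adaptive code. The channel is used at the times `j : T`. The user draws
private randomness, then stochastically chooses each input from the own message, the private
randomness and the strictly earlier own inputs and outputs, and finally estimates the other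
user's message. -/
structure AdaptiveUser (T M M' U X Y : Type*) [LinearOrder T] [Fintype U] [Fintype X] where
  rand : stdSimplex ℝ U
  enc : (j : T) → M → U → ({i : T // i < j} → X × Y) → stdSimplex ℝ X
  dec : M → U → (T → X × Y) → M'

section Codes

variable {T M₁ M₂ U₁ U₂ X₁ X₂ Y₁ Y₂ Z : Type*}
  [LinearOrder T] [Fintype T] [Fintype M₁] [Fintype M₂] [Fintype U₁] [Fintype U₂]
  [Fintype X₁] [Fintype X₂] [Fintype Y₁] [Fintype Y₂] [Fintype Z]

/-- All variables of one run: the messages, the private randomness, and for each time the inputs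
`x₁, x₂` and the outputs `y₁, y₂, z`. -/
abbrev Run (T M₁ M₂ U₁ U₂ X₁ X₂ Y₁ Y₂ Z : Type*) : Type _ :=
  (M₁ × M₂) × (U₁ × U₂) × (T → (X₁ × X₂) × (Y₁ × Y₂ × Z))

/-- Law of a run with independent uniform messages over the memoryless channel `W`. -/
def runLaw (W : X₁ → X₂ → stdSimplex ℝ (Y₁ × Y₂ × Z))
    (A₁ : AdaptiveUser T M₁ M₂ U₁ X₁ Y₁) (A₂ : AdaptiveUser T M₂ M₁ U₂ X₂ Y₂) :
    Run T M₁ M₂ U₁ U₂ X₁ X₂ Y₁ Y₂ Z → ℝ :=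
  fun ⟨(m₁, m₂), (u₁, u₂), ω⟩ =>
    (Fintype.card M₁ : ℝ)⁻¹ * (Fintype.card M₂ : ℝ)⁻¹ * A₁.rand u₁ * A₂.rand u₂ *
      ∏ j, A₁.enc j m₁ u₁ (fun i => ((ω i).1.1, (ω i).2.1)) (ω j).1.1 *
        A₂.enc j m₂ u₂ (fun i => ((ω i).1.2, (ω i).2.2.1)) (ω j).1.2 *
        W (ω j).1.1 (ω j).1.2 (ω j).2

open scoped Classical in
/-- Probability that at least one of the two messages is decoded wrongly. -/
def errorProb (W : X₁ → X₂ → stdSimplex ℝ (Y₁ × Y₂ × Z))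
    (A₁ : AdaptiveUser T M₁ M₂ U₁ X₁ Y₁) (A₂ : AdaptiveUser T M₂ M₁ U₂ X₂ Y₂) : ℝ :=
  ∑ r : Run T M₁ M₂ U₁ U₂ X₁ X₂ Y₁ Y₂ Z with
    (A₁.dec r.1.1 r.2.1.1 (fun j => ((r.2.2 j).1.1, (r.2.2 j).2.1)) ≠ r.1.2 ∨
      A₂.dec r.1.2 r.2.1.2 (fun j => ((r.2.2 j).1.2, (r.2.2 j).2.2.1)) ≠ r.1.1),
    runLaw W A₁ A₂ r

/-- Joint law of the messages and of everything that the eavesdropper observes. -/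
def eveLaw (W : X₁ → X₂ → stdSimplex ℝ (Y₁ × Y₂ × Z))
    (A₁ : AdaptiveUser T M₁ M₂ U₁ X₁ Y₁) (A₂ : AdaptiveUser T M₂ M₁ U₂ X₂ Y₂) :
    (M₁ × M₂) × (T → Z) → ℝ :=
  push (fun r => (r.1, fun j => (r.2.2 j).2.2.2)) (runLaw W A₁ A₂)

/-- `I(M₁, M₂; Z^T)` for a joint law of the messages and the eavesdropper's observation. -/
def leak₁₂ (p : (M₁ × M₂) × (T → Z) → ℝ) : ℝ := mutualInfo p

/-- `I(M₁; Z^T)`. -/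
def leak₁ (p : (M₁ × M₂) × (T → Z) → ℝ) : ℝ := mutualInfo (push (fun a => (a.1.1, a.2)) p)

/-- `I(M₂; Z^T)`. -/
def leak₂ (p : (M₁ × M₂) × (T → Z) → ℝ) : ℝ := mutualInfo (push (fun a => (a.1.2, a.2)) p)

end Codes

/-! ### Non-adaptive codes with a split index, and the key-exchange code -/

/-- Numbers of values of the secret, key, encrypted and open parts of one user. -/
structure Sizes where
  (s k e o : ℕ+)

/-- Rates of the secret, key, encrypted and open parts of one user. -/
structure Rates where
  (s k e o : ℝ)

/-- Rates `R` of given sizes at block length `n`, so that every size is `e^{nR}`. -/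
def Sizes.rates (N : Sizes) (n : ℕ) : Rates where
  s := Real.log (N.s : ℕ) / n
  k := Real.log (N.k : ℕ) / n
  e := Real.log (N.e : ℕ) / n
  o := Real.log (N.o : ℕ) / n

/-- `R̃ = R_s + R_k`, the main part. -/
def Rates.main (R : Rates) : ℝ := R.s + R.k

/-- `R̃_r = R_e + R_o`, the auxiliary part. -/
def Rates.aux (R : Rates) : ℝ := R.e + R.o

/-- Index of a codeword: main part `(s, k)` and auxiliary part `(e, o)`. -/
abbrev Index (N : Sizes) : Type :=
  Fin N.s × ZMod N.k × ZMod N.e × Fin N.o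

/-- One user's part of a non-adaptive code of length `n`: the codewords, of which the user sends the
one with the chosen index through the prefix channel, and the decoder for the index of the other
user, which sees the own channel inputs and outputs. -/
structure BlockUser (V X Y : Type*) (N N' : Sizes) (n : ℕ) where
  word : Index N → Fin n → V
  dec : (Fin n → X) → (Fin n → Y) → Index N'

/-- The times of `τ + 1` rounds of length `n`, in lexicographic order. -/
abbrev Times (τ n : ℕ) : Type := Fin (τ + 1) ×ₗ Fin n

/-- Messages for `τ + 1` rounds: a secret part in every round, and an encrypted part in every round
but the first, in which no key is available yet. -/
abbrev Msg (N : Sizes) (τ : ℕ) : Type := (Fin (τ + 1) → Fin N.s) × (Fin τ → ZMod N.e)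

/-- Private randomness for `τ + 1` rounds: a key and an open part in every round, and a filler for
the encrypted part of the first round. -/
abbrev Priv (N : Sizes) (τ : ℕ) : Type := (Fin (τ + 1) → ZMod N.k × Fin N.o) × ZMod N.e

/-- Overall rate of one user: logarithm of the number of messages per channel use. -/
def overallRate (N : Sizes) (n τ : ℕ) : ℝ :=
  Real.log (Fintype.card (Msg N τ)) / ((n : ℝ) * (τ + 1))

section KeyExchange

variable {V X Y : Type*} [Fintype V] [Fintype X] {N N' : Sizes} {n : ℕ}

/-- The encrypted part that a user sends in round `r`: the filler in the first round, afterwards the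
message part plus the key that the user has decoded in the previous round. The argument `past`
holds the own inputs and outputs of the earlier rounds. -/
def sentE (B : BlockUser V X Y N N' n) (h : (N.e : ℕ) ∣ N'.k) {τ : ℕ} (m : Msg N τ)
    (u : Priv N τ) (r : Fin (τ + 1)) :
    ((q : Fin (τ + 1)) → q < r → Fin n → X × Y) → ZMod N.e :=
  Fin.cases (motive := fun r => ((q : Fin (τ + 1)) → q < r → Fin n → X × Y) → ZMod N.e)
    (fun _ => u.2)
    (fun q past =>
      let blk := past q.castSucc Fin.castSucc_lt_succ
      m.2 q + ZMod.castHom h (ZMod N.e) (B.dec (fun i => (blk i).1) (fun i => (blk i).2)).2.1)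
    r

/-- One user's part of the key-exchange code: `τ + 1` rounds of the non-adaptive code, where the
encrypted message part of a round is masked by the key that the user has decoded in the previous
round; the other user's mask, which is the own key of the previous round, is removed by the
decoder. -/
def keyExchange (Q : InputLaw V X) (B : BlockUser V X Y N N' n) (h : (N.e : ℕ) ∣ N'.k)
    (h' : (N'.e : ℕ) ∣ N.k) (τ : ℕ) :
    AdaptiveUser (Times τ n) (Msg N τ) (Msg N' τ) (Priv N τ) X Y where
  rand := stdSimplex.barycenter
  enc j m u past :=
    let r := (ofLex j).1
    let e := sentE B h m u r (fun q hq i => past ⟨toLex (q, i), Prod.Lex.left _ _ hq⟩)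
    Q.chan (B.word (m.1 r, (u.1 r).1, e, (u.1 r).2) (ofLex j).2)
  dec _ u xy :=
    let est : Fin (τ + 1) → Index N' := fun r =>
      B.dec (fun i => (xy (toLex (r, i))).1) (fun i => (xy (toLex (r, i))).2)
    (fun r => (est r).1,
      fun q => (est q.succ).2.2.1 - ZMod.castHom h' (ZMod N'.e) (u.1 q.castSucc).1)

/-- Index sent in round `r` when the key `key` of the other user from the previous round has been
received correctly. -/
def idealIndex (h : (N.e : ℕ) ∣ N'.k) {τ : ℕ} (m : Msg N τ) (u : Priv N τ)
    (key : Fin (τ + 1) → ZMod N'.k) (r : Fin (τ + 1)) : Index N :=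
  (m.1 r, (u.1 r).1,
    Fin.cases u.2 (fun q => m.2 q + ZMod.castHom h (ZMod N.e) (key q.castSucc)) r, (u.1 r).2)

end KeyExchange

section Bounds

variable {V₁ V₂ X₁ X₂ Y₁ Y₂ Z : Type*}
  [Fintype V₁] [Fintype V₂] [Fintype X₁] [Fintype X₂] [Fintype Y₁] [Fintype Y₂] [Fintype Z]

/-- The channel from `(V₁, V₂)` to the eavesdropper. -/
def eveChan (W : X₁ → X₂ → stdSimplex ℝ (Y₁ × Y₂ × Z)) (Q₁ : InputLaw V₁ X₁)
    (Q₂ : InputLaw V₂ X₂) (v₁ : V₁) (v₂ : V₂) (z : Z) : ℝ :=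
  ∑ x₁, ∑ x₂, ∑ y₁, ∑ y₂, Q₁.chan v₁ x₁ * Q₂.chan v₂ x₂ * W x₁ x₂ (y₁, y₂, z)

/-- Joint law of the messages and the eavesdropper's observation in the idealized protocol, where
each encrypted part is masked by the true key of the other user from the previous round. -/
def idealEveLaw (W : X₁ → X₂ → stdSimplex ℝ (Y₁ × Y₂ × Z)) (Q₁ : InputLaw V₁ X₁)
    (Q₂ : InputLaw V₂ X₂) {N₁ N₂ : Sizes} {n : ℕ}
    (B₁ : BlockUser V₁ X₁ Y₁ N₁ N₂ n) (B₂ : BlockUser V₂ X₂ Y₂ N₂ N₁ n)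
    (h₁₂ : (N₁.e : ℕ) ∣ N₂.k) (h₂₁ : (N₂.e : ℕ) ∣ N₁.k) (τ : ℕ) :
    (Msg N₁ τ × Msg N₂ τ) × (Times τ n → Z) → ℝ :=
  fun ⟨(m₁, m₂), z⟩ =>
    (Fintype.card (Msg N₁ τ) : ℝ)⁻¹ * (Fintype.card (Msg N₂ τ) : ℝ)⁻¹ *
    ((Fintype.card (Priv N₁ τ) : ℝ)⁻¹ * (Fintype.card (Priv N₂ τ) : ℝ)⁻¹ *
      ∑ u₁ : Priv N₁ τ, ∑ u₂ : Priv N₂ τ, ∏ r : Fin (τ + 1), ∏ i : Fin n,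
        eveChan W Q₁ Q₂
          (B₁.word (idealIndex h₁₂ m₁ u₁ (fun q => (u₂.1 q).1) r) i)
          (B₂.word (idealIndex h₂₁ m₂ u₂ (fun q => (u₁.1 q).1) r) i)
          (z (toLex (r, i))))

/-- The joint law of `(V₁, V₂, X₁, X₂, Y₁, Y₂, Z)` for independent users. -/
def singleLaw (W : X₁ → X₂ → stdSimplex ℝ (Y₁ × Y₂ × Z)) (Q₁ : InputLaw V₁ X₁)
    (Q₂ : InputLaw V₂ X₂) : V₁ × V₂ × X₁ × X₂ × Y₁ × Y₂ × Z → ℝ :=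
  fun ⟨v₁, v₂, x₁, x₂, y⟩ =>
    Q₁.law v₁ * Q₁.chan v₁ x₁ * (Q₂.law v₂ * Q₂.chan v₂ x₂) * W x₁ x₂ y

/-- Sum of the two reliability terms
`e^{ns(R̃₁ + R̃₁ᵣ - I↓(Y₂;V₁|X₂))} + e^{ns(R̃₂ + R̃₂ᵣ - I↓(Y₁;V₂|X₁))}`, of order `1/(1+s)`. -/
def errTerm (W : X₁ → X₂ → stdSimplex ℝ (Y₁ × Y₂ × Z)) (Q₁ : InputLaw V₁ X₁)
    (Q₂ : InputLaw V₂ X₂) (n : ℕ) (R₁ R₂ : Rates) (s : ℝ) : ℝ :=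
  Real.exp (n * s * (R₁.main + R₁.aux -
    renyiInfoDown s (push (fun ⟨v₁, _, _, x₂, _, y₂, _⟩ => (y₂, v₁, x₂)) (singleLaw W Q₁ Q₂)))) +
  Real.exp (n * s * (R₂.main + R₂.aux -
    renyiInfoDown s (push (fun ⟨_, v₂, x₁, _, y₁, _, _⟩ => (y₁, v₂, x₁)) (singleLaw W Q₁ Q₂))))

/-- Sum of the three secrecy terms
`e^{ns(I↑(Z;V₁) - a₁)} + e^{ns(I↑(Z;V₂) - a₂)} + e^{ns(I↑(Z;V₁,V₂) - (a₁ + a₂))}`, of order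
`1 + s`, where `a₁, a₂` are the rates of the randomization. -/
def leakTerm (W : X₁ → X₂ → stdSimplex ℝ (Y₁ × Y₂ × Z)) (Q₁ : InputLaw V₁ X₁)
    (Q₂ : InputLaw V₂ X₂) (n : ℕ) (a₁ a₂ s : ℝ) : ℝ :=
  Real.exp (n * s *
    (renyiInfoUp s (push (fun ⟨v₁, _, _, _, _, _, z⟩ => (z, v₁)) (singleLaw W Q₁ Q₂)) - a₁)) +
  Real.exp (n * s *
    (renyiInfoUp s (push (fun ⟨_, v₂, _, _, _, _, z⟩ => (z, v₂)) (singleLaw W Q₁ Q₂)) - a₂)) +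
  Real.exp (n * s *
    (renyiInfoUp s (push (fun ⟨v₁, v₂, _, _, _, _, z⟩ => (z, (v₁, v₂))) (singleLaw W Q₁ Q₂)) -
      (a₁ + a₂)))

/-- Effect of wrongly decoded keys on an information about one of `M` messages, when some key is
wrong with probability at most `η`: `2 h(min(η, 1/2)) + η log M`, with the binary entropy `h`. -/
def keyErrorTerm (η : ℝ) (M : ℕ) : ℝ :=
  2 * Real.binEntropy (min η (1 / 2)) + η * Real.log M

variable {N₁ N₂ : Sizes} {n : ℕ}

/-- Error and joint leakage bounds for the key-exchange codes built from the non-adaptive code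
`(B₁, B₂)`, for every number `t = τ + 1` of rounds and every `s ∈ (0, 1]`. -/
def JointBounds (W : X₁ → X₂ → stdSimplex ℝ (Y₁ × Y₂ × Z)) (Q₁ : InputLaw V₁ X₁)
    (Q₂ : InputLaw V₂ X₂) (h₁₂ : (N₁.e : ℕ) ∣ N₂.k) (h₂₁ : (N₂.e : ℕ) ∣ N₁.k)
    (R₁ R₂ : Rates) (B₁ : BlockUser V₁ X₁ Y₁ N₁ N₂ n) (B₂ : BlockUser V₂ X₂ Y₂ N₂ N₁ n) : Prop :=
  ∀ τ : ℕ, ∀ s : ℝ, 0 < s → s ≤ 1 →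
    let t : ℝ := τ + 1
    let A₁ := keyExchange Q₁ B₁ h₁₂ h₂₁ τ
    let A₂ := keyExchange Q₂ B₂ h₂₁ h₁₂ τ
    let ideal := idealEveLaw W Q₁ Q₂ B₁ B₂ h₁₂ h₂₁ τ
    let η := 2 * t * errTerm W Q₁ Q₂ n R₁ R₂ s
    errorProb W A₁ A₂ ≤ η ∧
    leak₁₂ ideal ≤ 2 * t * (1 / s) * leakTerm W Q₁ Q₂ n R₁.aux R₂.aux s ∧
    leak₁₂ (eveLaw W A₁ A₂) ≤
      leak₁₂ ideal + keyErrorTerm η (Fintype.card (Msg N₁ τ × Msg N₂ τ))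

/-- Error and individual leakage bounds for the key-exchange codes built from the non-adaptive code
`(B₁, B₂)`, for every number `t = τ + 1` of rounds and every `s ∈ (0, 1]`. -/
def IndividualBounds (W : X₁ → X₂ → stdSimplex ℝ (Y₁ × Y₂ × Z)) (Q₁ : InputLaw V₁ X₁)
    (Q₂ : InputLaw V₂ X₂) (h₁₂ : (N₁.e : ℕ) ∣ N₂.k) (h₂₁ : (N₂.e : ℕ) ∣ N₁.k)
    (R₁ R₂ : Rates) (B₁ : BlockUser V₁ X₁ Y₁ N₁ N₂ n) (B₂ : BlockUser V₂ X₂ Y₂ N₂ N₁ n) : Prop :=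
  ∀ τ : ℕ, ∀ s : ℝ, 0 < s → s ≤ 1 →
    let t : ℝ := τ + 1
    let A₁ := keyExchange Q₁ B₁ h₁₂ h₂₁ τ
    let A₂ := keyExchange Q₂ B₂ h₂₁ h₁₂ τ
    let ideal := idealEveLaw W Q₁ Q₂ B₁ B₂ h₁₂ h₂₁ τ
    let η := 3 * t * errTerm W Q₁ Q₂ n R₁ R₂ s
    errorProb W A₁ A₂ ≤ η ∧
    leak₁ ideal ≤ 3 * t * (1 / s) * leakTerm W Q₁ Q₂ n R₁.aux (R₂.aux + R₂.s) s ∧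
    leak₂ ideal ≤ 3 * t * (1 / s) * leakTerm W Q₁ Q₂ n (R₁.aux + R₁.s) R₂.aux s ∧
    leak₁ (eveLaw W A₁ A₂) ≤ leak₁ ideal + keyErrorTerm η (Fintype.card (Msg N₁ τ)) ∧
    leak₂ (eveLaw W A₁ A₂) ≤ leak₂ ideal + keyErrorTerm η (Fintype.card (Msg N₂ τ))

end Bounds

end TwoWayWiretap

end

open Finset
open scoped BigOperators

noncomputable section

namespace TwoWayWiretap

/-! ### Relative entropy and mutual information -/

-- The code is random: every codeword letter is drawn independently from `Q₁.law` or `Q₂.law`, and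
-- each user decodes by maximum likelihood. Two kinds of single-round quantities decide everything.
-- `blockError` is the sum of the two average error probabilities of one block. `roundKlBoth` and
-- `roundKlFst` are mean relative entropies between the eavesdropper's output in one round, with
-- some parts of the index fixed and the others uniform, and the output law of independent random
-- codewords. Over the random code, the mean of `blockError` is at most $E_n(s)$ by Gallager's
-- argument (`sum_codes_blockError_le`), and the means of the relative entropies are at most
-- $\frac1s L_n(s;\cdot)$ by a resolvability argument for two encoders (`sum_prodLaw_kl_le`). None
-- of these quantities depends on $s$ or $t$. Hence one code that keeps two (or three) of them
-- within the factor 2 (or 3) of their means serves all $s$ and $t$ at once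
-- (`exists_le_card_mul_mean`).
--
-- The leakage of $t$ idealized rounds is reduced to single rounds by `kl_chainLaw_le`. For given
-- messages the rounds are linked only through the keys: the key of a round masks the encrypted part
-- of the next. Splitting off the first round and revealing its key makes the two pieces
-- independent, and this can only increase the divergence. In the piece split off, the encrypted
-- part is uniform, because its mask is uniform and independent of the key that was revealed. So
-- each round contributes the divergence with fixed secret and key parts and uniform encrypted and
-- open parts. For individual secrecy the average over the other user's message also makes that
-- user's secret and encrypted parts uniform, which enlarges the randomization to $\tilde
-- R_{i,r}+R_{i,s}$ (`expect_idealCond_eq_chainLaw`). The mean divergence from a reference law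
-- bounds the mutual information (`mutualInfo_le_expect_kl`).
--
-- The actual protocol is coupled with the idealized one. Their run laws agree on the event
-- `AllCorrect` that every block is decoded to its ideal index (`runLaw_eq_idealRunLaw`). In the
-- idealized protocol the indices of every round are uniform (`expect_idealIndex`), so a union bound
-- gives at most $t$ times `blockError` for the complement. As both laws have mass one, the same
-- number bounds the actual error probability, and a continuity estimate for $H(M|Z)$
-- (`mutualInfo_le_add_of_common`) turns it into the term $\kappa$.
--
-- For real rates only three facts about the sizes matter: the total size is at most $e^{n(\tilde
-- R+\tilde R_r)}$, while the randomizing sizes are at least their nominal values, and the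
-- divisibility holds. Rounding losses are absorbed by the key part, which may be smaller by a
-- constant factor.

lemma push_nonneg {A B : Type*} [Fintype A] (f : A → B) {p : A → ℝ} (hp : ∀ a, 0 ≤ p a) (b : B) :
    0 ≤ push f p b :=
  sum_nonneg fun a _ => hp a

lemma push_eq_sum_ite {A B : Type*} [Fintype A] [DecidableEq B] (f : A → B) (p : A → ℝ) (b : B) :
    push f p b = ∑ a, if f a = b then p a else 0 := by
  classical
  unfold push
  rw [sum_filter]
  exact sum_congr rfl fun a _ => by split_ifs <;> rfl

lemma push_fst {A B : Type*} [Fintype A] [Fintype B] (p : A × B → ℝ) (a : A) :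
    push Prod.fst p a = ∑ b, p (a, b) := by
  classical
  rw [push_eq_sum_ite, Fintype.sum_prod_type, sum_comm]
  simp

lemma push_snd {A B : Type*} [Fintype A] [Fintype B] (p : A × B → ℝ) (b : B) :
    push Prod.snd p b = ∑ a, p (a, b) := by
  classical
  rw [push_eq_sum_ite, Fintype.sum_prod_type]
  simp

lemma sum_push_mul {A B : Type*} [Fintype A] [Fintype B] (f : A → B) (p : A → ℝ) (g : B → ℝ) :
    ∑ b, push f p b * g b = ∑ a, p a * g (f a) := by
  classical
  simp only [push_eq_sum_ite, sum_mul, ite_mul, zero_mul]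
  rw [sum_comm]
  simp

lemma sum_push {A B : Type*} [Fintype A] [Fintype B] (f : A → B) (p : A → ℝ) :
    ∑ b, push f p b = ∑ a, p a := by
  simpa using sum_push_mul f p (fun _ => 1)

lemma push_push {A B C : Type*} [Fintype A] [Fintype B] (f : A → B) (g : B → C) (p : A → ℝ) :
    push g (push f p) = push (fun a => g (f a)) p := by
  classical
  funext c
  rw [push_eq_sum_ite, push_eq_sum_ite]
  have := sum_push_mul f p (fun b => if g b = c then 1 else 0)
  simpa using this

/-- Relative entropy `∑ p log (p / q)`. -/
def kl {A : Type*} [Fintype A] (p q : A → ℝ) : ℝ := ∑ a, p a * Real.log (p a / q a)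

/-- The log-sum inequality. -/
lemma log_sum_le {ι : Type*} (s : Finset ι) (x y : ι → ℝ) (hx : ∀ i ∈ s, 0 ≤ x i)
    (hy : ∀ i ∈ s, 0 ≤ y i) (h : ∀ i ∈ s, 0 < x i → 0 < y i) :
    (∑ i ∈ s, x i) * Real.log ((∑ i ∈ s, x i) / ∑ i ∈ s, y i) ≤
      ∑ i ∈ s, x i * Real.log (x i / y i) := by
  set X := ∑ i ∈ s, x i with hX
  set Y := ∑ i ∈ s, y i with hY
  rcases (sum_nonneg hx).eq_or_lt' with h0 | h0
  · rw [← hX] at h0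
    rw [h0, zero_mul]
    refine (sum_eq_zero fun i hi => ?_).ge
    rw [(sum_eq_zero_iff_of_nonneg hx).1 h0 i hi, zero_mul]
  rw [← hX] at h0
  have hYpos : 0 < Y := by
    obtain ⟨i, hi, hpos⟩ := (sum_pos_iff_of_nonneg hx).1 h0
    exact (sum_pos_iff_of_nonneg hy).2 ⟨i, hi, h i hi hpos⟩
  -- Tangent-line bound for the logarithm. On summation the linear terms cancel, since $\sum_i x_i =
  -- X$ and $\sum_i y_i\,X/Y = X$.
  have key : ∀ i ∈ s, x i * Real.log (X / Y) + x i - y i * (X / Y) ≤ x i * Real.log (x i / y i) := by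
    intro i hi
    rcases (hx i hi).eq_or_lt' with h1 | h1
    · rw [h1]
      have := mul_nonneg (hy i hi) (div_pos h0 hYpos).le
      linarith
    · have h2 := h i hi h1
      have h3 := Real.log_le_sub_one_of_pos (show 0 < (X / Y) / (x i / y i) by positivity)
      rw [Real.log_div (by positivity) (by positivity)] at h3
      have h4 := mul_le_mul_of_nonneg_left h3 h1.le
      have h5 : x i * ((X / Y) / (x i / y i) - 1) = y i * (X / Y) - x i := by field_simp
      rw [h5] at h4
      linarith
  have := sum_le_sum key
  rw [sum_sub_distrib, sum_add_distrib, ← sum_mul, ← sum_mul, ← hX, ← hY,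
    mul_div_cancel₀ _ hYpos.ne'] at this
  linarith

lemma log_sum_le_two {a b c d : ℝ} (ha : 0 ≤ a) (hb : 0 ≤ b) (hc : 0 ≤ c) (hd : 0 ≤ d)
    (hac : 0 < a → 0 < c) (hbd : 0 < b → 0 < d) :
    (a + b) * Real.log ((a + b) / (c + d)) ≤ a * Real.log (a / c) + b * Real.log (b / d) := by
  have := log_sum_le (univ : Finset (Fin 2)) ![a, b] ![c, d]
    (by simp [Fin.forall_fin_two, ha, hb]) (by simp [Fin.forall_fin_two, hc, hd])
    (by simpa [Fin.forall_fin_two] using ⟨hac, hbd⟩)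
  simpa [Fin.sum_univ_two] using this

/-- The log-sum inequality gives at least $\log(1/\sum q)$, so the reference may have mass below
one. -/
lemma kl_nonneg {A : Type*} [Fintype A] {p q : A → ℝ} (hp : ∀ a, 0 ≤ p a) (hq : ∀ a, 0 ≤ q a)
    (hac : ∀ a, 0 < p a → 0 < q a) (hp1 : ∑ a, p a = 1) (hq1 : ∑ a, q a ≤ 1) : 0 ≤ kl p q := by
  have h := log_sum_le univ p q (fun a _ => hp a) (fun a _ => hq a) (fun a _ => hac a)
  refine le_trans ?_ h
  rw [hp1, one_mul]
  obtain ⟨a, -, ha⟩ := (sum_pos_iff_of_nonneg fun a _ => hp a).1 (hp1 ▸ one_pos : 0 < ∑ a, p a)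
  have hpos : 0 < ∑ a, q a := (sum_pos_iff_of_nonneg fun a _ => hq a).2 ⟨a, mem_univ _, hac a ha⟩
  exact Real.log_nonneg (by rw [le_div_iff₀ hpos]; linarith)

/-- The mutual information of a uniform message and an observation with conditional laws `P m` is
at most the mean relative entropy between `P m` and any reference law. -/
lemma mutualInfo_le_expect_kl {M Z : Type*} [Fintype M] [Nonempty M] [Fintype Z]
    (P : M → Z → ℝ) (q : Z → ℝ) (hP : ∀ m z, 0 ≤ P m z) (hP1 : ∀ m, ∑ z, P m z = 1)
    (hq : ∀ z, 0 ≤ q z) (hq1 : ∑ z, q z ≤ 1) (hac : ∀ m z, 0 < P m z → 0 < q z) :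
    mutualInfo (fun a : M × Z => (Fintype.card M : ℝ)⁻¹ * P a.1 a.2) ≤ 𝔼 m, kl (P m) q := by
  set u : ℝ := (Fintype.card M : ℝ)⁻¹ with hu
  have hupos : 0 < u := by positivity
  set r : Z → ℝ := fun z => ∑ m, u * P m z with hr
  have hr0 : ∀ z, 0 ≤ r z := fun z => sum_nonneg fun m _ => mul_nonneg hupos.le (hP m z)
  have hPr : ∀ m z, 0 < P m z → 0 < r z := fun m z h =>
    (sum_pos_iff_of_nonneg fun m _ => mul_nonneg hupos.le (hP m z)).2
      ⟨m, mem_univ _, mul_pos hupos h⟩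
  have hr1 : ∑ z, r z = 1 := by
    simp only [hr]
    rw [sum_comm]
    simp only [← mul_sum, hP1, hu]
    simp
  have hrq : ∀ z, 0 < r z → 0 < q z := fun z h => by
    obtain ⟨m, -, hm⟩ :=
      (sum_pos_iff_of_nonneg fun m _ => mul_nonneg hupos.le (hP m z)).1 h
    exact hac m z (pos_of_mul_pos_right hm hupos.le)
  have h1 : mutualInfo (fun a : M × Z => u * P a.1 a.2) =
      ∑ m, ∑ z, u * P m z * Real.log (P m z / r z) := by
    unfold mutualInfo
    rw [Fintype.sum_prod_type]
    refine sum_congr rfl fun m _ => sum_congr rfl fun z _ => ?_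
    rw [push_fst, push_snd]
    simp only [← mul_sum, hP1, mul_one]
    rw [mul_div_mul_left _ _ hupos.ne']
    simp only [hr, mul_sum]
  have h2 : 𝔼 m, kl (P m) q = ∑ m, ∑ z, u * P m z * Real.log (P m z / q z) := by
    rw [Fintype.expect_eq_sum_div_card, div_eq_inv_mul, mul_sum]
    simp only [kl, mul_sum, mul_assoc, hu]
  -- Compensation identity: replacing the mean law $r$ by another reference $q$ costs exactly the
  -- divergence of $r$ from $q$, which is nonnegative.
  have h3 : ∑ m, ∑ z, u * P m z * Real.log (P m z / q z) -
      ∑ m, ∑ z, u * P m z * Real.log (P m z / r z) = kl r q := by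
    rw [← sum_sub_distrib]
    simp only [← sum_sub_distrib]
    rw [sum_comm]
    refine sum_congr rfl fun z _ => ?_
    rw [show r z * Real.log (r z / q z) = ∑ m, u * P m z * Real.log (r z / q z) by rw [← sum_mul]]
    refine sum_congr rfl fun m _ => ?_
    rcases (hP m z).eq_or_lt' with h | h
    · simp [h]
    · rw [Real.log_div h.ne' (hac m z h).ne', Real.log_div h.ne' (hPr m z h).ne',
        Real.log_div (hPr m z h).ne' (hac m z h).ne']
      ring
  have h4 := kl_nonneg hr0 hq hrq hr1 hq1
  rw [h1, h2]
  linarith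

/-- Relative entropy of a mixture of products, by the chain rule and convexity. -/
lemma kl_mixture_le {ι A B : Type*} [Fintype ι] [Fintype A] [Fintype B] (c : ι → ℝ)
    (a : ι → A → ℝ) (b : ι → B → ℝ) (qa : A → ℝ) (qb : B → ℝ) (hc : ∀ i, 0 ≤ c i)
    (ha : ∀ i x, 0 ≤ a i x) (hb : ∀ i y, 0 ≤ b i y) (ha1 : ∀ i, ∑ x, a i x = 1)
    (hb1 : ∀ i, ∑ y, b i y = 1) (hqa : ∀ x, 0 ≤ qa x) (hac : ∀ i x, 0 < a i x → 0 < qa x)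
    (hbc : ∀ i y, 0 < b i y → 0 < qb y) :
    kl (fun z : A × B => ∑ i, c i * a i z.1 * b i z.2) (fun z => qa z.1 * qb z.2) ≤
      kl (fun y => ∑ i, c i * b i y) qb + ∑ i, c i * kl (a i) qa := by
  set β : B → ℝ := fun y => ∑ i, c i * b i y with hβ
  have hterm : ∀ x y, (∑ i, c i * a i x * b i y) *
      Real.log ((∑ i, c i * a i x * b i y) / (qa x * qb y)) ≤
      (∑ i, c i * a i x * b i y) * Real.log (β y / qb y) +
        ∑ i, c i * b i y * (a i x * Real.log (a i x / qa x)) := by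
    intro x y
    have hn : ∀ i ∈ univ, 0 ≤ c i * a i x * b i y := fun i _ =>
      mul_nonneg (mul_nonneg (hc i) (ha i x)) (hb i y)
    have hcpos : ∀ i, 0 < c i * a i x * b i y → 0 < c i ∧ 0 < a i x ∧ 0 < b i y := fun i h =>
      have h1 := (hc i).lt_of_ne' (fun h0 => by simp [h0] at h)
      have h2 := (ha i x).lt_of_ne' (fun h0 => by simp [h0] at h)
      have h3 := (hb i y).lt_of_ne' (fun h0 => by simp [h0] at h)
      ⟨h1, h2, h3⟩
    -- For fixed $y$ the conditional law of $x$ is a mixture of the `a i` with weights proportional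
    -- to $c_i b_i(y)$, and the log-sum inequality is convexity of the divergence for this mixture.
    have h := log_sum_le univ (fun i => c i * a i x * b i y) (fun i => c i * b i y * qa x) hn
      (fun i _ => mul_nonneg (mul_nonneg (hc i) (hb i y)) (hqa x))
      (fun i _ h => by
        obtain ⟨h1, h2, h3⟩ := hcpos i h
        exact mul_pos (mul_pos h1 h3) (hac i x h2))
    have h' : ∑ i, c i * a i x * b i y * Real.log (c i * a i x * b i y / (c i * b i y * qa x)) =
        ∑ i, c i * b i y * (a i x * Real.log (a i x / qa x)) := by
      refine sum_congr rfl fun i _ => ?_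
      rcases (hn i (mem_univ _)).eq_or_lt' with h0 | h0
      · rw [h0, zero_mul]
        linear_combination (-Real.log (a i x / qa x)) * h0
      · obtain ⟨h1, h2, h3⟩ := hcpos i h0
        rw [show c i * a i x * b i y / (c i * b i y * qa x) = a i x / qa x by field_simp]
        ring
    rw [h', ← sum_mul] at h
    rcases (sum_nonneg hn).eq_or_lt' with h0 | h0
    · rw [h0] at h ⊢
      simpa using h
    · obtain ⟨i, -, hi⟩ := (sum_pos_iff_of_nonneg hn).1 h0
      obtain ⟨h1, h2, h3⟩ := hcpos i hi
      have hqx := hac i x h2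
      have hqy := hbc i y h3
      have hβy : 0 < β y := (sum_pos_iff_of_nonneg fun i _ => mul_nonneg (hc i) (hb i y)).2
        ⟨i, mem_univ _, mul_pos h1 h3⟩
      -- Chain rule: the marginal of $y$ is compared with `qb`, the conditional law of $x$ given $y$
      -- with `qa`.
      have e : Real.log ((∑ i, c i * a i x * b i y) / (qa x * qb y)) =
          Real.log (β y / qb y) + Real.log ((∑ i, c i * a i x * b i y) / (β y * qa x)) := by
        rw [← Real.log_mul (by positivity) (by positivity)]
        congr 1
        field_simp
      rw [e, mul_add]
      exact add_le_add le_rfl h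
  unfold kl
  rw [Fintype.sum_prod_type_right]
  refine (sum_le_sum fun y _ => sum_le_sum fun x _ => hterm x y).trans (le_of_eq ?_)
  simp only [sum_add_distrib]
  congr 1
  · refine sum_congr rfl fun y _ => ?_
    rw [← sum_mul, sum_comm]
    simp only [hβ]
    congr 1
    refine sum_congr rfl fun i _ => ?_
    rw [← sum_mul, ← mul_sum, ha1, mul_one]
  · simp only [mul_sum]
    rw [sum_comm' (t' := univ) (s' := fun _ => univ) (by simp)]
    conv_lhs => enter [2, x]; rw [sum_comm]
    rw [sum_comm]
    refine sum_congr rfl fun i _ => sum_congr rfl fun x _ => ?_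
    rw [← sum_mul, ← mul_sum, hb1, mul_one]

/-! ### Continuity of the conditional entropy -/

/-- Conditional entropy `H(M|Z)` of a finite measure. -/
def condEnt {M Z : Type*} [Fintype M] [Fintype Z] (p : M × Z → ℝ) : ℝ :=
  -∑ z, ∑ m, p (m, z) * Real.log (p (m, z) / ∑ m', p (m', z))

section condEnt

lemma sum_pos_of_pos {M Z : Type*} [Fintype M] {p : M × Z → ℝ} (hp : ∀ a, 0 ≤ p a) {m : M} {z : Z} (h : 0 < p (m, z)) :
    0 < ∑ m', p (m', z) :=
  (sum_pos_iff_of_nonneg fun m _ => hp (m, z)).2 ⟨m, mem_univ _, h⟩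

variable {M Z : Type*} [Fintype M] [Fintype Z]

lemma condEnt_nonneg {p : M × Z → ℝ} (hp : ∀ a, 0 ≤ p a) : 0 ≤ condEnt p := by
  refine neg_nonneg.2 (sum_nonpos fun z _ => sum_nonpos fun m _ => ?_)
  refine mul_nonpos_of_nonneg_of_nonpos (hp _) (Real.log_nonpos (div_nonneg (hp _)
    (sum_nonneg fun m _ => hp (m, z))) (div_le_one_of_le₀ ?_ (sum_nonneg fun m _ => hp (m, z))))
  exact single_le_sum (f := fun m => p (m, z)) (fun m _ => hp (m, z)) (mem_univ m)

/-- The uniform law maximizes the entropy for each $z$. The functional is homogeneous of degree one,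
hence the factor $\sum p$ for a measure that is not normalized. -/
lemma condEnt_le {p : M × Z → ℝ} (hp : ∀ a, 0 ≤ p a) :
    condEnt p ≤ (∑ a, p a) * Real.log (Fintype.card M) := by
  rw [condEnt, neg_le, Fintype.sum_prod_type_right, sum_mul, ← sum_neg_distrib]
  refine sum_le_sum fun z _ => ?_
  have h := log_sum_le univ (fun m => p (m, z)) (fun _ => ∑ m', p (m', z)) (fun m _ => hp _)
    (fun _ _ => sum_nonneg fun m _ => hp (m, z)) (fun m _ h => sum_pos_of_pos hp h)
  refine le_trans (le_of_eq ?_) h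
  rw [sum_const, card_univ, nsmul_eq_mul]
  rcases (sum_nonneg fun m (_ : m ∈ univ) => hp (m, z)).eq_or_lt' with h0 | h0
  · simp [h0]
  · rw [div_mul_cancel_right₀ h0.ne', Real.log_inv, mul_neg]

/-- For a homogeneous functional, concavity is superadditivity, and here the two-term log-sum
inequality gives it term by term. -/
lemma condEnt_add_ge {p q : M × Z → ℝ} (hp : ∀ a, 0 ≤ p a) (hq : ∀ a, 0 ≤ q a) :
    condEnt p + condEnt q ≤ condEnt (fun a => p a + q a) := by
  unfold condEnt
  rw [← neg_add, neg_le_neg_iff, ← sum_add_distrib]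
  refine sum_le_sum fun z _ => ?_
  rw [← sum_add_distrib]
  refine sum_le_sum fun m _ => ?_
  rw [sum_add_distrib]
  exact log_sum_le_two (hp _) (hq _) (sum_nonneg fun m _ => hp (m, z))
    (sum_nonneg fun m _ => hq (m, z)) (sum_pos_of_pos hp) (sum_pos_of_pos hq)

/-- Let $D$ tell which of the two measures produced the pair. Then $H(M|Z)\le H(M|Z,D)+H(D|Z)$, and
$H(D|Z)\le H(D)$, which is the binary entropy of the mass of `q`. -/
lemma condEnt_add_le {p q : M × Z → ℝ} (hp : ∀ a, 0 ≤ p a) (hq : ∀ a, 0 ≤ q a)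
    (h1 : ∑ a, p a + ∑ a, q a = 1) :
    condEnt (fun a => p a + q a) ≤ condEnt p + condEnt q + Real.binEntropy (∑ a, q a) := by
  have key : ∀ {c b C B : ℝ}, 0 ≤ c → 0 ≤ b → c ≤ C → 0 ≤ B →
      c * Real.log (c / C) + c * Real.log (C / (C + B)) ≤ c * Real.log ((c + b) / (C + B)) := by
    intro c b C B hc hb hC hB
    rcases hc.eq_or_lt' with h0 | h0
    · simp [h0]
    · have hCpos := h0.trans_le hC
      rw [← mul_add, ← Real.log_mul (by positivity) (by positivity)]
      refine mul_le_mul_of_nonneg_left (Real.log_le_log (by positivity) ?_) hc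
      rw [div_mul_div_cancel₀ hCpos.ne']
      gcongr
      linarith
  set P : Z → ℝ := fun z => ∑ m, p (m, z) with hP
  set Q : Z → ℝ := fun z => ∑ m, q (m, z) with hQ
  have hP0 : ∀ z, 0 ≤ P z := fun z => sum_nonneg fun m _ => hp (m, z)
  have hQ0 : ∀ z, 0 ≤ Q z := fun z => sum_nonneg fun m _ => hq (m, z)
  have hPs : ∑ z, P z = ∑ a, p a := (Fintype.sum_prod_type_right (f := p)).symm
  have hQs : ∑ z, Q z = ∑ a, q a := (Fintype.sum_prod_type_right (f := q)).symm
  have hterm : ∀ z, (∑ m, p (m, z) * Real.log (p (m, z) / P z)) +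
      (∑ m, q (m, z) * Real.log (q (m, z) / Q z)) + P z * Real.log (P z / (P z + Q z)) +
      Q z * Real.log (Q z / (P z + Q z)) ≤
      ∑ m, (p (m, z) + q (m, z)) * Real.log ((p (m, z) + q (m, z)) / (P z + Q z)) := by
    intro z
    rw [show P z * Real.log (P z / (P z + Q z)) = ∑ m, p (m, z) * Real.log (P z / (P z + Q z)) by
      rw [← sum_mul], show Q z * Real.log (Q z / (P z + Q z)) =
      ∑ m, q (m, z) * Real.log (Q z / (P z + Q z)) by rw [← sum_mul], ← sum_add_distrib,
      ← sum_add_distrib, ← sum_add_distrib]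
    refine sum_le_sum fun m _ => ?_
    have e1 := key (hp (m, z)) (hq (m, z))
      (single_le_sum (f := fun m => p (m, z)) (fun m _ => hp (m, z)) (mem_univ m)) (hQ0 z)
    have e2 := key (hq (m, z)) (hp (m, z))
      (single_le_sum (f := fun m => q (m, z)) (fun m _ => hq (m, z)) (mem_univ m)) (hP0 z)
    rw [add_comm (q (m, z)) (p (m, z)), add_comm (∑ i, q (i, z)) (P z)] at e2
    rw [add_mul]
    simp only [hP, hQ] at e1 e2 ⊢
    linarith
  have hsum := sum_le_sum fun z (_ : z ∈ univ) => hterm z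
  simp only [sum_add_distrib] at hsum
  -- This and the next inequality are $H(D|Z)\le H(D)$: the log-sum inequality over $z$ against the
  -- total mass one.
  have hPl := log_sum_le univ P (fun z => P z + Q z) (fun z _ => hP0 z)
    (fun z _ => add_nonneg (hP0 z) (hQ0 z)) (fun z _ h => add_pos_of_pos_of_nonneg h (hQ0 z))
  have hQl := log_sum_le univ Q (fun z => P z + Q z) (fun z _ => hQ0 z)
    (fun z _ => add_nonneg (hP0 z) (hQ0 z)) (fun z _ h => add_pos_of_nonneg_of_pos (hP0 z) h)
  rw [sum_add_distrib, hPs, hQs, h1, div_one] at hPl hQl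
  have hbin : Real.binEntropy (∑ a, q a) = -((∑ a, p a) * Real.log (∑ a, p a)) -
      (∑ a, q a) * Real.log (∑ a, q a) := by
    rw [Real.binEntropy, show 1 - ∑ a, q a = ∑ a, p a by linarith, Real.log_inv, Real.log_inv]
    ring
  rw [hbin]
  unfold condEnt
  simp only [sum_add_distrib]
  simp only [hP, hQ] at hsum hPl hQl
  linarith

lemma mutualInfo_eq_sub_condEnt [Nonempty M] {p : M × Z → ℝ} (hp : ∀ a, 0 ≤ p a)
    (hM : ∀ m, ∑ z, p (m, z) = (Fintype.card M : ℝ)⁻¹) :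
    mutualInfo p = Real.log (Fintype.card M) - condEnt p := by
  have h1 : ∑ a, p a = 1 := by
    rw [Fintype.sum_prod_type]
    simp [hM]
  unfold mutualInfo condEnt
  rw [sub_neg_eq_add, ← one_mul (Real.log (Fintype.card M)), ← h1, sum_mul,
    ← Fintype.sum_prod_type_right (f := fun a : M × Z =>
      p a * Real.log (p a / ∑ m', p (m', a.2))), ← sum_add_distrib]
  refine sum_congr rfl fun a _ => ?_
  rw [push_fst, push_snd, hM]
  rcases (hp a).eq_or_lt' with h0 | h0
  · simp [h0]
  · have h2 : 0 < ∑ m', p (m', a.2) := sum_pos_of_pos (m := a.1) (z := a.2) hp h0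
    have h3 : (0 : ℝ) < Fintype.card M := by positivity
    rw [← mul_add, ← Real.log_mul h3.ne' (div_pos h0 h2).ne']
    congr 2
    field_simp

/-- Two joint laws of a uniform message and an observation that share all but a mass `δ` have
mutual informations that differ by at most `h(δ) + δ log M`. -/
lemma mutualInfo_le_add_of_common [Nonempty M] {p p' c : M × Z → ℝ} (hc : ∀ a, 0 ≤ c a)
    (hcp : ∀ a, c a ≤ p a) (hcp' : ∀ a, c a ≤ p' a)
    (hM : ∀ m, ∑ z, p (m, z) = (Fintype.card M : ℝ)⁻¹)
    (hM' : ∀ m, ∑ z, p' (m, z) = (Fintype.card M : ℝ)⁻¹) {η : ℝ} (hη : 1 - ∑ a, c a ≤ η) :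
    mutualInfo p ≤ mutualInfo p' + keyErrorTerm η (Fintype.card M) := by
  have hp : ∀ a, 0 ≤ p a := fun a => (hc a).trans (hcp a)
  have hp' : ∀ a, 0 ≤ p' a := fun a => (hc a).trans (hcp' a)
  have h1 : ∑ a, p' a = 1 := by
    rw [Fintype.sum_prod_type]
    simp [hM']
  set δ := 1 - ∑ a, c a with hδ
  have hb : ∀ a, 0 ≤ p' a - c a := fun a => sub_nonneg.2 (hcp' a)
  have hbs : ∑ a, (p' a - c a) = δ := by rw [sum_sub_distrib, h1]
  have hδ0 : 0 ≤ δ := hbs ▸ sum_nonneg fun a _ => hb a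
  have hδ1 : δ ≤ 1 := by
    have := sum_nonneg fun a (_ : a ∈ univ) => hc a
    linarith
  -- Write $p=c+a$ and $p'=c+b$, where $a$ and $b$ have mass $\delta$. Then $H(p)\ge H(c)$, and
  -- $H(p')\le H(c)+\delta\log M+h(\delta)$.
  have e1 := condEnt_add_ge hc (fun a => sub_nonneg.2 (hcp a))
  have e2 := condEnt_nonneg (fun a => sub_nonneg.2 (hcp a))
  have e3 := condEnt_add_le hc hb (by rw [hbs]; linarith)
  have e4 := condEnt_le hb
  simp only [add_sub_cancel] at e1 e3
  rw [hbs] at e3 e4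
  have hlog : 0 ≤ Real.log (Fintype.card M) := Real.log_natCast_nonneg _
  have e5 : δ * Real.log (Fintype.card M) ≤ η * Real.log (Fintype.card M) :=
    mul_le_mul_of_nonneg_right hη hlog
  -- The binary entropy increases only up to $1/2$; beyond that point its maximum $\log 2=h(1/2)$ is
  -- used, hence the minimum with $1/2$.
  have e6 : Real.binEntropy δ ≤ Real.binEntropy (min η (1 / 2)) := by
    rcases le_total δ (1 / 2) with h | h
    · have hm : min η (1 / 2) ∈ Set.Icc (0 : ℝ) 2⁻¹ :=
        ⟨le_min (hδ0.trans hη) (by norm_num), (min_le_right _ _).trans (by norm_num)⟩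
      exact Real.binEntropy_strictMonoOn.monotoneOn ⟨hδ0, by linarith⟩ hm (le_min hη h)
    · rw [min_eq_right (h.trans hη), one_div, Real.binEntropy_two_inv]
      exact Real.binEntropy_le_log_two
  -- One binary entropy suffices for the estimate; the second one in `keyErrorTerm` is nonnegative
  -- slack.
  have e7 : 0 ≤ Real.binEntropy (min η (1 / 2)) :=
    (Real.binEntropy_nonneg hδ0 hδ1).trans e6
  rw [mutualInfo_eq_sub_condEnt hp hM, mutualInfo_eq_sub_condEnt hp' hM']
  unfold keyErrorTerm
  linarith

end condEnt

/-! ### Selection of a code -/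

/-- Among finitely many nonnegative quantities, some outcome of positive weight has all of them
within the factor `card ι` of their means. -/
lemma exists_le_card_mul_mean {ι Ω : Type*} [Fintype ι] [Nonempty ι] [Fintype Ω] (p : Ω → ℝ)
    (hp : ∀ ω, 0 ≤ p ω) (hp1 : ∑ ω, p ω = 1) (X : ι → Ω → ℝ)
    (hX : ∀ i ω, 0 < p ω → 0 ≤ X i ω) :
    ∃ ω, 0 < p ω ∧ ∀ i, X i ω ≤ Fintype.card ι * ∑ ω', p ω' * X i ω' := by
  set E : ι → ℝ := fun i => ∑ ω', p ω' * X i ω' with hE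
  have hterm : ∀ i ω, 0 ≤ p ω * X i ω := fun i ω => by
    rcases (hp ω).eq_or_lt' with h | h
    · simp [h]
    · exact mul_nonneg h.le (hX i ω h)
  have hE0 : ∀ i, 0 ≤ E i := fun i => sum_nonneg fun ω _ => hterm i ω
  by_contra! hcon
  -- If every outcome violated some bound, the normalized sum $\sum_i X_i/E_i$ would exceed `card ι`
  -- at every outcome of positive weight, whereas its mean is at most `card ι`.
  have hlt : ∀ ω, 0 < p ω → (Fintype.card ι : ℝ) < ∑ i, X i ω / E i := by
    intro ω hω
    obtain ⟨i, hi⟩ := hcon ω hω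
    have hEi : 0 < E i := by
      -- A quantity of mean zero vanishes at every outcome of positive weight, so its bound cannot
      -- be the violated one.
      refine (hE0 i).lt_of_ne' fun h0 => ?_
      have h2 := (sum_eq_zero_iff_of_nonneg fun ω _ => hterm i ω).1 h0 ω (mem_univ _)
      have h3 : X i ω = 0 := by
        rcases mul_eq_zero.1 h2 with h | h
        · exact absurd h hω.ne'
        · exact h
      have h4 : E i = ∑ ω', p ω' * X i ω' := rfl
      rw [← h4, h0, mul_zero, h3] at hi
      exact lt_irrefl _ hi
    calc (Fintype.card ι : ℝ) < X i ω / E i := by rwa [lt_div_iff₀ hEi]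
      _ ≤ _ := single_le_sum (f := fun i => X i ω / E i)
        (fun i _ => div_nonneg (hX i ω hω) (hE0 i)) (mem_univ i)
  obtain ⟨ω₀, -, hω₀⟩ :=
    (sum_pos_iff_of_nonneg fun ω _ => hp ω).1 (hp1 ▸ one_pos : 0 < ∑ ω, p ω)
  have h1 : ∑ ω, p ω * (Fintype.card ι : ℝ) < ∑ ω, p ω * ∑ i, X i ω / E i := by
    refine sum_lt_sum (fun ω _ => ?_) ⟨ω₀, mem_univ _, mul_lt_mul_of_pos_left (hlt _ hω₀) hω₀⟩
    rcases (hp ω).eq_or_lt' with h | h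
    · simp [h]
    · exact mul_le_mul_of_nonneg_left (hlt ω h).le h.le
  have h2 : ∑ ω, p ω * ∑ i, X i ω / E i ≤ Fintype.card ι := by
    simp only [mul_sum]
    rw [sum_comm]
    calc ∑ i, ∑ ω, p ω * (X i ω / E i) = ∑ i, E i / E i := by
          refine sum_congr rfl fun i _ => ?_
          simp only [← mul_div_assoc, ← sum_div, hE]
      -- The quotient is 1, or 0 by the convention for division when the mean vanishes.
      _ ≤ ∑ _i : ι, (1 : ℝ) := sum_le_sum fun i _ => div_self_le_one _
      _ = _ := by simp
  rw [← sum_mul, hp1, one_mul] at h1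
  linarith

/-! ### Product laws and random codes -/

/-- The law of independent letters with common law `p`. -/
def prodLaw {I V : Type*} [Fintype I] (p : V → ℝ) (c : I → V) : ℝ := ∏ i, p (c i)

lemma prodLaw_nonneg {I V : Type*} [Fintype I] {p : V → ℝ} (hp : ∀ v, 0 ≤ p v) (c : I → V) :
    0 ≤ prodLaw p c :=
  prod_nonneg fun _ _ => hp _

lemma pos_of_prodLaw_pos {I V : Type*} [Fintype I] {p : V → ℝ} (hp : ∀ v, 0 ≤ p v) {c : I → V}
    (h : 0 < prodLaw p c) (i : I) : 0 < p (c i) :=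
  (hp _).lt_of_ne' fun h0 => h.ne' (prod_eq_zero (mem_univ i) h0)

lemma sum_prod_eq_prod_sum {I V R : Type*} [CommSemiring R] [Fintype I] [DecidableEq I] [Fintype V]
    (f : I → V → R) : ∑ c : I → V, ∏ i, f i (c i) = ∏ i, ∑ v, f i v :=
  (Fintype.prod_sum f).symm

lemma sum_prodLaw {I V : Type*} [Fintype I] [DecidableEq I] [Fintype V] {p : V → ℝ}
    (hp : ∑ v, p v = 1) : ∑ c : I → V, prodLaw p c = 1 := by
  simp only [prodLaw]
  rw [sum_prod_eq_prod_sum]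
  simp [hp]

/-- Exchanging letter `i` of the word with the extra letter is an involution on pairs. -/
lemma sum_update_swap {I V : Type*} [Fintype I] [DecidableEq I] [Fintype V] (i : I)
    (F : (I → V) → V → ℝ) :
    ∑ c : I → V, ∑ v, F (Function.update c i v) (c i) = ∑ c : I → V, ∑ v, F c v := by
  have hinv : Function.Involutive
      (fun x : (I → V) × V => (Function.update x.1 i x.2, x.1 i)) := by
    rintro ⟨c, v⟩
    simp
  rw [← Fintype.sum_prod_type' (f := fun (c : I → V) v => F (Function.update c i v) (c i)),
    ← Fintype.sum_prod_type' (f := F)]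
  exact Equiv.sum_comp hinv.toPerm (fun x : (I → V) × V => F x.1 x.2)

/-- A letter of a random word may be drawn afresh. -/
lemma sum_prodLaw_resample {I V : Type*} [Fintype I] [DecidableEq I] [Fintype V] {p : V → ℝ}
    (hp : ∑ v, p v = 1) (i : I) (f : (I → V) → ℝ) :
    ∑ c, prodLaw p c * f c =
      ∑ c : I → V, prodLaw p c * ∑ v, p v * f (Function.update c i v) := by
  have h := sum_update_swap i (fun (c : I → V) v => prodLaw p c * p v * f c)
  have h1 : ∑ c : I → V, ∑ v, prodLaw p c * p v * f c = ∑ c, prodLaw p c * f c := by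
    refine sum_congr rfl fun c _ => ?_
    rw [← sum_mul, ← mul_sum, hp, mul_one]
  rw [← h1, ← h]
  refine sum_congr rfl fun c _ => ?_
  rw [mul_sum]
  refine sum_congr rfl fun v _ => ?_
  -- The joint weight of the word and the fresh letter is invariant under their exchange.
  have h2 : prodLaw p (Function.update c i v) * p (c i) = prodLaw p c * p v := by
    simp only [prodLaw]
    rw [← mul_prod_erase univ _ (mem_univ i), ← mul_prod_erase univ (fun j => p (c j)) (mem_univ i),
      Function.update_self]
    have h3 : ∏ j ∈ univ.erase i, p (Function.update c i v j) = ∏ j ∈ univ.erase i, p (c j) :=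
      prod_congr rfl fun j hj => by rw [Function.update_of_ne (ne_of_mem_erase hj)]
    rw [h3]
    ring
  rw [h2]
  ring

lemma sum_prodLaw_eval {I V : Type*} [Fintype I] [DecidableEq I] [Fintype V] {p : V → ℝ}
    (hp : ∑ v, p v = 1) (i : I) (f : V → ℝ) :
    ∑ c : I → V, prodLaw p c * f (c i) = ∑ v, p v * f v := by
  rw [sum_prodLaw_resample hp i (fun c => f (c i))]
  simp only [Function.update_self]
  rw [← sum_mul, sum_prodLaw hp, one_mul]

lemma sum_prodLaw_update_eval {I V : Type*} [Fintype I] [DecidableEq I] [Fintype V] {p : V → ℝ}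
    (hp : ∑ v, p v = 1) (i j : I) (v : V) (f : V → ℝ) :
    ∑ c : I → V, prodLaw p c * f (Function.update c i v j) =
      if j = i then f v else ∑ v, p v * f v := by
  split_ifs with h
  · subst h
    simp only [Function.update_self]
    rw [← sum_mul, sum_prodLaw hp, one_mul]
  · simp only [Function.update_of_ne h]
    exact sum_prodLaw_eval hp j f

/-! ### Maximum likelihood decoding of a random code -/

/-- Gallager's bound for the error probability of maximum likelihood decoding. -/
lemma sum_prodLaw_mlError_le {I V Y : Type*} [Fintype I] [DecidableEq I] [Fintype V] [Fintype Y]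
    {p : V → ℝ} (hp0 : ∀ v, 0 ≤ p v) (hp : ∑ v, p v = 1) {w : V → Y → ℝ}
    (hw : ∀ v y, 0 ≤ w v y) (dec : (I → V) → Y → I)
    (hdec : ∀ (c : I → V) y j, w (c j) y ≤ w (c (dec c y)) y) {s : ℝ} (hs : 0 < s) (hs1 : s ≤ 1) (i : I) :
    ∑ c : I → V, prodLaw p c * ∑ y, w (c i) y * (if dec c y ≠ i then 1 else 0) ≤
      (Fintype.card I : ℝ) ^ s * ∑ y, (∑ v, p v * w v y ^ (1 / (1 + s))) ^ (1 + s) := by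
  set α := 1 / (1 + s) with hα
  have hαpos : 0 < α := by positivity
  have hαs : α + α * s = 1 := by rw [hα]; field_simp
  simp only [mul_sum]
  rw [sum_comm]
  refine sum_le_sum fun y _ => ?_
  set g := ∑ v, p v * w v y ^ α with hg
  have hg0 : 0 ≤ g := sum_nonneg fun v _ => mul_nonneg (hp0 v) (Real.rpow_nonneg (hw v y) _)
  have hS0 : ∀ c : I → V, 0 ≤ ∑ j ∈ univ.erase i, w (c j) y ^ α := fun c =>
    sum_nonneg fun j _ => Real.rpow_nonneg (hw _ _) _
  -- On an error a wrong codeword is at least as likely as codeword `i`. The likelihood splits as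
  -- $w^\alpha(w^\alpha)^s$ because $\alpha(1+s)=1$, and the second factor is bounded by the sum
  -- over all wrong codewords.
  have h1 : ∀ c : I → V, w (c i) y * (if dec c y ≠ i then 1 else 0) ≤
      w (c i) y ^ α * (∑ j ∈ univ.erase i, w (c j) y ^ α) ^ s := by
    intro c
    split_ifs with h
    · calc w (c i) y * 1 = w (c i) y ^ α * (w (c i) y ^ α) ^ s := by
            rw [← Real.rpow_mul (hw _ _), ← Real.rpow_add_of_nonneg (hw _ _) hαpos.le
              (by positivity), hαs, Real.rpow_one, mul_one]
        _ ≤ w (c i) y ^ α * (∑ j ∈ univ.erase i, w (c j) y ^ α) ^ s := by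
            refine mul_le_mul_of_nonneg_left (Real.rpow_le_rpow (Real.rpow_nonneg (hw _ _) _) ?_
              hs.le) (Real.rpow_nonneg (hw _ _) _)
            refine (Real.rpow_le_rpow (hw _ _) (hdec c y i) hαpos.le).trans ?_
            exact single_le_sum (f := fun j => w (c j) y ^ α)
              (fun j _ => Real.rpow_nonneg (hw _ _) _) (mem_erase.2 ⟨h, mem_univ _⟩)
    · rw [mul_zero]
      exact mul_nonneg (Real.rpow_nonneg (hw _ _) _) (Real.rpow_nonneg (hS0 c) _)
  calc ∑ c : I → V, prodLaw p c * (w (c i) y * (if dec c y ≠ i then 1 else 0))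
      ≤ ∑ c : I → V, prodLaw p c *
          (w (c i) y ^ α * (∑ j ∈ univ.erase i, w (c j) y ^ α) ^ s) :=
        sum_le_sum fun c _ => mul_le_mul_of_nonneg_left (h1 c) (prodLaw_nonneg hp0 c)
    -- Codeword `i` is independent of the others, so its factor averages to `g`.
    _ = g * ∑ c : I → V, prodLaw p c * (∑ j ∈ univ.erase i, w (c j) y ^ α) ^ s := by
        rw [sum_prodLaw_resample hp i, mul_sum]
        refine sum_congr rfl fun c _ => ?_
        have h2 : ∀ v, ∑ j ∈ univ.erase i, w (Function.update c i v j) y ^ α =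
            ∑ j ∈ univ.erase i, w (c j) y ^ α := fun v =>
          sum_congr rfl fun j hj => by rw [Function.update_of_ne (ne_of_mem_erase hj)]
        simp only [h2, Function.update_self, ← mul_assoc]
        rw [← sum_mul]
        ring
    -- Jensen's inequality for the concave power $s\le1$.
    _ ≤ g * (∑ c : I → V, prodLaw p c * ∑ j ∈ univ.erase i, w (c j) y ^ α) ^ s := by
        refine mul_le_mul_of_nonneg_left ?_ hg0
        have := (Real.concaveOn_rpow hs.le hs1).le_map_sum (t := univ) (w := prodLaw p)
          (p := fun c : I → V => ∑ j ∈ univ.erase i, w (c j) y ^ α)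
          (fun c _ => prodLaw_nonneg hp0 c) (sum_prodLaw hp) (fun c _ => hS0 c)
        simpa only [smul_eq_mul] using this
    _ = g * ((univ.erase i).card * g) ^ s := by
        simp only [mul_sum (univ.erase i)]
        rw [sum_comm]
        simp only [sum_prodLaw_eval hp _ (fun v => w v y ^ α)]
        rw [sum_const, nsmul_eq_mul]
    _ ≤ g * (Fintype.card I * g) ^ s := by
        gcongr
        exact card_le_univ _
    _ = (Fintype.card I : ℝ) ^ s * g ^ (1 + s) := by
        rw [Real.mul_rpow (by positivity) hg0, Real.rpow_add_of_nonneg hg0 (by positivity) hs.le,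
          Real.rpow_one]
        ring

/-! ### Channel resolvability of a random code with two encoders -/

/-- Apply $\log t\le (t^s-1)/s$; subadditivity of $t\mapsto t^s$ for $s\le1$ then lets the leading 1
cancel. -/
lemma log_one_add_le {s x y z : ℝ} (hs : 0 < s) (hs1 : s ≤ 1) (hx : 0 ≤ x) (hy : 0 ≤ y)
    (hz : 0 ≤ z) : Real.log (1 + x + y + z) ≤ 1 / s * (x ^ s + y ^ s + z ^ s) := by
  have h1 : (1 + x + y + z) ^ s ≤ 1 + x ^ s + y ^ s + z ^ s := by
    calc (1 + x + y + z) ^ s ≤ (1 + x + y) ^ s + z ^ s :=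
          Real.rpow_add_le_add_rpow (by positivity) hz hs.le hs1
      _ ≤ (1 + x) ^ s + y ^ s + z ^ s := by
          gcongr
          exact Real.rpow_add_le_add_rpow (by positivity) hy hs.le hs1
      _ ≤ 1 ^ s + x ^ s + y ^ s + z ^ s := by
          gcongr
          exact Real.rpow_add_le_add_rpow zero_le_one hx hs.le hs1
      _ = _ := by rw [Real.one_rpow]
  have hpos : 0 < (1 + x + y + z) ^ s := by positivity
  have h2 := Real.log_le_sub_one_of_pos hpos
  rw [Real.log_rpow (by positivity)] at h2
  rw [one_div, inv_mul_eq_div, le_div_iff₀ hs]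
  linarith

/-- Jensen's inequality from the tangent of the logarithm at $\mu$, which only needs to bound the
mean from above. -/
lemma sum_mul_log_le {Ω : Type*} [Fintype Ω] {p X : Ω → ℝ} (hp0 : ∀ ω, 0 ≤ p ω)
    (hp : ∑ ω, p ω = 1) (hX : ∀ ω, 0 < X ω) {μ : ℝ} (hμ : 0 < μ) (h : ∑ ω, p ω * X ω ≤ μ) :
    ∑ ω, p ω * Real.log (X ω) ≤ Real.log μ := by
  have h1 : ∀ ω, p ω * Real.log (X ω) ≤ p ω * Real.log μ + (p ω * X ω) / μ - p ω := by
    intro ω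
    have := Real.log_le_sub_one_of_pos (div_pos (hX ω) hμ)
    rw [Real.log_div (hX ω).ne' hμ.ne'] at this
    have h2 := mul_le_mul_of_nonneg_left this (hp0 ω)
    rw [mul_div_assoc]
    linarith
  have h3 := sum_le_sum fun ω (_ : ω ∈ univ) => h1 ω
  rw [sum_sub_distrib, sum_add_distrib, ← sum_mul, ← sum_div, hp] at h3
  have h4 : (∑ ω, p ω * X ω) / μ ≤ 1 := (div_le_one hμ).2 h
  linarith

lemma expect_ite_eq_div {B : Type*} [Fintype B] [DecidableEq B] (b : B) (x : ℝ) :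
    𝔼 b', (if b' = b then x else 0) = x / Fintype.card B := by
  rw [Fintype.expect_eq_sum_div_card]
  simp

lemma sum_mul_sum_mul_expect {C₁ C₂ B₁ B₂ : Type*} [Fintype C₁] [Fintype C₂] [Fintype B₁]
    [Fintype B₂] (p₁ : C₁ → ℝ) (p₂ : C₂ → ℝ) (F : C₁ → C₂ → B₁ → B₂ → ℝ) :
    ∑ c₁, p₁ c₁ * ∑ c₂, p₂ c₂ * (𝔼 b₁, 𝔼 b₂, F c₁ c₂ b₁ b₂) =
      𝔼 b₁, 𝔼 b₂, ∑ c₁, p₁ c₁ * ∑ c₂, p₂ c₂ * F c₁ c₂ b₁ b₂ := by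
  simp only [mul_expect, ← expect_sum_comm]

section Resolvability

variable {V₁ V₂ Z : Type*} [Fintype V₁] [Fintype V₂]

/-- Marginal channel from the first input. -/
def chanFst (p₂ : V₂ → ℝ) (w : V₁ → V₂ → Z → ℝ) (v₁ : V₁) (z : Z) : ℝ := ∑ v₂, p₂ v₂ * w v₁ v₂ z

/-- Marginal channel from the second input. -/
def chanSnd (p₁ : V₁ → ℝ) (w : V₁ → V₂ → Z → ℝ) (v₂ : V₂) (z : Z) : ℝ := ∑ v₁, p₁ v₁ * w v₁ v₂ z

/-- Output law for independent inputs. -/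
def outLaw (p₁ : V₁ → ℝ) (p₂ : V₂ → ℝ) (w : V₁ → V₂ → Z → ℝ) (z : Z) : ℝ :=
  ∑ v₁, p₁ v₁ * chanFst p₂ w v₁ z

/-- The sum `∑ p(v) w(z|v) (w(z|v) / q(z)) ^ s`. -/
def infoSum {V Z : Type*} [Fintype V] [Fintype Z] (s : ℝ) (p : V → ℝ) (w : V → Z → ℝ) (q : Z → ℝ) : ℝ :=
  ∑ v, p v * ∑ z, w v z * (w v z / q z) ^ s

/-- The three resolvability terms for `b₁` and `b₂` values of the randomization. -/
def resolvTerm [Fintype Z] (s : ℝ) (p₁ : V₁ → ℝ) (p₂ : V₂ → ℝ) (w : V₁ → V₂ → Z → ℝ) (b₁ b₂ : ℝ) : ℝ :=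
  infoSum s p₁ (chanFst p₂ w) (outLaw p₁ p₂ w) / b₁ ^ s +
  infoSum s p₂ (chanSnd p₁ w) (outLaw p₁ p₂ w) / b₂ ^ s +
  infoSum s (fun v : V₁ × V₂ => p₁ v.1 * p₂ v.2) (fun v => w v.1 v.2) (outLaw p₁ p₂ w) /
    (b₁ * b₂) ^ s

lemma chanFst_nonneg {V₁ V₂ Z : Type*} [Fintype V₂] {p₂ : V₂ → ℝ} {w : V₁ → V₂ → Z → ℝ}
    (hp₂ : ∀ v, 0 ≤ p₂ v) (hw : ∀ v₁ v₂ z, 0 ≤ w v₁ v₂ z) (v₁ : V₁) (z : Z) :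
    0 ≤ chanFst p₂ w v₁ z :=
  sum_nonneg fun v _ => mul_nonneg (hp₂ v) (hw _ v z)

lemma chanSnd_nonneg {V₁ V₂ Z : Type*} [Fintype V₁] {p₁ : V₁ → ℝ} {w : V₁ → V₂ → Z → ℝ}
    (hp₁ : ∀ v, 0 ≤ p₁ v) (hw : ∀ v₁ v₂ z, 0 ≤ w v₁ v₂ z) (v₂ : V₂) (z : Z) :
    0 ≤ chanSnd p₁ w v₂ z :=
  sum_nonneg fun v _ => mul_nonneg (hp₁ v) (hw v _ z)

variable {p₁ : V₁ → ℝ} {p₂ : V₂ → ℝ} {w : V₁ → V₂ → Z → ℝ}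

lemma outLaw_nonneg (hp₁ : ∀ v, 0 ≤ p₁ v) (hp₂ : ∀ v, 0 ≤ p₂ v) (hw : ∀ v₁ v₂ z, 0 ≤ w v₁ v₂ z)
    (z : Z) : 0 ≤ outLaw p₁ p₂ w z :=
  sum_nonneg fun v _ => mul_nonneg (hp₁ v) (chanFst_nonneg hp₂ hw v z)

lemma outLaw_pos (hp₁ : ∀ v, 0 ≤ p₁ v) (hp₂ : ∀ v, 0 ≤ p₂ v) (hw : ∀ v₁ v₂ z, 0 ≤ w v₁ v₂ z)
    {v₁ : V₁} {v₂ : V₂} {z : Z} (h₁ : 0 < p₁ v₁) (h₂ : 0 < p₂ v₂) (h : 0 < w v₁ v₂ z) :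
    0 < outLaw p₁ p₂ w z := by
  refine (sum_pos_iff_of_nonneg fun v _ => mul_nonneg (hp₁ v) (chanFst_nonneg hp₂ hw v z)).2
    ⟨v₁, mem_univ _, mul_pos h₁ ?_⟩
  exact (sum_pos_iff_of_nonneg fun v _ => mul_nonneg (hp₂ v) (hw _ v z)).2
    ⟨v₂, mem_univ _, mul_pos h₂ h⟩

lemma outLaw_eq_sum_chanSnd (z : Z) : outLaw p₁ p₂ w z = ∑ v₂, p₂ v₂ * chanSnd p₁ w v₂ z := by
  simp only [outLaw, chanFst, chanSnd, mul_sum]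
  rw [sum_comm]
  exact sum_congr rfl fun _ _ => sum_congr rfl fun _ _ => by ring

lemma sum_outLaw [Fintype Z] (hp₁ : ∑ v, p₁ v = 1) (hp₂ : ∑ v, p₂ v = 1) (hw : ∀ v₁ v₂, ∑ z, w v₁ v₂ z = 1) :
    ∑ z, outLaw p₁ p₂ w z = 1 := by
  simp only [outLaw, chanFst, mul_sum]
  rw [sum_comm]
  simp_rw [sum_comm (s := (univ : Finset Z)), ← mul_sum, hw, mul_one, hp₂, mul_one, hp₁]

variable {I₁ I₂ B₁ B₂ : Type*} [Fintype I₁] [Fintype I₂] [DecidableEq I₁] [DecidableEq I₂]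
  [Fintype B₁] [Fintype B₂] [Nonempty B₁] [Nonempty B₂]

/-- The mean output law of the randomized encoders when one codeword of each is fixed. -/
lemma sum_prodLaw_mixture_le [DecidableEq B₁] [DecidableEq B₂]
    (hp₁ : ∀ v, 0 ≤ p₁ v) (hp₁s : ∑ v, p₁ v = 1) (hp₂ : ∀ v, 0 ≤ p₂ v) (hp₂s : ∑ v, p₂ v = 1)
    (hw : ∀ v₁ v₂ z, 0 ≤ w v₁ v₂ z) {β₁ : B₁ → I₁} {β₂ : B₂ → I₂} (hβ₁ : Function.Injective β₁)
    (hβ₂ : Function.Injective β₂) (b₁ : B₁) (b₂ : B₂) (v₁ : V₁) (v₂ : V₂) (z : Z) :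
    ∑ c₁ : I₁ → V₁, prodLaw p₁ c₁ * ∑ c₂ : I₂ → V₂, prodLaw p₂ c₂ * (𝔼 b₁', 𝔼 b₂',
      w (Function.update c₁ (β₁ b₁) v₁ (β₁ b₁')) (Function.update c₂ (β₂ b₂) v₂ (β₂ b₂')) z) ≤
    outLaw p₁ p₂ w z + w v₁ v₂ z / (Fintype.card B₁ * Fintype.card B₂) +
      chanFst p₂ w v₁ z / Fintype.card B₁ + chanSnd p₁ w v₂ z / Fintype.card B₂ := by
  have h1 : ∀ b₁' b₂', ∑ c₁ : I₁ → V₁, prodLaw p₁ c₁ * ∑ c₂ : I₂ → V₂, prodLaw p₂ c₂ *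
      w (Function.update c₁ (β₁ b₁) v₁ (β₁ b₁')) (Function.update c₂ (β₂ b₂) v₂ (β₂ b₂')) z ≤
      outLaw p₁ p₂ w z + (if b₁' = b₁ then if b₂' = b₂ then w v₁ v₂ z else 0 else 0) +
        (if b₁' = b₁ then chanFst p₂ w v₁ z else 0) +
        (if b₂' = b₂ then chanSnd p₁ w v₂ z else 0) := by
    intro b₁' b₂'
    have hq := outLaw_nonneg hp₁ hp₂ hw z
    have hw1 := chanFst_nonneg hp₂ hw v₁ z
    have hw2 := chanSnd_nonneg hp₁ hw v₂ z
    have hw12 := hw v₁ v₂ z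
    simp_rw [fun v => sum_prodLaw_update_eval hp₂s (β₂ b₂) (β₂ b₂') v₂ (fun v₂ => w v v₂ z),
      hβ₂.eq_iff]
    -- Four cases: each uniformly chosen index either hits the fixed codeword or an independent one.
    -- Missing both gives the output law, hitting one gives a marginal channel, hitting both gives
    -- the channel itself. The other terms are nonnegative, so this is only an upper bound.
    split_ifs with e2 e1 e1
    · rw [sum_prodLaw_update_eval hp₁s (β₁ b₁) (β₁ b₁') v₁ (fun v => w v v₂ z), if_pos (by rw [e1])]
      linarith
    · rw [sum_prodLaw_update_eval hp₁s (β₁ b₁) (β₁ b₁') v₁ (fun v => w v v₂ z),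
        if_neg (hβ₁.ne e1)]
      change chanSnd p₁ w v₂ z ≤ _
      linarith
    · rw [sum_prodLaw_update_eval hp₁s (β₁ b₁) (β₁ b₁') v₁ (fun v => ∑ v₂, p₂ v₂ * w v v₂ z),
        if_pos (by rw [e1])]
      change chanFst p₂ w v₁ z ≤ _
      linarith
    · rw [sum_prodLaw_update_eval hp₁s (β₁ b₁) (β₁ b₁') v₁ (fun v => ∑ v₂, p₂ v₂ * w v v₂ z),
        if_neg (hβ₁.ne e1)]
      change outLaw p₁ p₂ w z ≤ _
      linarith
  calc _ = 𝔼 b₁', 𝔼 b₂', ∑ c₁ : I₁ → V₁, prodLaw p₁ c₁ * ∑ c₂ : I₂ → V₂, prodLaw p₂ c₂ *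
        w (Function.update c₁ (β₁ b₁) v₁ (β₁ b₁')) (Function.update c₂ (β₂ b₂) v₂ (β₂ b₂')) z := by
        exact sum_mul_sum_mul_expect _ _ _
    _ ≤ 𝔼 b₁', 𝔼 b₂', (outLaw p₁ p₂ w z +
          (if b₁' = b₁ then if b₂' = b₂ then w v₁ v₂ z else 0 else 0) +
        (if b₁' = b₁ then chanFst p₂ w v₁ z else 0) +
        (if b₂' = b₂ then chanSnd p₁ w v₂ z else 0)) :=
        expect_le_expect fun b₁' _ => expect_le_expect fun b₂' _ => h1 b₁' b₂'
    _ = _ := by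
        have h2 : ∀ b₁', 𝔼 b₂', (if b₁' = b₁ then if b₂' = b₂ then w v₁ v₂ z else 0 else 0) =
            if b₁' = b₁ then w v₁ v₂ z / Fintype.card B₂ else 0 := by
          intro b₁'
          split_ifs
          · rw [expect_ite_eq_div]
          · simp
        simp only [expect_add_distrib, Fintype.expect_const, h2, expect_ite_eq_div]
        rw [div_div, mul_comm (Fintype.card B₂ : ℝ)]

/-- Mean relative entropy between the output of the randomized encoders and the output law. -/
theorem sum_prodLaw_kl_le [Fintype Z] (hp₁ : ∀ v, 0 ≤ p₁ v) (hp₁s : ∑ v, p₁ v = 1) (hp₂ : ∀ v, 0 ≤ p₂ v)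
    (hp₂s : ∑ v, p₂ v = 1) (hw : ∀ v₁ v₂ z, 0 ≤ w v₁ v₂ z) {β₁ : B₁ → I₁} {β₂ : B₂ → I₂}
    (hβ₁ : Function.Injective β₁) (hβ₂ : Function.Injective β₂) {s : ℝ} (hs : 0 < s)
    (hs1 : s ≤ 1) :
    ∑ c₁ : I₁ → V₁, prodLaw p₁ c₁ * ∑ c₂ : I₂ → V₂, prodLaw p₂ c₂ *
      kl (fun z => 𝔼 b₁, 𝔼 b₂, w (c₁ (β₁ b₁)) (c₂ (β₂ b₂)) z) (outLaw p₁ p₂ w) ≤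
    1 / s * resolvTerm s p₁ p₂ w (Fintype.card B₁) (Fintype.card B₂) := by
  classical
  set q := outLaw p₁ p₂ w with hq
  have hq0 : ∀ z, 0 ≤ q z := outLaw_nonneg hp₁ hp₂ hw
  set n₁ : ℝ := (Fintype.card B₁ : ℝ) with hn₁
  set n₂ : ℝ := (Fintype.card B₂ : ℝ) with hn₂
  have hn₁pos : 0 < n₁ := by positivity
  have hn₂pos : 0 < n₂ := by positivity
  set X : (I₁ → V₁) → (I₂ → V₂) → Z → ℝ := fun c₁ c₂ z =>
    𝔼 b₁, 𝔼 b₂, w (c₁ (β₁ b₁)) (c₂ (β₂ b₂)) z with hX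
  -- With the two transmitted codewords fixed, concavity moves the mean over the remaining codewords
  -- inside the logarithm. The mean ratio to `q` is at most one plus three terms, whose powers are
  -- then separated.
  have hinner : ∀ b₁ b₂ v₁ v₂ z, 0 < p₁ v₁ * p₂ v₂ * w v₁ v₂ z →
      ∑ c₁ : I₁ → V₁, prodLaw p₁ c₁ * ∑ c₂ : I₂ → V₂, prodLaw p₂ c₂ *
        Real.log (X (Function.update c₁ (β₁ b₁) v₁) (Function.update c₂ (β₂ b₂) v₂) z / q z) ≤
      1 / s * ((w v₁ v₂ z / (n₁ * n₂) / q z) ^ s + (chanFst p₂ w v₁ z / n₁ / q z) ^ s +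
        (chanSnd p₁ w v₂ z / n₂ / q z) ^ s) := by
    intro b₁ b₂ v₁ v₂ z hpos
    have hwpos : 0 < w v₁ v₂ z := (hw _ _ _).lt_of_ne' fun h => by simp [h] at hpos
    have hp₁pos : 0 < p₁ v₁ := (hp₁ _).lt_of_ne' fun h => by simp [h] at hpos
    have hp₂pos : 0 < p₂ v₂ := (hp₂ _).lt_of_ne' fun h => by simp [h] at hpos
    have hqpos : 0 < q z := outLaw_pos hp₁ hp₂ hw hp₁pos hp₂pos hwpos
    have h1 := chanFst_nonneg hp₂ hw v₁ z
    have h2 := chanSnd_nonneg hp₁ hw v₂ z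
    refine le_trans ?_ (log_one_add_le hs hs1 (by positivity) (by positivity) (by positivity))
    have hsum := sum_mul_log_le (Ω := (I₁ → V₁) × (I₂ → V₂))
      (p := fun c => prodLaw p₁ c.1 * prodLaw p₂ c.2)
      (X := fun c => X (Function.update c.1 (β₁ b₁) v₁) (Function.update c.2 (β₂ b₂) v₂) z / q z)
      (fun c => mul_nonneg (prodLaw_nonneg hp₁ _) (prodLaw_nonneg hp₂ _))
      (by rw [Fintype.sum_prod_type]; simp [← mul_sum, sum_prodLaw hp₁s, sum_prodLaw hp₂s])
      (fun c => div_pos (expect_pos' (fun b _ => expect_nonneg fun b' _ => hw _ _ _)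
        ⟨b₁, mem_univ _, expect_pos' (fun b' _ => hw _ _ _)
          ⟨b₂, mem_univ _, by simpa using hwpos⟩⟩) hqpos)
      (show 0 < 1 + w v₁ v₂ z / (n₁ * n₂) / q z + chanFst p₂ w v₁ z / n₁ / q z +
        chanSnd p₁ w v₂ z / n₂ / q z by positivity)
      (by
        have := sum_prodLaw_mixture_le hp₁ hp₁s hp₂ hp₂s hw hβ₁ hβ₂ b₁ b₂ v₁ v₂ z
        rw [Fintype.sum_prod_type]
        rw [show 1 + w v₁ v₂ z / (n₁ * n₂) / q z + chanFst p₂ w v₁ z / n₁ / q z +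
          chanSnd p₁ w v₂ z / n₂ / q z = (q z + w v₁ v₂ z / (n₁ * n₂) + chanFst p₂ w v₁ z / n₁ +
          chanSnd p₁ w v₂ z / n₂) / q z by field_simp, le_div_iff₀ hqpos, sum_mul]
        refine le_trans (le_of_eq ?_) this
        refine sum_congr rfl fun c₁ _ => ?_
        rw [mul_sum, sum_mul]
        refine sum_congr rfl fun c₂ _ => ?_
        rw [mul_assoc, div_mul_cancel₀ _ hqpos.ne', mul_assoc])
    rw [Fintype.sum_prod_type] at hsum
    refine le_trans (le_of_eq ?_) hsum
    refine sum_congr rfl fun c₁ _ => ?_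
    rw [mul_sum]
    refine sum_congr rfl fun c₂ _ => by rw [mul_assoc]
  have hpair : ∀ b₁ b₂, ∑ c₁ : I₁ → V₁, prodLaw p₁ c₁ * ∑ c₂ : I₂ → V₂, prodLaw p₂ c₂ *
      ∑ z, w (c₁ (β₁ b₁)) (c₂ (β₂ b₂)) z * Real.log (X c₁ c₂ z / q z) ≤
      1 / s * resolvTerm s p₁ p₂ w n₁ n₂ := by
    intro b₁ b₂
    -- The transmitted codewords are redrawn as fresh `v₁` and `v₂`, which decouples the channel
    -- weight from the rest of the code.
    have h1 : ∑ c₁ : I₁ → V₁, prodLaw p₁ c₁ * ∑ c₂ : I₂ → V₂, prodLaw p₂ c₂ *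
        ∑ z, w (c₁ (β₁ b₁)) (c₂ (β₂ b₂)) z * Real.log (X c₁ c₂ z / q z) =
        ∑ v₁, ∑ v₂, ∑ z, p₁ v₁ * p₂ v₂ * w v₁ v₂ z *
          ∑ c₁ : I₁ → V₁, prodLaw p₁ c₁ * ∑ c₂ : I₂ → V₂, prodLaw p₂ c₂ *
          Real.log (X (Function.update c₁ (β₁ b₁) v₁) (Function.update c₂ (β₂ b₂) v₂) z / q z) := by
      rw [sum_prodLaw_resample hp₁s (β₁ b₁)]
      simp_rw [sum_prodLaw_resample hp₂s (β₂ b₂) (fun c₂ => ∑ z, _ * Real.log (X _ c₂ z / q z))]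
      simp only [Function.update_self, mul_sum]
      rw [sum_comm]
      refine sum_congr rfl fun v₁ _ => ?_
      conv_rhs => rw [sum_comm' (t' := univ) (s' := fun _ => univ) (by simp)]
      simp_rw [sum_comm (s := (univ : Finset (I₂ → V₂)))]
      rw [sum_comm]
      conv_lhs => enter [2, v₂]; rw [sum_comm]
      conv_rhs => rw [sum_comm]
      refine sum_congr rfl fun v₂ _ => sum_congr rfl fun z _ => sum_congr rfl fun c₁ _ =>
        sum_congr rfl fun c₂ _ => ?_
      ring
    have hdiv : ∀ {a b c : ℝ}, 0 ≤ a → 0 < b → 0 ≤ c → (a / b / c) ^ s = (a / c) ^ s / b ^ s :=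
      fun ha hb hc => by
        rw [div_right_comm, Real.div_rpow (by positivity) hb.le]
    rw [h1]
    calc _ ≤ ∑ v₁, ∑ v₂, ∑ z, p₁ v₁ * p₂ v₂ * w v₁ v₂ z *
        (1 / s * ((w v₁ v₂ z / (n₁ * n₂) / q z) ^ s + (chanFst p₂ w v₁ z / n₁ / q z) ^ s +
        (chanSnd p₁ w v₂ z / n₂ / q z) ^ s)) := by
          refine sum_le_sum fun v₁ _ => sum_le_sum fun v₂ _ => sum_le_sum fun z _ => ?_
          have h0 : 0 ≤ p₁ v₁ * p₂ v₂ * w v₁ v₂ z :=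
            mul_nonneg (mul_nonneg (hp₁ _) (hp₂ _)) (hw _ _ _)
          rcases h0.eq_or_lt' with h | h
          · rw [h, zero_mul, zero_mul]
          · exact mul_le_mul_of_nonneg_left (hinner b₁ b₂ v₁ v₂ z h) h0
      _ = 1 / s * resolvTerm s p₁ p₂ w n₁ n₂ := by
          have e12 : ∀ v₁ v₂ z, (w v₁ v₂ z / (n₁ * n₂) / q z) ^ s =
              (w v₁ v₂ z / q z) ^ s / (n₁ * n₂) ^ s := fun v₁ v₂ z =>
            hdiv (hw _ _ _) (by positivity) (hq0 z)
          have e1 : ∀ v₁ z, (chanFst p₂ w v₁ z / n₁ / q z) ^ s =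
              (chanFst p₂ w v₁ z / q z) ^ s / n₁ ^ s := fun v₁ z =>
            hdiv (chanFst_nonneg hp₂ hw _ _) hn₁pos (hq0 z)
          have e2 : ∀ v₂ z, (chanSnd p₁ w v₂ z / n₂ / q z) ^ s =
              (chanSnd p₁ w v₂ z / q z) ^ s / n₂ ^ s := fun v₂ z =>
            hdiv (chanSnd_nonneg hp₁ hw _ _) hn₂pos (hq0 z)
          have t12 : ∑ v₁, ∑ v₂, ∑ z, p₁ v₁ * p₂ v₂ * w v₁ v₂ z *
              ((w v₁ v₂ z / q z) ^ s / (n₁ * n₂) ^ s) =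
              infoSum s (fun v : V₁ × V₂ => p₁ v.1 * p₂ v.2) (fun v => w v.1 v.2) q /
                (n₁ * n₂) ^ s := by
            rw [infoSum, Fintype.sum_prod_type, sum_div]
            refine sum_congr rfl fun v₁ _ => ?_
            rw [sum_div]
            refine sum_congr rfl fun v₂ _ => ?_
            rw [mul_sum, sum_div]
            refine sum_congr rfl fun z _ => ?_
            ring
          have t1 : ∑ v₁, ∑ v₂, ∑ z, p₁ v₁ * p₂ v₂ * w v₁ v₂ z *
              ((chanFst p₂ w v₁ z / q z) ^ s / n₁ ^ s) =
              infoSum s p₁ (chanFst p₂ w) q / n₁ ^ s := by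
            rw [infoSum, sum_div]
            refine sum_congr rfl fun v₁ _ => ?_
            rw [sum_comm, mul_sum, sum_div]
            refine sum_congr rfl fun z _ => ?_
            rw [← sum_mul]
            simp only [mul_assoc]
            rw [← mul_sum]
            change p₁ v₁ * chanFst p₂ w v₁ z * _ = _
            ring
          have t2 : ∑ v₁, ∑ v₂, ∑ z, p₁ v₁ * p₂ v₂ * w v₁ v₂ z *
              ((chanSnd p₁ w v₂ z / q z) ^ s / n₂ ^ s) =
              infoSum s p₂ (chanSnd p₁ w) q / n₂ ^ s := by
            rw [infoSum, sum_div, sum_comm]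
            refine sum_congr rfl fun v₂ _ => ?_
            rw [sum_comm, mul_sum, sum_div]
            refine sum_congr rfl fun z _ => ?_
            rw [← sum_mul]
            simp only [mul_comm (p₁ _) (p₂ v₂), mul_assoc]
            rw [← mul_sum]
            change p₂ v₂ * chanSnd p₁ w v₂ z * _ = _
            ring
          have hq' : outLaw p₁ p₂ w = q := rfl
          rw [resolvTerm, hq', ← t12, ← t1, ← t2]
          simp only [e12, e1, e2, mul_sum, ← sum_add_distrib]
          refine sum_congr rfl fun v₁ _ => sum_congr rfl fun v₂ _ => sum_congr rfl fun z _ => ?_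
          ring
  calc _ = 𝔼 b₁, 𝔼 b₂, ∑ c₁ : I₁ → V₁, prodLaw p₁ c₁ * ∑ c₂ : I₂ → V₂, prodLaw p₂ c₂ *
      ∑ z, w (c₁ (β₁ b₁)) (c₂ (β₂ b₂)) z * Real.log (X c₁ c₂ z / q z) := by
        have : ∀ c₁ c₂, kl (fun z => 𝔼 b₁, 𝔼 b₂, w (c₁ (β₁ b₁)) (c₂ (β₂ b₂)) z) q =
            𝔼 b₁, 𝔼 b₂, ∑ z, w (c₁ (β₁ b₁)) (c₂ (β₂ b₂)) z * Real.log (X c₁ c₂ z / q z) := by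
          intro c₁ c₂
          simp only [kl, hX, expect_mul, ← expect_sum_comm]
        simp only [this]
        exact sum_mul_sum_mul_expect _ _ _
    _ ≤ 𝔼 _b₁ : B₁, 𝔼 _b₂ : B₂, 1 / s * resolvTerm s p₁ p₂ w n₁ n₂ :=
        expect_le_expect fun b₁ _ => expect_le_expect fun b₂ _ => hpair b₁ b₂
    _ = _ := by simp only [Fintype.expect_const]

end Resolvability

/-! ### Memoryless extensions -/

/-- Memoryless extension of a channel with two inputs. -/
def prodChan {I V₁ V₂ Z : Type*} [Fintype I] (w : V₁ → V₂ → Z → ℝ) (v₁ : I → V₁) (v₂ : I → V₂)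
    (z : I → Z) : ℝ :=
  ∏ i, w (v₁ i) (v₂ i) (z i)

section Tensor

variable {I V₁ V₂ Z : Type*} [Fintype I] [DecidableEq I]

lemma chanFst_prod [Fintype V₂] (p₂ : V₂ → ℝ) (w : V₁ → V₂ → Z → ℝ) (v₁ : I → V₁) (z : I → Z) :
    chanFst (prodLaw p₂) (prodChan w) v₁ z = ∏ i, chanFst p₂ w (v₁ i) (z i) := by
  simp only [chanFst, prodLaw, prodChan, ← prod_mul_distrib]
  exact sum_prod_eq_prod_sum fun i v => p₂ v * w (v₁ i) v (z i)

lemma chanSnd_prod [Fintype V₁] (p₁ : V₁ → ℝ) (w : V₁ → V₂ → Z → ℝ) (v₂ : I → V₂) (z : I → Z) :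
    chanSnd (prodLaw p₁) (prodChan w) v₂ z = ∏ i, chanSnd p₁ w (v₂ i) (z i) := by
  simp only [chanSnd, prodLaw, prodChan, ← prod_mul_distrib]
  exact sum_prod_eq_prod_sum fun i v => p₁ v * w v (v₂ i) (z i)

variable [Fintype V₁] [Fintype V₂]

lemma outLaw_prod (p₁ : V₁ → ℝ) (p₂ : V₂ → ℝ) (w : V₁ → V₂ → Z → ℝ) :
    outLaw (prodLaw (I := I) p₁) (prodLaw p₂) (prodChan w) = prodLaw (outLaw p₁ p₂ w) := by
  funext z
  simp only [outLaw, chanFst_prod, prodLaw, ← prod_mul_distrib]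
  exact sum_prod_eq_prod_sum fun i v => p₁ v * chanFst p₂ w v (z i)

/-- Single-letter form: every ingredient is a product over the letters, and the power acts on each
factor separately. -/
lemma infoSum_prod {V : Type*} [Fintype V] [Fintype Z] (s : ℝ) (p : V → ℝ) {w : V → Z → ℝ}
    {q : Z → ℝ} (hw : ∀ v z, 0 ≤ w v z) (hq : ∀ z, 0 ≤ q z) :
    infoSum s (prodLaw (I := I) p) (fun v z => ∏ i, w (v i) (z i)) (prodLaw q) =
      infoSum s p w q ^ Fintype.card I := by
  have h1 : ∀ (v : I → V), ∑ z : I → Z, (∏ i, w (v i) (z i)) *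
      ((∏ i, w (v i) (z i)) / prodLaw q z) ^ s =
      ∏ i, ∑ z, w (v i) z * (w (v i) z / q z) ^ s := by
    intro v
    rw [← sum_prod_eq_prod_sum]
    refine sum_congr rfl fun z _ => ?_
    rw [prodLaw, ← prod_div_distrib, prod_mul_distrib,
      Real.finsetProd_rpow _ _ fun i _ => div_nonneg (hw _ _) (hq _)]
  simp only [infoSum, h1]
  simp only [prodLaw, ← prod_mul_distrib]
  rw [sum_prod_eq_prod_sum fun _ v => p v * ∑ z, w v z * (w v z / q z) ^ s]
  simp

lemma resolvTerm_prod [Fintype Z] (s : ℝ) {p₁ : V₁ → ℝ} {p₂ : V₂ → ℝ} {w : V₁ → V₂ → Z → ℝ}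
    (hp₁ : ∀ v, 0 ≤ p₁ v) (hp₂ : ∀ v, 0 ≤ p₂ v) (hw : ∀ v₁ v₂ z, 0 ≤ w v₁ v₂ z) (b₁ b₂ : ℝ) :
    resolvTerm s (prodLaw (I := I) p₁) (prodLaw p₂) (prodChan w) b₁ b₂ =
      infoSum s p₁ (chanFst p₂ w) (outLaw p₁ p₂ w) ^ Fintype.card I / b₁ ^ s +
      infoSum s p₂ (chanSnd p₁ w) (outLaw p₁ p₂ w) ^ Fintype.card I / b₂ ^ s +
      infoSum s (fun v : V₁ × V₂ => p₁ v.1 * p₂ v.2) (fun v => w v.1 v.2) (outLaw p₁ p₂ w) ^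
        Fintype.card I / (b₁ * b₂) ^ s := by
  have hq := outLaw_nonneg hp₁ hp₂ hw
  have e1 := infoSum_prod (I := I) s p₁ (chanFst_nonneg (w := w) hp₂ hw) hq
  have e2 := infoSum_prod (I := I) s p₂ (chanSnd_nonneg (w := w) hp₁ hw) hq
  have e3 := infoSum_prod (I := I) s (fun v : V₁ × V₂ => p₁ v.1 * p₂ v.2)
    (w := fun v => w v.1 v.2) (fun v z => hw _ _ _) hq
  -- A pair of words is regarded as a word of pairs, so that the joint term is again that of a
  -- product law.
  have h3 : infoSum s (fun v : (I → V₁) × (I → V₂) => prodLaw p₁ v.1 * prodLaw p₂ v.2)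
      (fun v => prodChan w v.1 v.2) (prodLaw (outLaw p₁ p₂ w)) =
      infoSum s (prodLaw fun v : V₁ × V₂ => p₁ v.1 * p₂ v.2)
        (fun (v : I → V₁ × V₂) z => ∏ i, w (v i).1 (v i).2 (z i)) (prodLaw (outLaw p₁ p₂ w)) := by
    unfold infoSum
    rw [← (Equiv.arrowProdEquivProdArrow I (fun _ => V₁) (fun _ => V₂)).sum_comp]
    refine sum_congr rfl fun v _ => ?_
    simp only [prodLaw, prod_mul_distrib]
    rfl
  have h1 : chanFst (prodLaw (I := I) p₂) (prodChan w) =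
      fun (v : I → V₁) z => ∏ i, chanFst p₂ w (v i) (z i) := by
    funext v z
    exact chanFst_prod _ _ _ _
  have h2 : chanSnd (prodLaw (I := I) p₁) (prodChan w) =
      fun (v : I → V₂) z => ∏ i, chanSnd p₁ w (v i) (z i) := by
    funext v z
    exact chanSnd_prod _ _ _ _
  rw [resolvTerm, outLaw_prod, h1, h2, h3, e1, e2, e3]

end Tensor

/-! ### Rényi mutual information of order `1 + s` -/

/-- The summand of the Rényi divergence is $(pw)^{1+s}(qp)^{-s}=p\,w\,(w/q)^s$, that of `infoSum`.
This turns the secrecy exponents into the quantities of the resolvability bound. -/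
lemma exp_renyiInfoUp {V Z : Type*} [Fintype V] [Fintype Z] {s : ℝ} (hs : 0 < s) {p : V → ℝ}
    {w : V → Z → ℝ} {q : Z → ℝ} {r : Z × V → ℝ} (hp : ∀ v, 0 ≤ p v) (hp1 : ∑ v, p v = 1)
    (hw : ∀ v z, 0 ≤ w v z) (hw1 : ∀ v, ∑ z, w v z = 1) (hq : ∀ z, q z = ∑ v, p v * w v z)
    (hr : ∀ z v, r (z, v) = p v * w v z) (n : ℕ) (a : ℝ) :
    Real.exp (n * s * (renyiInfoUp s r - a)) = infoSum s p w q ^ n / Real.exp (n * a) ^ s := by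
  have hq0 : ∀ z, 0 ≤ q z := fun z => hq z ▸ sum_nonneg fun v _ => mul_nonneg (hp v) (hw v z)
  have hqpos : ∀ z v, 0 < p v * w v z → 0 < q z := fun z v h => hq z ▸
    (sum_pos_iff_of_nonneg fun v _ => mul_nonneg (hp v) (hw v z)).2 ⟨v, mem_univ _, h⟩
  have h1 : renyiSum s r (fun ab => push Prod.fst r ab.1 * push Prod.snd r ab.2) =
      infoSum s p w q := by
    unfold renyiSum infoSum
    rw [Fintype.sum_prod_type_right]
    refine sum_congr rfl fun v _ => ?_
    rw [mul_sum]
    refine sum_congr rfl fun z _ => ?_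
    beta_reduce
    rw [push_fst, push_snd]
    simp only [hr]
    rw [← hq, ← mul_sum, hw1, mul_one]
    rcases (mul_nonneg (hp v) (hw v z)).eq_or_lt' with h | h
    · rw [h, Real.zero_rpow (by positivity), zero_mul, ← mul_assoc, h, zero_mul]
    · have hz := hqpos z v h
      have hv : 0 < p v := (hp v).lt_of_ne' fun h0 => by simp [h0] at h
      have hwz : 0 < w v z := (hw v z).lt_of_ne' fun h0 => by simp [h0] at h
      rw [Real.rpow_add h, Real.rpow_one, Real.rpow_neg (by positivity), mul_comm (q z),
        Real.mul_rpow hv.le hwz.le, Real.mul_rpow hv.le hz.le, Real.div_rpow hwz.le hz.le]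
      have := Real.rpow_pos_of_pos hv s
      have := Real.rpow_pos_of_pos hz s
      field_simp
  have hterm : ∀ v z, 0 ≤ w v z * (w v z / q z) ^ s := fun v z =>
    mul_nonneg (hw v z) (Real.rpow_nonneg (div_nonneg (hw v z) (hq0 z)) _)
  -- Positivity is needed since the exponential undoes only the logarithm of a positive number.
  have hpos : 0 < infoSum s p w q := by
    obtain ⟨v, -, hv⟩ := (sum_pos_iff_of_nonneg fun v _ => hp v).1 (hp1 ▸ one_pos : 0 < ∑ v, p v)
    obtain ⟨z, -, hz⟩ :=
      (sum_pos_iff_of_nonneg fun z _ => hw v z).1 (hw1 v ▸ one_pos : 0 < ∑ z, w v z)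
    have hqz := hqpos z v (mul_pos hv hz)
    refine (sum_pos_iff_of_nonneg fun v _ => mul_nonneg (hp v) (sum_nonneg fun z _ => hterm v z)).2
      ⟨v, mem_univ _, mul_pos hv ?_⟩
    exact (sum_pos_iff_of_nonneg fun z _ => hterm v z).2 ⟨z, mem_univ _, by positivity⟩
  rw [renyiInfoUp, renyiDiv, h1, ← Real.exp_mul, ← Real.exp_log (pow_pos hpos n), ← Real.exp_sub,
    Real.log_pow]
  congr 1
  field_simp

/-! ### Rényi mutual information of order `1 / (1 + s)` -/

/-- The sum `∑_c P(c) ∑_a (∑_b P(b) w(a|b,c)^{1/(1+s)})^{1+s}`. -/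
def gallagerSum {A B C : Type*} [Fintype A] [Fintype B] [Fintype C] (s : ℝ) (pB : B → ℝ)
    (pC : C → ℝ) (w : B → C → A → ℝ) : ℝ :=
  ∑ c, pC c * ∑ a, (∑ b, pB b * w b c a ^ (1 / (1 + s))) ^ (1 + s)

lemma gallagerSum_prod {I A B C : Type*} [Fintype I] [DecidableEq I] [Fintype A] [Fintype B]
    [Fintype C] (s : ℝ) {pB : B → ℝ} (pC : C → ℝ) {w : B → C → A → ℝ} (hpB : ∀ b, 0 ≤ pB b)
    (hw : ∀ b c a, 0 ≤ w b c a) :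
    gallagerSum s (prodLaw (I := I) pB) (prodLaw pC) (prodChan w) =
      gallagerSum s pB pC w ^ Fintype.card I := by
  have h1 : ∀ (c : I → C) (a : I → A),
      (∑ b : I → B, prodLaw pB b * prodChan w b c a ^ (1 / (1 + s))) ^ (1 + s) =
      ∏ i, (∑ b, pB b * w b (c i) (a i) ^ (1 / (1 + s))) ^ (1 + s) := by
    intro c a
    rw [Real.finsetProd_rpow _ _ fun i _ => sum_nonneg fun b _ =>
      mul_nonneg (hpB b) (Real.rpow_nonneg (hw _ _ _) _), ← sum_prod_eq_prod_sum]
    congr 1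
    refine sum_congr rfl fun b _ => ?_
    rw [prod_mul_distrib, Real.finsetProd_rpow _ _ fun i _ => hw _ _ _]
    rfl
  have h2 : ∀ c : I → C, ∑ a : I → A,
      ∏ i, (∑ b, pB b * w b (c i) (a i) ^ (1 / (1 + s))) ^ (1 + s) =
      ∏ i, ∑ a, (∑ b, pB b * w b (c i) a ^ (1 / (1 + s))) ^ (1 + s) := fun c =>
    sum_prod_eq_prod_sum fun i a => (∑ b, pB b * w b (c i) a ^ (1 / (1 + s))) ^ (1 + s)
  simp only [gallagerSum, h1, h2]
  simp only [prodLaw, ← prod_mul_distrib]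
  rw [sum_prod_eq_prod_sum fun _ c => pC c *
    ∑ a, (∑ b, pB b * w b c a ^ (1 / (1 + s))) ^ (1 + s)]
  simp

/-- Upper bound of the minimum over `Q` by the choice `Q ∝ (∑_b P(b) w(a|b)^{1/(1+s)})^{1+s}`. -/
lemma sum_rpow_le_exp_minRenyi {A B : Type*} [Fintype A] [Fintype B] {s : ℝ} (hs : 0 < s)
    {p : B → ℝ} {w : B → A → ℝ} {r : A × B → ℝ} (hp : ∀ b, 0 ≤ p b) (hp1 : ∑ b, p b = 1)
    (hw : ∀ b a, 0 ≤ w b a) (hw1 : ∀ b, ∑ a, w b a = 1) (hr : ∀ a b, r (a, b) = p b * w b a) :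
    ∑ a, (∑ b, p b * w b a ^ (1 / (1 + s))) ^ (1 + s) ≤ Real.exp (-s * minRenyi s r) := by
  set α := 1 / (1 + s) with hα
  have hαpos : 0 < α := by positivity
  have hαs : α + α * s = 1 := by rw [hα]; field_simp
  have hαs' : α * (1 + s) = 1 := by rw [mul_add, mul_one, hαs]
  have e1 : 1 + -s / (1 + s) = α := by rw [hα]; field_simp; ring
  have e2 : -(-s / (1 + s)) = α * s := by rw [hα]; field_simp
  set g : A → ℝ := fun a => ∑ b, p b * w b a ^ α with hg
  have hg0 : ∀ a, 0 ≤ g a := fun a =>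
    sum_nonneg fun b _ => mul_nonneg (hp b) (Real.rpow_nonneg (hw b a) _)
  have hsnd : ∀ b, push Prod.snd r b = p b := fun b => by
    rw [push_snd]
    simp only [hr, ← mul_sum, hw1, mul_one]
  have hsum : ∀ Q : A → ℝ, (∀ a, 0 ≤ Q a) →
      renyiSum (-s / (1 + s)) r (fun ab => Q ab.1 * push Prod.snd r ab.2) =
        ∑ a, Q a ^ (α * s) * g a := by
    intro Q hQ
    unfold renyiSum
    rw [Fintype.sum_prod_type]
    refine sum_congr rfl fun a _ => ?_
    rw [hg, mul_sum]
    refine sum_congr rfl fun b _ => ?_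
    beta_reduce
    rw [hr, hsnd, e1, e2, Real.mul_rpow (hp b) (hw b a), Real.mul_rpow (hQ a) (hp b)]
    have : p b ^ α * p b ^ (α * s) = p b := by
      rw [← Real.rpow_add_of_nonneg (hp b) hαpos.le (by positivity), hαs, Real.rpow_one]
    linear_combination (w b a ^ α * Q a ^ (α * s)) * this
  set T := ∑ a, g a ^ (1 + s) with hT
  obtain ⟨a₀, ha₀⟩ : ∃ a, 0 < g a := by
    obtain ⟨b, -, hb⟩ := (sum_pos_iff_of_nonneg fun b _ => hp b).1 (hp1 ▸ one_pos : 0 < ∑ b, p b)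
    obtain ⟨a, -, ha⟩ :=
      (sum_pos_iff_of_nonneg fun a _ => hw b a).1 (hw1 b ▸ one_pos : 0 < ∑ a, w b a)
    exact ⟨a, (sum_pos_iff_of_nonneg fun b _ => mul_nonneg (hp b) (Real.rpow_nonneg (hw b a) _)).2
      ⟨b, mem_univ _, by positivity⟩⟩
  have hTpos : 0 < T := (sum_pos_iff_of_nonneg fun a _ => Real.rpow_nonneg (hg0 a) _).2
    ⟨a₀, mem_univ _, by positivity⟩
  have hle : minRenyi s r ≤ -(1 / s) * Real.log T := by
    refine csInf_le ?_ ?_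
    -- The infimum of reals needs a lower bound of the set. The order is below one, so the prefactor
    -- is negative, and $Q(a)\le1$ bounds every sum by $\sum_a g(a)$.
    · refine ⟨1 / (-s / (1 + s)) * Real.log (∑ a, g a), ?_⟩
      rintro d ⟨Q, hQ, hpos, rfl⟩
      have hneg : 1 / (-s / (1 + s)) ≤ 0 := by
        rw [one_div_nonpos, neg_div, neg_nonpos]
        positivity
      refine mul_le_mul_of_nonpos_left (Real.log_le_log hpos ?_) hneg
      rw [hsum Q hQ.1]
      refine sum_le_sum fun a _ => mul_le_of_le_one_left (hg0 a) ?_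
      refine Real.rpow_le_one (hQ.1 a) ?_ (by positivity)
      rw [← hQ.2]
      exact single_le_sum (f := Q) (fun a _ => hQ.1 a) (mem_univ a)
    · have hQ0 : ∀ a, 0 ≤ g a ^ (1 + s) / T := fun a =>
        div_nonneg (Real.rpow_nonneg (hg0 a) _) hTpos.le
      -- With this `Q` each summand is $g^{1+s}/T^{\alpha s}$, since $(1+s)\alpha s=s$; the sum is
      -- thus $T^{1-\alpha s}=T^{\alpha}$.
      have hval : renyiSum (-s / (1 + s)) r
          (fun ab => (g ab.1 ^ (1 + s) / T) * push Prod.snd r ab.2) = T ^ α := by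
        rw [hsum (fun a => g a ^ (1 + s) / T) hQ0]
        have : ∀ a, (g a ^ (1 + s) / T) ^ (α * s) * g a = g a ^ (1 + s) / T ^ (α * s) := by
          intro a
          rw [Real.div_rpow (Real.rpow_nonneg (hg0 a) _) hTpos.le, ← Real.rpow_mul (hg0 a),
            show (1 + s) * (α * s) = s by rw [← mul_assoc, mul_comm _ α, hαs', one_mul],
            Real.rpow_add_of_nonneg (hg0 a) zero_le_one hs.le, Real.rpow_one]
          ring
        simp only [this]
        rw [← sum_div, ← hT, div_eq_iff (Real.rpow_pos_of_pos hTpos _).ne', ← Real.rpow_add hTpos,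
          hαs, Real.rpow_one]
      refine ⟨fun a => g a ^ (1 + s) / T, ⟨hQ0, by rw [← sum_div, ← hT, div_self hTpos.ne']⟩, ?_, ?_⟩
      · rw [hval]
        positivity
      · rw [renyiDiv, hval, Real.log_rpow hTpos, hα]
        field_simp
  calc T = Real.exp (Real.log T) := (Real.exp_log hTpos).symm
    _ ≤ Real.exp (-s * minRenyi s r) := by
      refine Real.exp_le_exp.2 ?_
      have h := mul_le_mul_of_nonneg_left hle hs.le
      rw [← mul_assoc, mul_neg, mul_one_div_cancel hs.ne'] at h
      linarith

/-- The conditional information is defined by averaging exponentials over `c`, so the bound is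
applied for each `c` separately. Values of `c` without mass, where the conditional law is a division
by zero, contribute nothing. -/
lemma gallagerSum_le_exp {A B C : Type*} [Fintype A] [Fintype B] [Fintype C] {s : ℝ} (hs : 0 < s)
    {pB : B → ℝ} {pC : C → ℝ} {w : B → C → A → ℝ} {r : A × B × C → ℝ} (hpB : ∀ b, 0 ≤ pB b)
    (hpB1 : ∑ b, pB b = 1) (hpC : ∀ c, 0 ≤ pC c) (hpC1 : ∑ c, pC c = 1)
    (hw : ∀ b c a, 0 ≤ w b c a) (hw1 : ∀ b c, ∑ a, w b c a = 1)
    (hr : ∀ a b c, r (a, b, c) = pB b * pC c * w b c a) :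
    gallagerSum s pB pC w ≤ Real.exp (-s * renyiInfoDown s r) := by
  classical
  have hm : ∀ c, margC r c = pC c := by
    intro c
    rw [margC, push_eq_sum_ite]
    simp only [Fintype.sum_prod_type, hr, sum_ite_eq', mem_univ, if_true]
    rw [sum_comm]
    simp only [← mul_sum, hw1, mul_one, ← sum_mul, hpB1, one_mul]
  have hpos : 0 < ∑ c, margC r c * Real.exp (-s * minRenyi s (condC r c)) := by
    obtain ⟨c, -, hc⟩ := (sum_pos_iff_of_nonneg fun c _ => hpC c).1 (hpC1 ▸ one_pos : 0 < ∑ c, pC c)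
    refine (sum_pos_iff_of_nonneg fun c _ => mul_nonneg (hm c ▸ hpC c) (Real.exp_pos _).le).2
      ⟨c, mem_univ _, mul_pos (hm c ▸ hc) (Real.exp_pos _)⟩
  rw [renyiInfoDown, show ∀ x, -s * (-(1 / s) * x) = x by intro x; field_simp, Real.exp_log hpos]
  refine sum_le_sum fun c _ => ?_
  rw [hm]
  rcases (hpC c).eq_or_lt' with h | h
  · simp [h]
  · refine mul_le_mul_of_nonneg_left ?_ h.le
    refine sum_rpow_le_exp_minRenyi hs hpB hpB1 (fun b a => hw b c a) (fun b => hw1 b c) ?_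
    intro a b
    rw [condC, hr, hm]
    field_simp

/-! ### Uniform means -/

lemma expect_eq_sum_inv_mul {A : Type*} [Fintype A] (f : A → ℝ) :
    𝔼 a, f a = ∑ a, (Fintype.card A : ℝ)⁻¹ * f a := by
  rw [Fintype.expect_eq_sum_div_card, div_eq_inv_mul, mul_sum]

lemma expect_prod_type {A B : Type*} [Fintype A] [Fintype B] (f : A × B → ℝ) :
    𝔼 x, f x = 𝔼 a, 𝔼 b, f (a, b) :=
  expect_product univ univ f

lemma expect_comm' {A B : Type*} [Fintype A] [Fintype B] (f : A → B → ℝ) :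
    𝔼 a, 𝔼 b, f a b = 𝔼 b, 𝔼 a, f a b :=
  expect_comm univ univ f

lemma expect_add_left {E : Type*} [Fintype E] [AddCommGroup E] (c : E) (f : E → ℝ) :
    𝔼 e, f (c + e) = 𝔼 e, f e :=
  Fintype.expect_equiv (Equiv.addLeft c) _ _ fun _ => rfl

lemma expect_add_right {E : Type*} [Fintype E] [AddCommGroup E] (c : E) (f : E → ℝ) :
    𝔼 e, f (e + c) = 𝔼 e, f e :=
  Fintype.expect_equiv (Equiv.addRight c) _ _ fun _ => rfl

/-- A surjective homomorphism of finite groups maps the uniform law to the uniform law. -/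
lemma expect_comp_hom {K E : Type*} [Fintype K] [Fintype E] [AddCommGroup K] [AddCommGroup E]
    (φ : K →+ E) (hφ : Function.Surjective φ) (f : E → ℝ) : 𝔼 k, f (φ k) = 𝔼 e, f e := by
  -- A translation of the target lifts to a translation of the source, which preserves the uniform
  -- mean. Averaging over all translations then gives the uniform law.
  have h1 : ∀ e, 𝔼 k, f (e + φ k) = 𝔼 k, f (φ k) := by
    intro e
    obtain ⟨k₀, rfl⟩ := hφ e
    simp only [← map_add]
    exact expect_add_left k₀ fun k => f (φ k)
  calc 𝔼 k, f (φ k) = 𝔼 e, 𝔼 k, f (e + φ k) := by simp only [h1, Fintype.expect_const]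
    _ = 𝔼 k, 𝔼 e, f (e + φ k) := expect_comm' _
    _ = 𝔼 e, f e := by simp only [expect_add_right, Fintype.expect_const]

lemma expect_fin_succ {A : Type*} [Fintype A] {n : ℕ} (f : (Fin (n + 1) → A) → ℝ) :
    𝔼 a, f a = 𝔼 a₀, 𝔼 a : Fin n → A, f (Fin.cons a₀ a) := by
  rw [← Fintype.expect_equiv (Fin.consEquiv fun _ => A) (fun x => f (Fin.cons x.1 x.2)) f
    fun _ => rfl, expect_prod_type]

lemma expect_prod_eq_prod_expect {ι A : Type*} [Fintype ι] [DecidableEq ι] [Fintype A]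
    (f : ι → A → ℝ) : 𝔼 a : ι → A, ∏ i, f i (a i) = ∏ i, 𝔼 a, f i a := by
  simp only [Fintype.expect_eq_sum_div_card, prod_div_distrib]
  rw [sum_prod_eq_prod_sum]
  simp

lemma expect_pi_eval {ι A : Type*} [Fintype ι] [DecidableEq ι] [Fintype A] [Nonempty A] (i : ι)
    (f : A → ℝ) : 𝔼 a : ι → A, f (a i) = 𝔼 a, f a := by
  have := expect_prod_eq_prod_expect (ι := ι) (fun j a => if j = i then f a else 1)
  rw [prod_eq_single i (fun j _ h => by simp [h]) (by simp)] at this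
  simpa using this

/-! ### Rounds that are linked by keys -/

section Chain

variable {S K E Z : Type*} [Fintype K] [AddCommGroup E]

/-- Output law of `n` rounds with secret parts `s` and encrypted parts `me`, where each encrypted
part is masked by the uniform key of the preceding round, and the first one by the key `k₀`. -/
def chainLaw (w : S → K → E → Z → ℝ) (π : K → E) {n : ℕ} (s : Fin n → S) (me : Fin n → E) (k₀ : K)
    (z : Fin n → Z) : ℝ :=
  -- Entry `r.castSucc` of the extended word is the key of the round before `r`, or `k₀` for the
  -- first round; the key of the last round masks nothing.
  𝔼 k : Fin n → K, ∏ r, w (s r) (k r)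
    (me r + π ((Fin.cons k₀ k : Fin (n + 1) → K) r.castSucc)) (z r)

/-- Markov structure: once the key of the first round is given, it is the initial key of the
remaining rounds and the only link to them. -/
lemma chainLaw_succ (w : S → K → E → Z → ℝ) (π : K → E) {n : ℕ} (s : Fin (n + 1) → S)
    (me : Fin (n + 1) → E) (k₀ : K) (z : Fin (n + 1) → Z) :
    chainLaw w π s me k₀ z = 𝔼 k, w (s 0) k (me 0 + π k₀) (z 0) *
      chainLaw w π (fun r => s r.succ) (fun r => me r.succ) k (fun r => z r.succ) := by
  rw [chainLaw, expect_fin_succ]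
  refine expect_congr rfl fun k _ => ?_
  rw [chainLaw, mul_expect]
  refine expect_congr rfl fun k' _ => ?_
  rw [Fin.prod_univ_succ]
  simp [Fin.cons_succ]

lemma chainLaw_nonneg {w : S → K → E → Z → ℝ} (hw : ∀ s k e z, 0 ≤ w s k e z) (π : K → E) {n : ℕ}
    (s : Fin n → S) (me : Fin n → E) (k₀ : K) (z : Fin n → Z) : 0 ≤ chainLaw w π s me k₀ z :=
  expect_nonneg fun _ _ => prod_nonneg fun _ _ => hw _ _ _ _

lemma sum_chainLaw [Nonempty K] [Fintype Z] {w : S → K → E → Z → ℝ}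
    (hw1 : ∀ s k e, ∑ z, w s k e z = 1) (π : K → E) {n : ℕ} (s : Fin n → S) (me : Fin n → E)
    (k₀ : K) : ∑ z, chainLaw w π s me k₀ z = 1 := by
  simp only [chainLaw]
  rw [← expect_sum_comm]
  refine (expect_congr rfl fun k _ => ?_).trans (Fintype.expect_const 1)
  rw [sum_prod_eq_prod_sum fun r z => w (s r) (k r)
    (me r + π ((Fin.cons k₀ k : Fin (n + 1) → K) r.castSucc)) z]
  simp [hw1]

lemma prodLaw_pos_of_chainLaw_pos {w : S → K → E → Z → ℝ} (hw : ∀ s k e z, 0 ≤ w s k e z)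
    {q : Z → ℝ} (hac : ∀ s k e z, 0 < w s k e z → 0 < q z) (π : K → E) {n : ℕ} (s : Fin n → S)
    (me : Fin n → E) (k₀ : K) (z : Fin n → Z) (h : 0 < chainLaw w π s me k₀ z) :
    0 < prodLaw q z := by
  obtain ⟨k, -, hk⟩ := exists_ne_zero_of_expect_ne_zero h.ne'
  refine prod_pos fun r _ => ?_
  have := prod_ne_zero_iff.1 hk r (mem_univ r)
  exact hac _ _ _ _ ((hw _ _ _ _).lt_of_ne' this)

/-- The relative entropy of linked rounds is at most the sum of the relative entropies of single
rounds with a given key and a uniform encrypted part. -/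
theorem kl_chainLaw_le [Fintype E] [Nonempty K] [Fintype Z] {w : S → K → E → Z → ℝ}
    (hw : ∀ s k e z, 0 ≤ w s k e z) (hw1 : ∀ s k e, ∑ z, w s k e z = 1) {q : Z → ℝ}
    (hq : ∀ z, 0 ≤ q z) (hac : ∀ s k e z, 0 < w s k e z → 0 < q z) {π : K → E}
    (hπ : ∀ f : E → ℝ, 𝔼 k, f (π k) = 𝔼 e, f e) {n : ℕ} (s : Fin n → S) (me : Fin n → E) :
    kl (fun z => 𝔼 k₀, chainLaw w π s me k₀ z) (prodLaw q) ≤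
      ∑ r, 𝔼 k, kl (fun z => 𝔼 e, w (s r) k e z) q := by
  induction n with
  | zero => simp [kl, chainLaw, prodLaw]
  | succ n ih =>
    -- The initial key occurs only in the first mask, so its average makes the first encrypted part
    -- uniform, whatever the message part and independently of the key `k` of this round.
    have h1 : ∀ z : Fin (n + 1) → Z, 𝔼 k₀, chainLaw w π s me k₀ z =
        ∑ k, (Fintype.card K : ℝ)⁻¹ * (𝔼 e, w (s 0) k e (z 0)) *
          chainLaw w π (fun r => s r.succ) (fun r => me r.succ) k (fun r => z r.succ) := by
      intro z
      simp only [chainLaw_succ w π s me]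
      rw [expect_comm']
      simp only [← expect_mul]
      rw [expect_eq_sum_inv_mul]
      refine sum_congr rfl fun k _ => ?_
      rw [hπ (fun e => w (s 0) k (me 0 + e) (z 0)), expect_add_left (me 0)
        (fun e => w (s 0) k e (z 0)), mul_assoc]
    have h2 : kl (fun z => 𝔼 k₀, chainLaw w π s me k₀ z) (prodLaw q) =
        kl (fun z : Z × (Fin n → Z) => ∑ k, (Fintype.card K : ℝ)⁻¹ * (𝔼 e, w (s 0) k e z.1) *
          chainLaw w π (fun r => s r.succ) (fun r => me r.succ) k z.2)
          (fun z => q z.1 * prodLaw q z.2) := by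
      unfold kl
      rw [← (Fin.consEquiv fun _ => Z).sum_comp]
      refine sum_congr rfl fun z _ => ?_
      beta_reduce
      rw [h1, prodLaw, Fin.prod_univ_succ]
      rfl
    rw [h2, Fin.sum_univ_succ]
    -- Given `k`, the first round and the remaining rounds are independent, so the law is a mixture
    -- of products.
    refine (kl_mixture_le (fun _ : K => (Fintype.card K : ℝ)⁻¹) (fun k z => 𝔼 e, w (s 0) k e z)
      (fun k z => chainLaw w π (fun r => s r.succ) (fun r => me r.succ) k z) q (prodLaw q)
      (fun _ => by positivity) (fun k z => expect_nonneg fun e _ => hw _ _ _ _)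
      (fun k z => chainLaw_nonneg hw _ _ _ _ _) (fun k => ?_) (fun k => sum_chainLaw hw1 _ _ _ _)
      hq (fun k z h => ?_)
      (fun k z h => prodLaw_pos_of_chainLaw_pos hw hac _ _ _ _ _ h)).trans ?_
    · rw [← expect_sum_comm]
      simp only [hw1, Fintype.expect_const]
    · obtain ⟨e, -, he⟩ := exists_ne_zero_of_expect_ne_zero h.ne'
      exact hac _ _ _ _ ((hw _ _ _ _).lt_of_ne' he)
    · rw [← expect_eq_sum_inv_mul (fun k => kl (fun z => 𝔼 e, w (s 0) k e z) q)]
      simp only [← expect_eq_sum_inv_mul]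
      rw [add_comm]
      -- Averaged over `k`, the remaining rounds again form a chain with uniform initial key, to
      -- which the induction hypothesis applies.
      exact add_le_add le_rfl (ih (fun r => s r.succ) (fun r => me r.succ))

/-- The filler of the first round is modelled as the message part 0 masked by a fictitious uniform
key. -/
lemma expect_chainLaw_eq [Fintype E] {w : S → K → E → Z → ℝ} {π : K → E}
    (hπ : ∀ f : E → ℝ, 𝔼 k, f (π k) = 𝔼 e, f e) {τ : ℕ} (s : Fin (τ + 1) → S) (me : Fin τ → E)
    (z : Fin (τ + 1) → Z) :
    𝔼 k₀, chainLaw w π s (Fin.cons 0 me) k₀ z = 𝔼 e₀, 𝔼 k : Fin (τ + 1) → K, ∏ r, w (s r) (k r)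
      (Fin.cases e₀ (fun q => me q + π (k q.castSucc)) r) (z r) := by
  rw [← hπ]
  refine expect_congr rfl fun k₀ _ => expect_congr rfl fun k _ => prod_congr rfl fun r _ => ?_
  congr 1
  refine Fin.cases ?_ (fun q => ?_) r
  · simp
  · simp

end Chain

/-! ### Leakage of the idealized protocol -/

section Ideal

variable {N₁ N₂ : Sizes} {Z : Type*}

/-- Output law of the idealized protocol for given messages, where `v` is the channel from the
indices of a round to the observation of a round. -/
def idealCond (v : Index N₁ → Index N₂ → Z → ℝ) (h₁₂ : (N₁.e : ℕ) ∣ N₂.k)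
    (h₂₁ : (N₂.e : ℕ) ∣ N₁.k) {τ : ℕ} (m₁ : Msg N₁ τ) (m₂ : Msg N₂ τ) (z : Fin (τ + 1) → Z) : ℝ :=
  𝔼 u₁ : Priv N₁ τ, 𝔼 u₂ : Priv N₂ τ, ∏ r, v (idealIndex h₁₂ m₁ u₁ (fun q => (u₂.1 q).1) r)
    (idealIndex h₂₁ m₂ u₂ (fun q => (u₁.1 q).1) r) (z r)

lemma idealCond_swap (v : Index N₁ → Index N₂ → Z → ℝ) (h₁₂ : (N₁.e : ℕ) ∣ N₂.k)
    (h₂₁ : (N₂.e : ℕ) ∣ N₁.k) {τ : ℕ} (m₁ : Msg N₁ τ) (m₂ : Msg N₂ τ) (z : Fin (τ + 1) → Z) :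
    idealCond (fun i₂ i₁ => v i₁ i₂) h₂₁ h₁₂ m₂ m₁ z = idealCond v h₁₂ h₂₁ m₁ m₂ z :=
  expect_comm' _

/-- Both keys of a round as masks of the encrypted parts of the next round. -/
def maskBoth (h₁₂ : (N₁.e : ℕ) ∣ N₂.k) (h₂₁ : (N₂.e : ℕ) ∣ N₁.k) (k : ZMod N₁.k × ZMod N₂.k) :
    ZMod N₁.e × ZMod N₂.e :=
  (ZMod.castHom h₁₂ (ZMod N₁.e) k.2, ZMod.castHom h₂₁ (ZMod N₂.e) k.1)

/-- The key of the second user as a mask of the encrypted part of the first user. -/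
def maskFst (h₁₂ : (N₁.e : ℕ) ∣ N₂.k) (k : ZMod N₁.k × ZMod N₂.k) : ZMod N₁.e :=
  ZMod.castHom h₁₂ (ZMod N₁.e) k.2

/-- Divisibility makes the reduction a surjective homomorphism, so a uniform key becomes a uniform
mask. -/
lemma expect_castHom {N N' : Sizes} (h : (N.e : ℕ) ∣ N'.k) (f : ZMod N.e → ℝ) :
    𝔼 k : ZMod N'.k, f (ZMod.castHom h (ZMod N.e) k) = 𝔼 e, f e :=
  expect_comp_hom (ZMod.castHom h (ZMod N.e)).toAddMonoidHom (ZMod.castHom_surjective h) f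

lemma expect_maskFst (h₁₂ : (N₁.e : ℕ) ∣ N₂.k) (f : ZMod N₁.e → ℝ) :
    𝔼 k : ZMod N₁.k × ZMod N₂.k, f (maskFst h₁₂ k) = 𝔼 e, f e := by
  rw [expect_prod_type]
  simp only [maskFst, expect_castHom h₁₂ f, Fintype.expect_const]

lemma expect_maskBoth (h₁₂ : (N₁.e : ℕ) ∣ N₂.k) (h₂₁ : (N₂.e : ℕ) ∣ N₁.k)
    (f : ZMod N₁.e × ZMod N₂.e → ℝ) : 𝔼 k, f (maskBoth h₁₂ h₂₁ k) = 𝔼 e, f e := by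
  rw [expect_prod_type, expect_prod_type, expect_comm']
  simp only [maskBoth]
  rw [expect_castHom h₁₂ fun e => 𝔼 k : ZMod N₁.k, f (e, ZMod.castHom h₂₁ (ZMod N₂.e) k)]
  exact expect_congr rfl fun e _ => expect_castHom h₂₁ fun e' => f (e, e')

/-- One round with the open parts averaged out. -/
def roundBoth (v : Index N₁ → Index N₂ → Z → ℝ) (s : Fin N₁.s × Fin N₂.s)
    (k : ZMod N₁.k × ZMod N₂.k) (e : ZMod N₁.e × ZMod N₂.e) (z : Z) : ℝ :=
  𝔼 o : Fin N₁.o × Fin N₂.o, v (s.1, k.1, e.1, o.1) (s.2, k.2, e.2, o.2) z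

/-- One round with the open parts and the message of the second user averaged out. -/
def roundFst (v : Index N₁ → Index N₂ → Z → ℝ) (s : Fin N₁.s) (k : ZMod N₁.k × ZMod N₂.k)
    (e : ZMod N₁.e) (z : Z) : ℝ :=
  𝔼 x : Fin N₁.o × Fin N₂.s × ZMod N₂.e × Fin N₂.o,
    v (s, k.1, e, x.1) (x.2.1, k.2, x.2.2.1, x.2.2.2) z

/-- The private randomness of both users, sorted by kind. -/
def privEquiv (N₁ N₂ : Sizes) (τ : ℕ) : Priv N₁ τ × Priv N₂ τ ≃
    (ZMod N₁.e × ZMod N₂.e) × (Fin (τ + 1) → ZMod N₁.k × ZMod N₂.k) ×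
      (Fin (τ + 1) → Fin N₁.o × Fin N₂.o) where
  toFun u := ((u.1.2, u.2.2), fun r => ((u.1.1 r).1, (u.2.1 r).1),
    fun r => ((u.1.1 r).2, (u.2.1 r).2))
  invFun x := ((fun r => ((x.2.1 r).1, (x.2.2 r).1), x.1.1),
    (fun r => ((x.2.1 r).2, (x.2.2 r).2), x.1.2))
  left_inv _ := rfl
  right_inv _ := rfl

/-- The message of the second user and the private randomness of both users, in terms of the
filler of the first user, the keys, and the uniform parts that are averaged out in each round. -/
def msgPrivEquiv (N₁ : Sizes) {N₂ : Sizes} (h₂₁ : (N₂.e : ℕ) ∣ N₁.k) (τ : ℕ) :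
    Msg N₂ τ × Priv N₁ τ × Priv N₂ τ ≃ ZMod N₁.e × (Fin (τ + 1) → ZMod N₁.k × ZMod N₂.k) ×
      (Fin (τ + 1) → Fin N₁.o × Fin N₂.s × ZMod N₂.e × Fin N₂.o) where
  toFun x := (x.2.1.2, fun r => ((x.2.1.1 r).1, (x.2.2.1 r).1), fun r => ((x.2.1.1 r).2, x.1.1 r,
    (idealIndex h₂₁ x.1 x.2.2 (fun q => (x.2.1.1 q).1) r).2.2.1, (x.2.2.1 r).2))
  invFun y := ((fun r => (y.2.2 r).2.1,
      fun q => (y.2.2 q.succ).2.2.1 - ZMod.castHom h₂₁ (ZMod N₂.e) (y.2.1 q.castSucc).1),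
    (fun r => ((y.2.1 r).1, (y.2.2 r).1), y.1),
    (fun r => ((y.2.1 r).2, (y.2.2 r).2.2.2), (y.2.2 0).2.2.1))
  left_inv := by
    rintro ⟨⟨s, e⟩, ⟨u, f⟩, ⟨u', f'⟩⟩
    simp [idealIndex]
  right_inv := by
    rintro ⟨f, k, x⟩
    refine Prod.ext rfl (Prod.ext rfl (funext fun r => ?_))
    refine Prod.ext rfl (Prod.ext rfl (Prod.ext ?_ rfl))
    refine Fin.cases ?_ (fun q => ?_) r
    · rfl
    · simp [idealIndex]

/-- With both messages fixed, the state carried between rounds is the pair of keys. The open parts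
are fresh in each round and average out letterwise. -/
lemma idealCond_eq_chainLaw (v : Index N₁ → Index N₂ → Z → ℝ) (h₁₂ : (N₁.e : ℕ) ∣ N₂.k)
    (h₂₁ : (N₂.e : ℕ) ∣ N₁.k) {τ : ℕ} (m₁ : Msg N₁ τ) (m₂ : Msg N₂ τ) (z : Fin (τ + 1) → Z) :
    idealCond v h₁₂ h₂₁ m₁ m₂ z = 𝔼 k₀, chainLaw (roundBoth v) (maskBoth h₁₂ h₂₁)
      (fun r => (m₁.1 r, m₂.1 r)) (Fin.cons 0 fun q => (m₁.2 q, m₂.2 q)) k₀ z := by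
  rw [expect_chainLaw_eq (expect_maskBoth h₁₂ h₂₁)]
  refine (expect_prod_type (fun u : Priv N₁ τ × Priv N₂ τ => ∏ r,
      v (idealIndex h₁₂ m₁ u.1 (fun q => (u.2.1 q).1) r)
        (idealIndex h₂₁ m₂ u.2 (fun q => (u.1.1 q).1) r) (z r))).symm.trans ?_
  let e : ZMod N₁.e × ZMod N₂.e → (Fin (τ + 1) → ZMod N₁.k × ZMod N₂.k) → Fin (τ + 1) →
      ZMod N₁.e × ZMod N₂.e := fun e₀ k r =>
    Fin.cases e₀ (fun q => (m₁.2 q, m₂.2 q) + maskBoth h₁₂ h₂₁ (k q.castSucc)) r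
  refine (Fintype.expect_equiv (privEquiv N₁ N₂ τ) _ (fun x => ∏ r,
    v (m₁.1 r, (x.2.1 r).1, (e x.1 x.2.1 r).1, (x.2.2 r).1)
      (m₂.1 r, (x.2.1 r).2, (e x.1 x.2.1 r).2, (x.2.2 r).2) (z r)) fun u => ?_).trans ?_
  · refine prod_congr rfl fun r _ => ?_
    refine Fin.cases ?_ (fun q => ?_) r
    · rfl
    · rfl
  · rw [expect_prod_type]
    refine expect_congr rfl fun e₀ _ => ?_
    rw [expect_prod_type]
    refine expect_congr rfl fun k _ => (expect_prod_eq_prod_expect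
      (fun (r : Fin (τ + 1)) (o : Fin N₁.o × Fin N₂.o) =>
      v (m₁.1 r, (k r).1, (e e₀ k r).1, o.1) (m₂.1 r, (k r).2, (e e₀ k r).2, o.2) (z r))).trans ?_
    exact prod_congr rfl fun r _ => rfl

/-- A uniform message of the second user makes the encrypted parts sent by that user uniform and
independent of all keys. The first user's key then links no rounds, and only the mask `maskFst`
remains. -/
lemma expect_idealCond_eq_chainLaw (v : Index N₁ → Index N₂ → Z → ℝ) (h₁₂ : (N₁.e : ℕ) ∣ N₂.k)
    (h₂₁ : (N₂.e : ℕ) ∣ N₁.k) {τ : ℕ} (m₁ : Msg N₁ τ) (z : Fin (τ + 1) → Z) :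
    𝔼 m₂, idealCond v h₁₂ h₂₁ m₁ m₂ z = 𝔼 k₀, chainLaw (roundFst v) (maskFst h₁₂)
      m₁.1 (Fin.cons 0 m₁.2) k₀ z := by
  rw [expect_chainLaw_eq (expect_maskFst h₁₂)]
  have h1 : 𝔼 m₂, idealCond v h₁₂ h₂₁ m₁ m₂ z =
      𝔼 x : Msg N₂ τ × Priv N₁ τ × Priv N₂ τ, ∏ r,
        v (idealIndex h₁₂ m₁ x.2.1 (fun q => (x.2.2.1 q).1) r)
          (idealIndex h₂₁ x.1 x.2.2 (fun q => (x.2.1.1 q).1) r) (z r) := by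
    rw [expect_prod_type (A := Msg N₂ τ)]
    refine expect_congr rfl fun m₂ _ => ?_
    rw [expect_prod_type (A := Priv N₁ τ)]
    rfl
  rw [h1]
  let e : ZMod N₁.e → (Fin (τ + 1) → ZMod N₁.k × ZMod N₂.k) → Fin (τ + 1) → ZMod N₁.e :=
    fun e₀ k r => Fin.cases e₀ (fun q => m₁.2 q + maskFst h₁₂ (k q.castSucc)) r
  refine (Fintype.expect_equiv (msgPrivEquiv N₁ h₂₁ τ) _ (fun x => ∏ r,
    v (m₁.1 r, (x.2.1 r).1, e x.1 x.2.1 r, (x.2.2 r).1)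
      ((x.2.2 r).2.1, (x.2.1 r).2, (x.2.2 r).2.2.1, (x.2.2 r).2.2.2) (z r)) fun u => ?_).trans ?_
  · rfl
  · rw [expect_prod_type]
    refine expect_congr rfl fun e₀ _ => ?_
    rw [expect_prod_type]
    refine expect_congr rfl fun k _ => (expect_prod_eq_prod_expect
      (fun (r : Fin (τ + 1)) (x : Fin N₁.o × Fin N₂.s × ZMod N₂.e × Fin N₂.o) =>
      v (m₁.1 r, (k r).1, e e₀ k r, x.1) (x.2.1, (k r).2, x.2.2.1, x.2.2.2) (z r))).trans ?_
    exact prod_congr rfl fun r _ => rfl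

lemma expect_msg_fst {N : Sizes} {τ : ℕ} (r : Fin (τ + 1)) (f : Fin N.s → ℝ) :
    𝔼 m : Msg N τ, f (m.1 r) = 𝔼 s, f s := by
  rw [expect_prod_type]
  simp only [Fintype.expect_const]
  exact expect_pi_eval r f

section Bounds

variable {v : Index N₁ → Index N₂ → Z → ℝ} {q : Z → ℝ}

lemma idealCond_nonneg (hv : ∀ i₁ i₂ z, 0 ≤ v i₁ i₂ z) (h₁₂ : (N₁.e : ℕ) ∣ N₂.k)
    (h₂₁ : (N₂.e : ℕ) ∣ N₁.k) {τ : ℕ} (m₁ : Msg N₁ τ) (m₂ : Msg N₂ τ) (z : Fin (τ + 1) → Z) :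
    0 ≤ idealCond v h₁₂ h₂₁ m₁ m₂ z :=
  expect_nonneg fun _ _ => expect_nonneg fun _ _ => prod_nonneg fun _ _ => hv _ _ _

lemma prodLaw_pos_of_idealCond_pos (hv : ∀ i₁ i₂ z, 0 ≤ v i₁ i₂ z)
    (hac : ∀ i₁ i₂ z, 0 < v i₁ i₂ z → 0 < q z) (h₁₂ : (N₁.e : ℕ) ∣ N₂.k)
    (h₂₁ : (N₂.e : ℕ) ∣ N₁.k) {τ : ℕ} (m₁ : Msg N₁ τ) (m₂ : Msg N₂ τ) (z : Fin (τ + 1) → Z)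
    (h : 0 < idealCond v h₁₂ h₂₁ m₁ m₂ z) : 0 < prodLaw q z := by
  obtain ⟨u₁, -, h₁⟩ := exists_ne_zero_of_expect_ne_zero h.ne'
  obtain ⟨u₂, -, h₂⟩ := exists_ne_zero_of_expect_ne_zero h₁
  exact prod_pos fun r _ =>
    hac _ _ _ ((hv _ _ _).lt_of_ne' (prod_ne_zero_iff.1 h₂ r (mem_univ r)))

variable [Fintype Z]

/-- Relative entropy between the output for given main parts and the law `q`. -/
def roundKlBoth (v : Index N₁ → Index N₂ → Z → ℝ) (q : Z → ℝ) : ℝ :=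
  𝔼 s, 𝔼 k, kl (fun z => 𝔼 e, roundBoth v s k e z) q

/-- Relative entropy between the output for given main part of the first user and given key of the
second user and the law `q`. -/
def roundKlFst (v : Index N₁ → Index N₂ → Z → ℝ) (q : Z → ℝ) : ℝ :=
  𝔼 s, 𝔼 k, kl (fun z => 𝔼 e, roundFst v s k e z) q

lemma sum_idealCond (hv1 : ∀ i₁ i₂, ∑ z, v i₁ i₂ z = 1) (h₁₂ : (N₁.e : ℕ) ∣ N₂.k)
    (h₂₁ : (N₂.e : ℕ) ∣ N₁.k) {τ : ℕ} (m₁ : Msg N₁ τ) (m₂ : Msg N₂ τ) :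
    ∑ z, idealCond v h₁₂ h₂₁ m₁ m₂ z = 1 := by
  simp only [idealCond, ← expect_sum_comm]
  refine (expect_congr rfl fun u₁ _ => (expect_congr rfl fun u₂ _ => ?_).trans
    (Fintype.expect_const 1)).trans (Fintype.expect_const 1)
  rw [sum_prod_eq_prod_sum fun r z => v (idealIndex h₁₂ m₁ u₁ (fun q => (u₂.1 q).1) r)
    (idealIndex h₂₁ m₂ u₂ (fun q => (u₁.1 q).1) r) z]
  simp [hv1]

/-- Joint leakage of the idealized protocol. -/
theorem mutualInfo_idealCond_le (hv : ∀ i₁ i₂ z, 0 ≤ v i₁ i₂ z)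
    (hv1 : ∀ i₁ i₂, ∑ z, v i₁ i₂ z = 1) (hq : ∀ z, 0 ≤ q z) (hq1 : ∑ z, q z = 1)
    (hac : ∀ i₁ i₂ z, 0 < v i₁ i₂ z → 0 < q z) (h₁₂ : (N₁.e : ℕ) ∣ N₂.k)
    (h₂₁ : (N₂.e : ℕ) ∣ N₁.k) (τ : ℕ) :
    mutualInfo (fun a : (Msg N₁ τ × Msg N₂ τ) × (Fin (τ + 1) → Z) =>
      (Fintype.card (Msg N₁ τ × Msg N₂ τ) : ℝ)⁻¹ * idealCond v h₁₂ h₂₁ a.1.1 a.1.2 a.2) ≤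
      (τ + 1) * roundKlBoth v q := by
  refine (mutualInfo_le_expect_kl (fun m : Msg N₁ τ × Msg N₂ τ => idealCond v h₁₂ h₂₁ m.1 m.2)
    (prodLaw q) (fun _ _ => idealCond_nonneg hv _ _ _ _ _) (fun _ => sum_idealCond hv1 _ _ _ _)
    (prodLaw_nonneg hq) (sum_prodLaw hq1).le
    (fun _ _ => prodLaw_pos_of_idealCond_pos hv hac _ _ _ _ _)).trans ?_
  have hkl : ∀ m : Msg N₁ τ × Msg N₂ τ, kl (idealCond v h₁₂ h₂₁ m.1 m.2) (prodLaw q) ≤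
      ∑ r, 𝔼 k, kl (fun z => 𝔼 e, roundBoth v (m.1.1 r, m.2.1 r) k e z) q := by
    intro m
    rw [show idealCond v h₁₂ h₂₁ m.1 m.2 = _ from
      funext fun z => idealCond_eq_chainLaw v h₁₂ h₂₁ m.1 m.2 z]
    refine kl_chainLaw_le (fun s k e z => expect_nonneg fun o _ => hv _ _ _) (fun s k e => ?_) hq
      (fun s k e z h => ?_) (expect_maskBoth h₁₂ h₂₁) _ _
    · simp only [← expect_sum_comm, hv1, Fintype.expect_const]
    · obtain ⟨o, -, ho⟩ := exists_ne_zero_of_expect_ne_zero h.ne'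
      exact hac _ _ _ ((hv _ _ _).lt_of_ne' ho)
  refine (expect_le_expect fun m _ => hkl m).trans (le_of_eq ?_)
  rw [expect_sum_comm]
  -- The secret parts of each round are uniform, so all rounds contribute the same mean.
  have : ∀ r : Fin (τ + 1), 𝔼 m : Msg N₁ τ × Msg N₂ τ,
      𝔼 k, kl (fun z => 𝔼 e, roundBoth v (m.1.1 r, m.2.1 r) k e z) q = roundKlBoth v q := by
    intro r
    rw [expect_prod_type (A := Msg N₁ τ), roundKlBoth, expect_prod_type (A := Fin N₁.s)]
    rw [expect_msg_fst r (fun s₁ => 𝔼 m₂ : Msg N₂ τ,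
      𝔼 k, kl (fun z => 𝔼 e, roundBoth v (s₁, m₂.1 r) k e z) q)]
    exact expect_congr rfl fun s₁ _ => expect_msg_fst r (fun s₂ =>
      𝔼 k, kl (fun z => 𝔼 e, roundBoth v (s₁, s₂) k e z) q)
  simp [this]

/-- Leakage of the message of the first user in the idealized protocol. -/
theorem mutualInfo_expect_idealCond_le (hv : ∀ i₁ i₂ z, 0 ≤ v i₁ i₂ z)
    (hv1 : ∀ i₁ i₂, ∑ z, v i₁ i₂ z = 1) (hq : ∀ z, 0 ≤ q z) (hq1 : ∑ z, q z = 1)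
    (hac : ∀ i₁ i₂ z, 0 < v i₁ i₂ z → 0 < q z) (h₁₂ : (N₁.e : ℕ) ∣ N₂.k)
    (h₂₁ : (N₂.e : ℕ) ∣ N₁.k) (τ : ℕ) :
    mutualInfo (fun a : Msg N₁ τ × (Fin (τ + 1) → Z) =>
      (Fintype.card (Msg N₁ τ) : ℝ)⁻¹ * 𝔼 m₂, idealCond v h₁₂ h₂₁ a.1 m₂ a.2) ≤
      (τ + 1) * roundKlFst v q := by
  refine (mutualInfo_le_expect_kl (fun (m : Msg N₁ τ) z => 𝔼 m₂, idealCond v h₁₂ h₂₁ m m₂ z)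
    (prodLaw q) (fun _ _ => expect_nonneg fun _ _ => idealCond_nonneg hv _ _ _ _ _) (fun _ => ?_)
    (prodLaw_nonneg hq) (sum_prodLaw hq1).le (fun m z h => ?_)).trans ?_
  · rw [← expect_sum_comm]
    simp only [sum_idealCond hv1, Fintype.expect_const]
  · obtain ⟨m₂, -, h₂⟩ := exists_ne_zero_of_expect_ne_zero h.ne'
    exact prodLaw_pos_of_idealCond_pos hv hac _ _ _ _ _
      ((idealCond_nonneg hv _ _ _ _ _).lt_of_ne' h₂)
  have hkl : ∀ m : Msg N₁ τ, kl (fun z => 𝔼 m₂, idealCond v h₁₂ h₂₁ m m₂ z) (prodLaw q) ≤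
      ∑ r, 𝔼 k, kl (fun z => 𝔼 e, roundFst v (m.1 r) k e z) q := by
    intro m
    simp only [expect_idealCond_eq_chainLaw v h₁₂ h₂₁]
    refine kl_chainLaw_le (fun s k e z => expect_nonneg fun o _ => hv _ _ _) (fun s k e => ?_) hq
      (fun s k e z h => ?_) (expect_maskFst h₁₂) _ _
    · simp only [← expect_sum_comm, hv1, Fintype.expect_const]
    · obtain ⟨o, -, ho⟩ := exists_ne_zero_of_expect_ne_zero h.ne'
      exact hac _ _ _ ((hv _ _ _).lt_of_ne' ho)
  refine (expect_le_expect fun m _ => hkl m).trans (le_of_eq ?_)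
  rw [expect_sum_comm]
  have : ∀ r : Fin (τ + 1), 𝔼 m : Msg N₁ τ,
      𝔼 k, kl (fun z => 𝔼 e, roundFst v (m.1 r) k e z) q = roundKlFst v q := fun r =>
    expect_msg_fst r (fun s => 𝔼 k, kl (fun z => 𝔼 e, roundFst v s k e z) q)
  simp [this]

end Bounds

end Ideal

/-! ### Laws of runs -/

/-- The path law of a sequence of kernels, each of which depends on the past only, has mass one. -/
lemma sum_prod_kernel {T Ω : Type*} [LinearOrder T] [Fintype T] [Fintype Ω] [Nonempty Ω]
    (κ : T → (T → Ω) → Ω → ℝ)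
    (hdep : ∀ j ω ω', (∀ i < j, ω i = ω' i) → κ j ω = κ j ω')
    (h1 : ∀ j ω, ∑ a, κ j ω a = 1) : ∑ ω : T → Ω, ∏ j, κ j ω (ω j) = 1 := by
  -- The sum runs over whole paths, so each time outside `S` is free and contributes a factor `card
  -- Ω`. Multiplication by `card Ω ^ #S` makes the value the same for every `S`. Times are added in
  -- increasing order.
  have hS : ∀ S : Finset T, (∑ ω : T → Ω, ∏ j ∈ S, κ j ω (ω j)) * (Fintype.card Ω : ℝ) ^ #S =
      (Fintype.card Ω : ℝ) ^ Fintype.card T := by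
    intro S
    induction S using Finset.induction_on_max with
    | empty => simp
    | insert a S ha ih =>
      have haS : a ∉ S := fun h => lt_irrefl _ (ha a h)
      have hg : ∀ (ω : T → Ω) (b : Ω), ∏ j ∈ S, κ j (Function.update ω a b)
          (Function.update ω a b j) = ∏ j ∈ S, κ j ω (ω j) := by
        intro ω b
        refine prod_congr rfl fun j hj => ?_
        have hja := ha j hj
        rw [Function.update_of_ne hja.ne,
          hdep j _ ω fun i hi => Function.update_of_ne (hi.trans hja).ne _ _]
      -- The letter at the latest time `a` affects neither the kernels of earlier times nor its own
      -- kernel's dependence on the past. Exchanging it with a free letter thus isolates one kernel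
      -- of mass one.
      have h2 := sum_update_swap a fun ω b => (∏ j ∈ S, κ j ω (ω j)) * κ a ω b
      simp only [hg, ← mul_sum, h1, mul_one] at h2
      have h3 : ∀ (ω : T → Ω) (b : Ω), κ a (Function.update ω a b) = κ a ω := fun ω b =>
        hdep a _ ω fun i hi => Function.update_of_ne hi.ne _ _
      simp only [h3, sum_const, card_univ, nsmul_eq_mul] at h2
      simp only [prod_insert haS, card_insert_of_notMem haS, pow_succ]
      rw [← ih, ← h2, sum_mul, sum_mul]
      refine sum_congr rfl fun ω _ => ?_
      ring
  have := hS univ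
  rw [card_univ] at this
  exact mul_right_cancel₀ (pow_ne_zero _ (by positivity)) (this.trans (one_mul _).symm)

lemma sum_push_prod {R M Z : Type*} [Fintype R] [Fintype Z] (f : R → M) (g : R → Z) (p : R → ℝ)
    (m : M) : ∑ z, push (fun r => (f r, g r)) p (m, z) = push f p m := by
  classical
  simp only [push_eq_sum_ite, Prod.mk.injEq, ite_and]
  rw [sum_comm]
  refine sum_congr rfl fun r _ => ?_
  split_ifs <;> simp

lemma push_fst_of_uniform {R M₁ M₂ : Type*} [Fintype R] [Fintype M₁] [Fintype M₂] [Nonempty M₂]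
    {f : R → M₁ × M₂} {p : R → ℝ} (h : ∀ m, push f p m = (Fintype.card (M₁ × M₂) : ℝ)⁻¹) (m : M₁) :
    push (fun r => (f r).1) p m = (Fintype.card M₁ : ℝ)⁻¹ := by
  rw [← push_push f Prod.fst, push_fst]
  simp [h]

lemma push_snd_of_uniform {R M₁ M₂ : Type*} [Fintype R] [Fintype M₁] [Fintype M₂] [Nonempty M₁]
    {f : R → M₁ × M₂} {p : R → ℝ} (h : ∀ m, push f p m = (Fintype.card (M₁ × M₂) : ℝ)⁻¹) (m : M₂) :
    push (fun r => (f r).2) p m = (Fintype.card M₂ : ℝ)⁻¹ := by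
  rw [← push_push f Prod.snd, push_snd]
  simp only [h, sum_const, card_univ, nsmul_eq_mul, Fintype.card_prod, Nat.cast_mul, mul_inv]
  rw [mul_inv_cancel_left₀ (by positivity)]

/-- Two laws of a uniform message and an observation that agree on a large event have close
mutual informations. -/
lemma mutualInfo_push_le {R M Z : Type*} [Fintype R] [Fintype M] [Nonempty M] [Fintype Z]
    (f : R → M) (g : R → Z) {p p' : R → ℝ} (hp : ∀ r, 0 ≤ p r) (hp' : ∀ r, 0 ≤ p' r)
    (G : R → Prop) [DecidablePred G] (hG : ∀ r, G r → p r = p' r)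
    (hM : ∀ m, push f p m = (Fintype.card M : ℝ)⁻¹)
    (hM' : ∀ m, push f p' m = (Fintype.card M : ℝ)⁻¹) {η : ℝ}
    (hη : ∑ r, (if G r then 0 else p' r) ≤ η) :
    mutualInfo (push (fun r => (f r, g r)) p) ≤
      mutualInfo (push (fun r => (f r, g r)) p') + keyErrorTerm η (Fintype.card M) := by
  classical
  set c : R → ℝ := fun r => if G r then p' r else 0 with hc
  have hc0 : ∀ r, 0 ≤ c r := fun r => by
    simp only [hc]
    split_ifs
    exacts [hp' r, le_rfl]
  refine mutualInfo_le_add_of_common (c := push (fun r => (f r, g r)) c)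
    (fun a => push_nonneg _ hc0 _) (fun a => sum_le_sum fun r _ => ?_)
    (fun a => sum_le_sum fun r _ => ?_) (fun m => (sum_push_prod f g p m).trans (hM m))
    (fun m => (sum_push_prod f g p' m).trans (hM' m)) ?_
  · simp only [hc]
    split_ifs with h
    exacts [(hG r h).ge, hp r]
  · simp only [hc]
    split_ifs with h
    exacts [le_rfl, hp' r]
  · rw [sum_push]
    have h1 : ∑ r, p' r = 1 := by
      rw [← sum_push f p', sum_congr rfl fun m _ => hM' m]
      simp
    refine le_trans (le_of_eq ?_) hη
    rw [← h1, ← sum_sub_distrib]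
    refine sum_congr rfl fun r _ => ?_
    simp only [hc]
    split_ifs <;> simp

/-- The image of a product law under a letterwise map is the product of the images. -/
lemma push_prod {I Ω Z : Type*} [Fintype I] [DecidableEq I] [Fintype Ω] (g : Ω → Z)
    (κ : I → Ω → ℝ) (z : I → Z) :
    push (fun (ω : I → Ω) j => g (ω j)) (fun ω => ∏ j, κ j (ω j)) z = ∏ j, push g (κ j) (z j) := by
  classical
  simp only [push_eq_sum_ite]
  rw [← sum_prod_eq_prod_sum fun j a => if g a = z j then κ j a else 0]
  refine sum_congr rfl fun ω _ => ?_
  split_ifs with h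
  · exact prod_congr rfl fun j _ => by rw [if_pos (congrFun h j)]
  · obtain ⟨j, hj⟩ := Function.ne_iff.1 h
    exact (prod_eq_zero (mem_univ j) (if_neg hj)).symm

section Runs

variable {V₁ V₂ X₁ X₂ Y₁ Y₂ Z : Type*}
  [Fintype V₁] [Fintype V₂] [Fintype X₁] [Fintype X₂] [Fintype Y₁] [Fintype Y₂] [Fintype Z]

/-- Law of the inputs and outputs at one time for given codeword letters. -/
def letterLaw (W : X₁ → X₂ → stdSimplex ℝ (Y₁ × Y₂ × Z)) (Q₁ : InputLaw V₁ X₁)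
    (Q₂ : InputLaw V₂ X₂) (v₁ : V₁) (v₂ : V₂) (a : (X₁ × X₂) × (Y₁ × Y₂ × Z)) : ℝ :=
  Q₁.chan v₁ a.1.1 * Q₂.chan v₂ a.1.2 * W a.1.1 a.1.2 a.2

variable (W : X₁ → X₂ → stdSimplex ℝ (Y₁ × Y₂ × Z)) (Q₁ : InputLaw V₁ X₁) (Q₂ : InputLaw V₂ X₂)

lemma letterLaw_nonneg (v₁ : V₁) (v₂ : V₂) (a : (X₁ × X₂) × (Y₁ × Y₂ × Z)) :
    0 ≤ letterLaw W Q₁ Q₂ v₁ v₂ a :=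
  mul_nonneg (mul_nonneg ((Q₁.chan v₁).2.1 _) ((Q₂.chan v₂).2.1 _)) ((W _ _).2.1 _)

lemma sum_simplex {A : Type*} [Fintype A] (p : stdSimplex ℝ A) : ∑ a, p a = 1 := p.2.2

lemma simplex_nonneg {A : Type*} [Fintype A] (p : stdSimplex ℝ A) (a : A) : 0 ≤ p a := p.2.1 a

lemma sum_letter (p₁ : stdSimplex ℝ X₁) (p₂ : stdSimplex ℝ X₂) :
    ∑ a : (X₁ × X₂) × (Y₁ × Y₂ × Z), p₁ a.1.1 * p₂ a.1.2 * W a.1.1 a.1.2 a.2 = 1 := by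
  rw [Fintype.sum_prod_type]
  simp only [← mul_sum, sum_simplex, mul_one]
  rw [Fintype.sum_prod_type]
  simp only [← mul_sum, sum_simplex, mul_one]

lemma sum_letterLaw (v₁ : V₁) (v₂ : V₂) : ∑ a, letterLaw W Q₁ Q₂ v₁ v₂ a = 1 :=
  sum_letter W _ _

section Adaptive

variable {T M₁ M₂ U₁ U₂ : Type*} [LinearOrder T] [Fintype T] [Fintype M₁] [Fintype M₂] [Fintype U₁]
  [Fintype U₂] (A₁ : AdaptiveUser T M₁ M₂ U₁ X₁ Y₁) (A₂ : AdaptiveUser T M₂ M₁ U₂ X₂ Y₂)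

lemma runLaw_nonneg (r : Run T M₁ M₂ U₁ U₂ X₁ X₂ Y₁ Y₂ Z) : 0 ≤ runLaw W A₁ A₂ r := by
  obtain ⟨⟨m₁, m₂⟩, ⟨u₁, u₂⟩, ω⟩ := r
  refine mul_nonneg (mul_nonneg (mul_nonneg (by positivity) (simplex_nonneg _ _))
    (simplex_nonneg _ _)) (prod_nonneg fun j _ => ?_)
  exact mul_nonneg (mul_nonneg (simplex_nonneg _ _) (simplex_nonneg _ _)) (simplex_nonneg _ _)

/-- Both encoders use strictly past observations only, so the channel uses integrate to one for
fixed messages and private randomness. -/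
lemma push_fst_runLaw [Nonempty ((X₁ × X₂) × (Y₁ × Y₂ × Z))] (m : M₁ × M₂) :
    push Prod.fst (runLaw W A₁ A₂) m = (Fintype.card (M₁ × M₂) : ℝ)⁻¹ := by
  obtain ⟨m₁, m₂⟩ := m
  rw [push_fst, Fintype.sum_prod_type]
  have h1 : ∀ u : U₁ × U₂, ∑ ω : T → (X₁ × X₂) × (Y₁ × Y₂ × Z), runLaw W A₁ A₂ ((m₁, m₂), (u, ω)) =
      (Fintype.card (M₁ × M₂) : ℝ)⁻¹ * (A₁.rand u.1 * A₂.rand u.2) := by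
    rintro ⟨u₁, u₂⟩
    have h2 := sum_prod_kernel (T := T) (Ω := (X₁ × X₂) × (Y₁ × Y₂ × Z)) (fun j ω a =>
      A₁.enc j m₁ u₁ (fun i => ((ω i).1.1, (ω i).2.1)) a.1.1 *
        A₂.enc j m₂ u₂ (fun i => ((ω i).1.2, (ω i).2.2.1)) a.1.2 * W a.1.1 a.1.2 a.2)
      (fun j ω ω' h => by
        have e1 : (fun i : {i : T // i < j} => ω i) = fun i : {i : T // i < j} => ω' i :=
          funext fun i => h i i.2
        have e2 : ∀ i : {i : T // i < j}, ω i = ω' i := fun i => congrFun e1 i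
        simp only [e2])
      (fun j ω => sum_letter W _ _)
    calc _ = ∑ ω : T → (X₁ × X₂) × (Y₁ × Y₂ × Z), (Fintype.card M₁ : ℝ)⁻¹ *
        (Fintype.card M₂ : ℝ)⁻¹ * A₁.rand u₁ * A₂.rand u₂ * ∏ j,
          (A₁.enc j m₁ u₁ (fun i => ((ω i).1.1, (ω i).2.1)) (ω j).1.1 *
          A₂.enc j m₂ u₂ (fun i => ((ω i).1.2, (ω i).2.2.1)) (ω j).1.2 *
          W (ω j).1.1 (ω j).1.2 (ω j).2) := rfl
      _ = _ := by
        rw [← mul_sum, h2, Fintype.card_prod, Nat.cast_mul, mul_inv]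
        ring
  simp only [h1]
  rw [← mul_sum, Fintype.sum_prod_type]
  simp only [← mul_sum, sum_simplex, mul_one]

end Adaptive

variable {N₁ N₂ : Sizes} {n : ℕ}

/-- Words over all times, sorted by rounds. -/
def blockEquiv (τ n : ℕ) (Ω : Type*) : (Times τ n → Ω) ≃ (Fin (τ + 1) → Fin n → Ω) where
  toFun ω r i := ω (toLex (r, i))
  invFun f j := f (ofLex j).1 (ofLex j).2
  left_inv _ := rfl
  right_inv _ := rfl

lemma prod_times {τ n : ℕ} {R : Type*} [CommMonoid R] (f : Times τ n → R) :
    ∏ j, f j = ∏ r, ∏ i, f (toLex (r, i)) := by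
  rw [← Fintype.prod_prod_type' (f := fun r i => f (toLex (r, i)))]
  exact (Equiv.prod_comp (toLex : Fin (τ + 1) × Fin n ≃ Times τ n) f).symm

-- Coupling of the key-exchange code with the idealized protocol.

section Ideal

variable (h₁₂ : (N₁.e : ℕ) ∣ N₂.k) (h₂₁ : (N₂.e : ℕ) ∣ N₁.k) (τ : ℕ)
  (B₁ : BlockUser V₁ X₁ Y₁ N₁ N₂ n) (B₂ : BlockUser V₂ X₂ Y₂ N₂ N₁ n)

/-- Law of a run of the idealized protocol. -/
def idealRunLaw : Run (Times τ n) (Msg N₁ τ) (Msg N₂ τ) (Priv N₁ τ) (Priv N₂ τ) X₁ X₂ Y₁ Y₂ Z → ℝ :=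
  fun r => (Fintype.card (Msg N₁ τ) : ℝ)⁻¹ * (Fintype.card (Msg N₂ τ) : ℝ)⁻¹ *
    (Fintype.card (Priv N₁ τ) : ℝ)⁻¹ * (Fintype.card (Priv N₂ τ) : ℝ)⁻¹ *
    ∏ j, letterLaw W Q₁ Q₂
      (B₁.word (idealIndex h₁₂ r.1.1 r.2.1.1 (fun q => (r.2.1.2.1 q).1) (ofLex j).1) (ofLex j).2)
      (B₂.word (idealIndex h₂₁ r.1.2 r.2.1.2 (fun q => (r.2.1.1.1 q).1) (ofLex j).1) (ofLex j).2)
      (r.2.2 j)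

lemma idealRunLaw_nonneg
    (r : Run (Times τ n) (Msg N₁ τ) (Msg N₂ τ) (Priv N₁ τ) (Priv N₂ τ) X₁ X₂ Y₁ Y₂ Z) :
    0 ≤ idealRunLaw W Q₁ Q₂ h₁₂ h₂₁ τ B₁ B₂ r :=
  mul_nonneg (by positivity) (prod_nonneg fun _ _ => letterLaw_nonneg _ _ _ _ _ _)

/-- Every round is decoded correctly, when the indices are those of the idealized protocol. -/
def AllCorrect
    (r : Run (Times τ n) (Msg N₁ τ) (Msg N₂ τ) (Priv N₁ τ) (Priv N₂ τ) X₁ X₂ Y₁ Y₂ Z) : Prop :=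
  ∀ ρ : Fin (τ + 1),
    B₂.dec (fun i => (r.2.2 (toLex (ρ, i))).1.2) (fun i => (r.2.2 (toLex (ρ, i))).2.2.1) =
      idealIndex h₁₂ r.1.1 r.2.1.1 (fun q => (r.2.1.2.1 q).1) ρ ∧
    B₁.dec (fun i => (r.2.2 (toLex (ρ, i))).1.1) (fun i => (r.2.2 (toLex (ρ, i))).2.1) =
      idealIndex h₂₁ r.1.2 r.2.1.2 (fun q => (r.2.1.1.1 q).1) ρ

/-- On this event the decoded keys are the true ones, so the actual and ideal masks coincide. No
induction over the rounds is needed, because the event compares the decoder outputs with the ideal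
indices directly. -/
lemma runLaw_eq_idealRunLaw
    (r : Run (Times τ n) (Msg N₁ τ) (Msg N₂ τ) (Priv N₁ τ) (Priv N₂ τ) X₁ X₂ Y₁ Y₂ Z)
    (hr : AllCorrect h₁₂ h₂₁ τ B₁ B₂ r) :
    runLaw W (keyExchange Q₁ B₁ h₁₂ h₂₁ τ) (keyExchange Q₂ B₂ h₂₁ h₁₂ τ) r =
      idealRunLaw W Q₁ Q₂ h₁₂ h₂₁ τ B₁ B₂ r := by
  obtain ⟨⟨m₁, m₂⟩, ⟨u₁, u₂⟩, ω⟩ := r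
  have e1 : ∀ ρ : Fin (τ + 1), sentE B₁ h₁₂ m₁ u₁ ρ
      (fun q _ i => ((ω (toLex (q, i))).1.1, (ω (toLex (q, i))).2.1)) =
      (idealIndex h₁₂ m₁ u₁ (fun q => (u₂.1 q).1) ρ).2.2.1 := by
    refine Fin.cases rfl fun q => ?_
    have := (hr q.castSucc).2
    dsimp only at this
    simp [sentE, idealIndex, this]
  have e2 : ∀ ρ : Fin (τ + 1), sentE B₂ h₂₁ m₂ u₂ ρ
      (fun q _ i => ((ω (toLex (q, i))).1.2, (ω (toLex (q, i))).2.2.1)) =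
      (idealIndex h₂₁ m₂ u₂ (fun q => (u₁.1 q).1) ρ).2.2.1 := by
    refine Fin.cases rfl fun q => ?_
    have := (hr q.castSucc).1
    dsimp only at this
    simp [sentE, idealIndex, this]
  unfold runLaw idealRunLaw
  dsimp only
  refine congrArg₂ _ rfl (prod_congr rfl fun j _ => ?_)
  unfold letterLaw keyExchange
  dsimp only
  rw [e1, e2]
  rfl

omit [Fintype Y₁] [Fintype Y₂] [Fintype Z] in
lemma not_error_of_allCorrect
    (r : Run (Times τ n) (Msg N₁ τ) (Msg N₂ τ) (Priv N₁ τ) (Priv N₂ τ) X₁ X₂ Y₁ Y₂ Z)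
    (hr : AllCorrect h₁₂ h₂₁ τ B₁ B₂ r) :
    (keyExchange Q₁ B₁ h₁₂ h₂₁ τ).dec r.1.1 r.2.1.1 (fun j => ((r.2.2 j).1.1, (r.2.2 j).2.1)) =
      r.1.2 ∧
    (keyExchange Q₂ B₂ h₂₁ h₁₂ τ).dec r.1.2 r.2.1.2 (fun j => ((r.2.2 j).1.2, (r.2.2 j).2.2.1)) =
      r.1.1 := by
  constructor
  · refine Prod.ext (funext fun ρ => ?_) (funext fun q => ?_)
    · simp [keyExchange, (hr ρ).2, idealIndex]
    · simp [keyExchange, (hr q.succ).2, idealIndex]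
  · refine Prod.ext (funext fun ρ => ?_) (funext fun q => ?_)
    · simp [keyExchange, (hr ρ).1, idealIndex]
    · simp [keyExchange, (hr q.succ).1, idealIndex]

lemma sum_idealRunLaw (m : Msg N₁ τ × Msg N₂ τ) (u : Priv N₁ τ × Priv N₂ τ) :
    ∑ ω, idealRunLaw W Q₁ Q₂ h₁₂ h₂₁ τ B₁ B₂ (m, u, ω) = (Fintype.card (Msg N₁ τ) : ℝ)⁻¹ *
      (Fintype.card (Msg N₂ τ) : ℝ)⁻¹ * (Fintype.card (Priv N₁ τ) : ℝ)⁻¹ *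
      (Fintype.card (Priv N₂ τ) : ℝ)⁻¹ := by
  unfold idealRunLaw
  rw [← mul_sum]
  dsimp only
  rw [sum_prod_eq_prod_sum fun (j : Times τ n) a => letterLaw W Q₁ Q₂
      (B₁.word (idealIndex h₁₂ m.1 u.1 (fun q => (u.2.1 q).1) (ofLex j).1) (ofLex j).2)
      (B₂.word (idealIndex h₂₁ m.2 u.2 (fun q => (u.1.1 q).1) (ofLex j).1) (ofLex j).2) a]
  simp only [sum_letterLaw, prod_const_one, mul_one]

lemma push_fst_idealRunLaw (m : Msg N₁ τ × Msg N₂ τ) :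
    push Prod.fst (idealRunLaw W Q₁ Q₂ h₁₂ h₂₁ τ B₁ B₂) m =
      (Fintype.card (Msg N₁ τ × Msg N₂ τ) : ℝ)⁻¹ := by
  rw [push_fst, Fintype.sum_prod_type]
  simp only [sum_idealRunLaw, sum_const, card_univ, nsmul_eq_mul]
  rw [Fintype.card_prod, Fintype.card_prod (Msg N₁ τ), Nat.cast_mul, Nat.cast_mul, mul_inv]
  have h1 : (Fintype.card (Priv N₁ τ) : ℝ) ≠ 0 := by positivity
  have h2 : (Fintype.card (Priv N₂ τ) : ℝ) ≠ 0 := by positivity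
  field_simp

lemma push_letterLaw_eve (v₁ : V₁) (v₂ : V₂) (z : Z) :
    push (fun a : (X₁ × X₂) × (Y₁ × Y₂ × Z) => a.2.2.2) (letterLaw W Q₁ Q₂ v₁ v₂) z =
      eveChan W Q₁ Q₂ v₁ v₂ z := by
  classical
  rw [push_eq_sum_ite]
  simp [Fintype.sum_prod_type, letterLaw, eveChan]

lemma push_idealRunLaw :
    push (fun r => (r.1, fun j => (r.2.2 j).2.2.2)) (idealRunLaw W Q₁ Q₂ h₁₂ h₂₁ τ B₁ B₂) =
      idealEveLaw W Q₁ Q₂ B₁ B₂ h₁₂ h₂₁ τ := by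
  classical
  funext ⟨m, z⟩
  rw [push_eq_sum_ite, Fintype.sum_prod_type]
  simp only [Prod.mk.injEq, ite_and]
  rw [Fintype.sum_eq_single m (fun m' h => by simp [h])]
  simp only [if_true]
  rw [Fintype.sum_prod_type, Fintype.sum_prod_type]
  unfold idealEveLaw
  dsimp only
  simp only [mul_sum]
  refine sum_congr rfl fun u₁ _ => sum_congr rfl fun u₂ _ => ?_
  unfold idealRunLaw
  dsimp only
  set κ : Times τ n → (X₁ × X₂) × (Y₁ × Y₂ × Z) → ℝ := fun j a => letterLaw W Q₁ Q₂
      (B₁.word (idealIndex h₁₂ m.1 u₁ (fun q => (u₂.1 q).1) (ofLex j).1) (ofLex j).2)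
      (B₂.word (idealIndex h₂₁ m.2 u₂ (fun q => (u₁.1 q).1) (ofLex j).1) (ofLex j).2) a with hκ
  have h2 : ∑ ω : Times τ n → (X₁ × X₂) × (Y₁ × Y₂ × Z),
      (if (fun j => (ω j).2.2.2) = z then ∏ j, κ j (ω j) else 0) =
      ∏ r, ∏ i, eveChan W Q₁ Q₂
          (B₁.word (idealIndex h₁₂ m.1 u₁ (fun q => (u₂.1 q).1) r) i)
          (B₂.word (idealIndex h₂₁ m.2 u₂ (fun q => (u₁.1 q).1) r) i) (z (toLex (r, i))) := by
    rw [← push_eq_sum_ite (fun (ω : Times τ n → (X₁ × X₂) × (Y₁ × Y₂ × Z)) j => (ω j).2.2.2)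
      (fun ω => ∏ j, κ j (ω j)) z,
      push_prod (fun a : (X₁ × X₂) × (Y₁ × Y₂ × Z) => a.2.2.2), prod_times]
    exact prod_congr rfl fun r _ => prod_congr rfl fun i _ => push_letterLaw_eve W Q₁ Q₂ _ _ _
  rw [← h2, mul_sum, mul_sum]
  refine sum_congr rfl fun ω _ => ?_
  split_ifs <;> simp [mul_assoc, hκ]

end Ideal

end Runs

/-! ### Error probability of the idealized protocol -/

/-- In the idealized protocol with uniform messages, the indices of a round are uniform. -/
lemma expect_idealIndex {N₁ N₂ : Sizes} (h₁₂ : (N₁.e : ℕ) ∣ N₂.k) (h₂₁ : (N₂.e : ℕ) ∣ N₁.k)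
    {τ : ℕ} (ρ : Fin (τ + 1)) (f : Index N₁ → Index N₂ → ℝ) :
    𝔼 m₁ : Msg N₁ τ, 𝔼 x : Msg N₂ τ × Priv N₁ τ × Priv N₂ τ,
      f (idealIndex h₁₂ m₁ x.2.1 (fun q => (x.2.2.1 q).1) ρ)
        (idealIndex h₂₁ x.1 x.2.2 (fun q => (x.2.1.1 q).1) ρ) = 𝔼 i₁, 𝔼 i₂, f i₁ i₂ := by
  set g : Fin N₁.s → ZMod N₁.k × ZMod N₂.k → ZMod N₁.e → ℝ := fun s k e =>
    𝔼 y : Fin N₁.o × Fin N₂.s × ZMod N₂.e × Fin N₂.o,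
      f (s, k.1, e, y.1) (y.2.1, k.2, y.2.2.1, y.2.2.2) with hg
  have h1 : ∀ m₁ : Msg N₁ τ, 𝔼 x : Msg N₂ τ × Priv N₁ τ × Priv N₂ τ,
      f (idealIndex h₁₂ m₁ x.2.1 (fun q => (x.2.2.1 q).1) ρ)
        (idealIndex h₂₁ x.1 x.2.2 (fun q => (x.2.1.1 q).1) ρ) =
      𝔼 e₀ : ZMod N₁.e, 𝔼 k : Fin (τ + 1) → ZMod N₁.k × ZMod N₂.k, g (m₁.1 ρ) (k ρ)
        (Fin.cases e₀ (fun q => m₁.2 q + maskFst h₁₂ (k q.castSucc)) ρ) := by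
    intro m₁
    let e : ZMod N₁.e → (Fin (τ + 1) → ZMod N₁.k × ZMod N₂.k) → ZMod N₁.e :=
      fun e₀ k => Fin.cases e₀ (fun q => m₁.2 q + maskFst h₁₂ (k q.castSucc)) ρ
    refine (Fintype.expect_equiv (msgPrivEquiv N₁ h₂₁ τ) _ (fun x =>
      f (m₁.1 ρ, (x.2.1 ρ).1, e x.1 x.2.1, (x.2.2 ρ).1)
        ((x.2.2 ρ).2.1, (x.2.1 ρ).2, (x.2.2 ρ).2.2.1, (x.2.2 ρ).2.2.2)) fun u => ?_).trans ?_
    · rfl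
    · rw [expect_prod_type (A := ZMod N₁.e)]
      refine expect_congr rfl fun e₀ _ => ?_
      rw [expect_prod_type (A := Fin (τ + 1) → ZMod N₁.k × ZMod N₂.k)]
      refine expect_congr rfl fun k _ => ?_
      exact expect_pi_eval ρ (fun y : Fin N₁.o × Fin N₂.s × ZMod N₂.e × Fin N₂.o =>
        f (m₁.1 ρ, (k ρ).1, e e₀ k, y.1) (y.2.1, (k ρ).2, y.2.2.1, y.2.2.2))
  have h2 : 𝔼 m₁ : Msg N₁ τ, 𝔼 e₀ : ZMod N₁.e, 𝔼 k : Fin (τ + 1) → ZMod N₁.k × ZMod N₂.k,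
      g (m₁.1 ρ) (k ρ) (Fin.cases e₀ (fun q => m₁.2 q + maskFst h₁₂ (k q.castSucc)) ρ) =
      𝔼 s, 𝔼 k, 𝔼 e, g s k e := by
    rw [expect_prod_type (A := Fin (τ + 1) → Fin N₁.s)]
    refine Eq.trans (expect_congr rfl fun s _ => ?_)
      (expect_pi_eval ρ fun s => 𝔼 k, 𝔼 e, g s k e)
    -- In the first round the filler is uniform. In a later round the message part is uniform, and
    -- adding a mask from the previous round keeps it uniform and independent of the current keys.
    refine Fin.cases ?_ (fun q => ?_) ρ
    · simp only [Fin.cases_zero, Fintype.expect_const]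
      rw [expect_comm']
      exact expect_pi_eval 0 fun k => 𝔼 e, g (s 0) k e
    · simp only [Fin.cases_succ, Fintype.expect_const]
      rw [expect_comm']
      refine Eq.trans (expect_congr rfl fun k _ => ?_)
        (expect_pi_eval q.succ fun k => 𝔼 e, g (s q.succ) k e)
      rw [expect_pi_eval q fun e => g (s q.succ) (k q.succ) (e + maskFst h₁₂ (k q.castSucc)),
        expect_add_right _ fun e => g (s q.succ) (k q.succ) e]
  simp only [h1]
  rw [h2, expect_prod_type (A := Fin N₁.s)]
  refine expect_congr rfl fun s _ => ?_
  rw [hg]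
  simp only [expect_prod_type]
  -- both sides are means over all remaining parts
  have h3 : ∀ k₁ : ZMod N₁.k, 𝔼 k₂ : ZMod N₂.k, 𝔼 e₁ : ZMod N₁.e, 𝔼 o₁ : Fin N₁.o, 𝔼 s₂ : Fin N₂.s,
      𝔼 e₂ : ZMod N₂.e, 𝔼 o₂ : Fin N₂.o, f (s, k₁, e₁, o₁) (s₂, k₂, e₂, o₂) =
      𝔼 e₁ : ZMod N₁.e, 𝔼 o₁ : Fin N₁.o, 𝔼 s₂ : Fin N₂.s, 𝔼 k₂ : ZMod N₂.k,
      𝔼 e₂ : ZMod N₂.e, 𝔼 o₂ : Fin N₂.o, f (s, k₁, e₁, o₁) (s₂, k₂, e₂, o₂) := by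
    intro k₁
    rw [expect_comm']
    refine expect_congr rfl fun e₁ _ => ?_
    rw [expect_comm']
    refine expect_congr rfl fun o₁ _ => ?_
    rw [expect_comm']
  exact expect_congr rfl fun k₁ _ => h3 k₁

section Error

variable {V₁ V₂ X₁ X₂ Y₁ Y₂ Z : Type*}
  [Fintype V₁] [Fintype V₂] [Fintype X₁] [Fintype X₂] [Fintype Y₁] [Fintype Y₂] [Fintype Z]
  (W : X₁ → X₂ → stdSimplex ℝ (Y₁ × Y₂ × Z)) (Q₁ : InputLaw V₁ X₁) (Q₂ : InputLaw V₂ X₂)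
  {N₁ N₂ : Sizes} {n : ℕ} (B₁ : BlockUser V₁ X₁ Y₁ N₁ N₂ n) (B₂ : BlockUser V₂ X₂ Y₂ N₂ N₁ n)

open scoped Classical in
/-- Number of users that decode a block wrongly. -/
def wrongCount (i₁ : Index N₁) (i₂ : Index N₂) (ω : Fin n → (X₁ × X₂) × (Y₁ × Y₂ × Z)) : ℝ :=
  (if B₂.dec (fun i => (ω i).1.2) (fun i => (ω i).2.2.1) ≠ i₁ then 1 else 0) +
    (if B₁.dec (fun i => (ω i).1.1) (fun i => (ω i).2.1) ≠ i₂ then 1 else 0)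

/-- Sum of the two error probabilities of a non-adaptive code for given indices. -/
def indexError (i₁ : Index N₁) (i₂ : Index N₂) : ℝ :=
  ∑ ω : Fin n → (X₁ × X₂) × (Y₁ × Y₂ × Z),
    (∏ i, letterLaw W Q₁ Q₂ (B₁.word i₁ i) (B₂.word i₂ i) (ω i)) * wrongCount B₁ B₂ i₁ i₂ ω

/-- Sum of the two average error probabilities of a non-adaptive code. -/
def blockError : ℝ := 𝔼 i₁, 𝔼 i₂, indexError W Q₁ Q₂ B₁ B₂ i₁ i₂

omit [Fintype V₁] [Fintype V₂] [Fintype X₁] [Fintype X₂] [Fintype Y₁] [Fintype Y₂] [Fintype Z] in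
lemma wrongCount_nonneg (i₁ : Index N₁) (i₂ : Index N₂)
    (ω : Fin n → (X₁ × X₂) × (Y₁ × Y₂ × Z)) : 0 ≤ wrongCount B₁ B₂ i₁ i₂ ω := by
  unfold wrongCount
  split_ifs <;> norm_num

lemma blockError_nonneg : 0 ≤ blockError W Q₁ Q₂ B₁ B₂ :=
  expect_nonneg fun _ _ => expect_nonneg fun _ _ => sum_nonneg fun _ _ =>
    mul_nonneg (prod_nonneg fun _ _ => letterLaw_nonneg _ _ _ _ _ _) (wrongCount_nonneg _ _ _ _ _)

variable (h₁₂ : (N₁.e : ℕ) ∣ N₂.k) (h₂₁ : (N₂.e : ℕ) ∣ N₁.k) (τ : ℕ)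

/-- For fixed messages and private randomness the rounds are independent. All rounds but `ρ`
integrate to one and leave the error of a single block. -/
lemma sum_idealRunLaw_mul_wrongCount (m : Msg N₁ τ × Msg N₂ τ) (u : Priv N₁ τ × Priv N₂ τ)
    (ρ : Fin (τ + 1)) :
    ∑ ω : Times τ n → (X₁ × X₂) × (Y₁ × Y₂ × Z), idealRunLaw W Q₁ Q₂ h₁₂ h₂₁ τ B₁ B₂ (m, u, ω) *
      wrongCount B₁ B₂ (idealIndex h₁₂ m.1 u.1 (fun q => (u.2.1 q).1) ρ)
        (idealIndex h₂₁ m.2 u.2 (fun q => (u.1.1 q).1) ρ) (fun i => ω (toLex (ρ, i))) =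
    (Fintype.card (Msg N₁ τ) : ℝ)⁻¹ * (Fintype.card (Msg N₂ τ) : ℝ)⁻¹ *
      (Fintype.card (Priv N₁ τ) : ℝ)⁻¹ * (Fintype.card (Priv N₂ τ) : ℝ)⁻¹ *
      indexError W Q₁ Q₂ B₁ B₂ (idealIndex h₁₂ m.1 u.1 (fun q => (u.2.1 q).1) ρ)
        (idealIndex h₂₁ m.2 u.2 (fun q => (u.1.1 q).1) ρ) := by
  classical
  set i₁ : Fin (τ + 1) → Index N₁ := fun r => idealIndex h₁₂ m.1 u.1 (fun q => (u.2.1 q).1) r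
    with hi₁
  set i₂ : Fin (τ + 1) → Index N₂ := fun r => idealIndex h₂₁ m.2 u.2 (fun q => (u.1.1 q).1) r
    with hi₂
  unfold idealRunLaw
  dsimp only
  simp only [mul_assoc, ← mul_sum]
  simp only [← mul_assoc]
  congr 1
  set F : Fin (τ + 1) → (Fin n → (X₁ × X₂) × (Y₁ × Y₂ × Z)) → ℝ := fun r ω =>
    (∏ i, letterLaw W Q₁ Q₂ (B₁.word (i₁ r) i) (B₂.word (i₂ r) i) (ω i)) *
      if r = ρ then wrongCount B₁ B₂ (i₁ ρ) (i₂ ρ) ω else 1 with hF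
  have h1 : ∑ f : Fin (τ + 1) → Fin n → (X₁ × X₂) × (Y₁ × Y₂ × Z), ∏ r, F r (f r) =
      indexError W Q₁ Q₂ B₁ B₂ (i₁ ρ) (i₂ ρ) := by
    rw [sum_prod_eq_prod_sum, prod_eq_single ρ]
    · simp only [hF, if_true]
      rfl
    · intro r _ hr
      simp only [hF, if_neg hr, mul_one]
      rw [sum_prod_eq_prod_sum fun i a =>
        letterLaw W Q₁ Q₂ (B₁.word (i₁ r) i) (B₂.word (i₂ r) i) a]
      simp only [sum_letterLaw, prod_const_one]
    · simp
  rw [← h1, ← (blockEquiv τ n ((X₁ × X₂) × (Y₁ × Y₂ × Z))).sum_comp]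
  refine sum_congr rfl fun ω _ => ?_
  rw [prod_times]
  simp only [hF]
  rw [prod_mul_distrib]
  congr 1
  rw [prod_eq_single ρ (fun r _ hr => if_neg hr) (by simp), if_pos rfl]
  rfl

open scoped Classical in
/-- Union bound over the rounds of the idealized protocol. -/
theorem sum_not_allCorrect_le :
    ∑ r, (if AllCorrect h₁₂ h₂₁ τ B₁ B₂ r then 0 else idealRunLaw W Q₁ Q₂ h₁₂ h₂₁ τ B₁ B₂ r) ≤
      (τ + 1) * blockError W Q₁ Q₂ B₁ B₂ := by
  have h1 : ∀ r : Run (Times τ n) (Msg N₁ τ) (Msg N₂ τ) (Priv N₁ τ) (Priv N₂ τ) X₁ X₂ Y₁ Y₂ Z,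
      (if AllCorrect h₁₂ h₂₁ τ B₁ B₂ r then 0 else idealRunLaw W Q₁ Q₂ h₁₂ h₂₁ τ B₁ B₂ r) ≤
      ∑ ρ, idealRunLaw W Q₁ Q₂ h₁₂ h₂₁ τ B₁ B₂ r *
        wrongCount B₁ B₂ (idealIndex h₁₂ r.1.1 r.2.1.1 (fun q => (r.2.1.2.1 q).1) ρ)
        (idealIndex h₂₁ r.1.2 r.2.1.2 (fun q => (r.2.1.1.1 q).1) ρ)
        (fun i => r.2.2 (toLex (ρ, i))) := by
    intro r
    have h0 := idealRunLaw_nonneg W Q₁ Q₂ h₁₂ h₂₁ τ B₁ B₂ r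
    have hn : ∀ ρ ∈ univ, 0 ≤ idealRunLaw W Q₁ Q₂ h₁₂ h₂₁ τ B₁ B₂ r *
        wrongCount B₁ B₂ (idealIndex h₁₂ r.1.1 r.2.1.1 (fun q => (r.2.1.2.1 q).1) ρ)
        (idealIndex h₂₁ r.1.2 r.2.1.2 (fun q => (r.2.1.1.1 q).1) ρ)
        (fun i => r.2.2 (toLex (ρ, i))) := fun ρ _ => mul_nonneg h0 (wrongCount_nonneg _ _ _ _ _)
    split_ifs with h
    · exact sum_nonneg hn
    · obtain ⟨ρ, hρ⟩ := not_forall.1 h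
      refine le_trans (le_mul_of_one_le_right h0 ?_) (single_le_sum hn (mem_univ ρ))
      unfold wrongCount
      by_cases hb : B₂.dec (fun i => (r.2.2 (toLex (ρ, i))).1.2)
          (fun i => (r.2.2 (toLex (ρ, i))).2.2.1) =
          idealIndex h₁₂ r.1.1 r.2.1.1 (fun q => (r.2.1.2.1 q).1) ρ
      · rw [if_pos (fun hc => hρ ⟨hb, hc⟩)]
        split_ifs <;> norm_num
      · rw [if_pos hb]
        split_ifs <;> norm_num
  refine (sum_le_sum fun r _ => h1 r).trans (le_of_eq ?_)
  rw [sum_comm]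
  -- The indices of each round are uniform, so the mean error of a round is the average block error.
  have h2 : ∀ ρ : Fin (τ + 1),
      ∑ r : Run (Times τ n) (Msg N₁ τ) (Msg N₂ τ) (Priv N₁ τ) (Priv N₂ τ) X₁ X₂ Y₁ Y₂ Z,
      idealRunLaw W Q₁ Q₂ h₁₂ h₂₁ τ B₁ B₂ r *
        wrongCount B₁ B₂ (idealIndex h₁₂ r.1.1 r.2.1.1 (fun q => (r.2.1.2.1 q).1) ρ)
        (idealIndex h₂₁ r.1.2 r.2.1.2 (fun q => (r.2.1.1.1 q).1) ρ)
        (fun i => r.2.2 (toLex (ρ, i))) = blockError W Q₁ Q₂ B₁ B₂ := by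
    intro ρ
    rw [blockError, ← expect_idealIndex h₁₂ h₂₁ ρ (indexError W Q₁ Q₂ B₁ B₂),
      Fintype.sum_prod_type, Fintype.sum_prod_type (α₁ := Msg N₁ τ)]
    rw [expect_eq_sum_inv_mul]
    refine sum_congr rfl fun m₁ _ => ?_
    rw [expect_eq_sum_inv_mul, mul_sum, Fintype.sum_prod_type (α₁ := Msg N₂ τ)]
    refine sum_congr rfl fun m₂ _ => ?_
    rw [Fintype.sum_prod_type (α₁ := Priv N₁ τ × Priv N₂ τ)]
    refine sum_congr rfl fun u _ => ?_
    rw [sum_idealRunLaw_mul_wrongCount W Q₁ Q₂ B₁ B₂ h₁₂ h₂₁ τ (m₁, m₂) u ρ]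
    rw [Fintype.card_prod (Msg N₂ τ), Fintype.card_prod (Priv N₁ τ), Nat.cast_mul, Nat.cast_mul,
      mul_inv, mul_inv]
    ring
  simp only [h2, sum_const, card_univ, Fintype.card_fin, nsmul_eq_mul, Nat.cast_add, Nat.cast_one]

end Error

/-! ### Mean error probability of a random code -/

/-- Maximum likelihood decoder of a code `c`, with side information `x`. -/
def mlDec {I V X Y : Type*} [Finite I] [Nonempty I] (w : V → X → Y → ℝ) (c : I → V) (x : X)
    (y : Y) : I :=
  (Finite.exists_max fun i => w (c i) x y).choose

lemma le_mlDec {I V X Y : Type*} [Finite I] [Nonempty I] (w : V → X → Y → ℝ) (c : I → V) (x : X)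
    (y : Y) (i : I) : w (c i) x y ≤ w (c (mlDec w c x y)) x y :=
  (Finite.exists_max fun i => w (c i) x y).choose_spec i

open scoped Classical in
/-- Mean error probability of maximum likelihood decoding for random codes `c` (to be decoded) and
`c'` (own code), where `k` is the law of all letters, of which the decoder observes `obs`. -/
theorem sum_codes_mlError_le {I I' V V' X Y Ω : Type*} {n : ℕ} [Fintype I] [DecidableEq I]
    [Nonempty I] [Fintype I'] [DecidableEq I'] [Fintype V] [Fintype V'] [Fintype X] [Fintype Y]
    [Fintype Ω] {p : V → ℝ} {p' : V' → ℝ} {k : V → V' → Ω → ℝ} {obs : Ω → X × Y}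
    {qx : V' → X → ℝ} {w : V → X → Y → ℝ} (hp : ∀ v, 0 ≤ p v) (hp1 : ∑ v, p v = 1)
    (hp' : ∀ v, 0 ≤ p' v) (hp1' : ∑ v, p' v = 1) (hqx : ∀ v x, 0 ≤ qx v x)
    (hw : ∀ v x y, 0 ≤ w v x y)
    (hk : ∀ v v' x y, push obs (k v v') (x, y) = qx v' x * w v x y) {s : ℝ} (hs : 0 < s)
    (hs1 : s ≤ 1) (i : I) (i' : I') :
    ∑ c : I → Fin n → V, prodLaw (prodLaw p) c * ∑ c' : I' → Fin n → V', prodLaw (prodLaw p') c' *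
      ∑ ω : Fin n → Ω, (∏ t, k (c i t) (c' i' t) (ω t)) *
        (if mlDec (prodChan w) c (fun t => (obs (ω t)).1) (fun t => (obs (ω t)).2) ≠ i
          then 1 else 0) ≤
    (Fintype.card I : ℝ) ^ s * gallagerSum s p (fun x => ∑ v, p' v * qx v x) w ^ n := by
  set pX : X → ℝ := fun x => ∑ v, p' v * qx v x with hpX
  have hpX0 : ∀ x, 0 ≤ pX x := fun x => sum_nonneg fun v _ => mul_nonneg (hp' v) (hqx v x)
  set φ : (I → Fin n → V) → (Fin n → X) → (Fin n → Y) → ℝ := fun c x y =>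
    if mlDec (prodChan w) c x y ≠ i then 1 else 0 with hφ
  -- The own codeword enters only through the law of the own input `x`. Given `x`, the output
  -- depends on the transmitted codeword of `c` alone.
  have h1 : ∀ (c : I → Fin n → V) (c' : I' → Fin n → V'),
      ∑ ω : Fin n → Ω, (∏ t, k (c i t) (c' i' t) (ω t)) *
        φ c (fun t => (obs (ω t)).1) (fun t => (obs (ω t)).2) =
      ∑ x : Fin n → X, (∏ t, qx (c' i' t) (x t)) * ∑ y, prodChan w (c i) x y * φ c x y := by
    intro c c'
    rw [← sum_push_mul (fun (ω : Fin n → Ω) t => obs (ω t))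
      (fun ω => ∏ t, k (c i t) (c' i' t) (ω t)) (fun xy => φ c (fun t => (xy t).1) fun t => (xy t).2)]
    simp only [push_prod obs]
    rw [← (Equiv.arrowProdEquivProdArrow (Fin n) (fun _ => X) (fun _ => Y)).symm.sum_comp,
      Fintype.sum_prod_type]
    refine sum_congr rfl fun x _ => ?_
    rw [mul_sum]
    refine sum_congr rfl fun y _ => ?_
    rw [← mul_assoc]
    congr 1
    simp only [prodChan, ← prod_mul_distrib]
    exact prod_congr rfl fun t _ => hk _ _ _ _
  -- Averaging over the own random code makes the own inputs independent with law `pX`, and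
  -- independent of the code to be decoded.
  have h2 : ∀ x : Fin n → X, ∑ c' : I' → Fin n → V', prodLaw (prodLaw p') c' *
      ∏ t, qx (c' i' t) (x t) = prodLaw pX x := by
    intro x
    rw [sum_prodLaw_eval (sum_prodLaw hp1') i' fun v => ∏ t, qx (v t) (x t)]
    simp only [prodLaw, ← prod_mul_distrib]
    exact sum_prod_eq_prod_sum fun t v => p' v * qx v (x t)
  calc _ = ∑ x : Fin n → X, prodLaw pX x * ∑ c : I → Fin n → V, prodLaw (prodLaw p) c *
        ∑ y, prodChan w (c i) x y * φ c x y := by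
        have h3 : ∀ c : I → Fin n → V, ∑ c' : I' → Fin n → V', prodLaw (prodLaw p') c' *
            ∑ ω : Fin n → Ω, (∏ t, k (c i t) (c' i' t) (ω t)) *
              φ c (fun t => (obs (ω t)).1) (fun t => (obs (ω t)).2) =
            ∑ x : Fin n → X, prodLaw pX x * ∑ y, prodChan w (c i) x y * φ c x y := by
          intro c
          simp only [h1, ← h2]
          simp only [mul_sum, sum_mul]
          rw [sum_comm]
          exact sum_congr rfl fun x _ => sum_comm.trans (sum_congr rfl fun y _ =>
            sum_congr rfl fun c' _ => by ring)
        refine (sum_congr rfl fun c _ => congrArg _ (h3 c)).trans ?_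
        simp only [mul_sum (s := (univ : Finset (Fin n → X)))]
        rw [sum_comm]
        refine sum_congr rfl fun x _ => ?_
        rw [mul_sum]
        exact sum_congr rfl fun c _ => by ring
    _ ≤ ∑ x : Fin n → X, prodLaw pX x * ((Fintype.card I : ℝ) ^ s *
        ∑ y, (∑ v, prodLaw p v * prodChan w v x y ^ (1 / (1 + s))) ^ (1 + s)) := by
        refine sum_le_sum fun x _ => mul_le_mul_of_nonneg_left ?_ (prodLaw_nonneg hpX0 x)
        refine le_trans (le_of_eq ?_) (sum_prodLaw_mlError_le (prodLaw_nonneg hp) (sum_prodLaw hp1)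
          (w := fun v y => prodChan w v x y) (fun v y => prod_nonneg fun _ _ => hw _ _ _)
          (fun c y => mlDec (prodChan w) c x y) (fun c y j => le_mlDec _ c x y j) hs hs1 i)
        rfl
    _ = _ := by
        have h3 := gallagerSum_prod (I := Fin n) s pX hp hw
        rw [Fintype.card_fin] at h3
        rw [← h3, gallagerSum, mul_sum]
        exact sum_congr rfl fun x _ => by ring

section Error

variable {V₁ V₂ X₁ X₂ Y₁ Y₂ Z : Type*}
  [Fintype V₁] [Fintype V₂] [Fintype X₁] [Fintype X₂] [Fintype Y₁] [Fintype Y₂] [Fintype Z]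
  (W : X₁ → X₂ → stdSimplex ℝ (Y₁ × Y₂ × Z)) (Q₁ : InputLaw V₁ X₁) (Q₂ : InputLaw V₂ X₂)
  {N₁ N₂ : Sizes} {n : ℕ}

/-- Channel from the letter of the first user to the second user, given the own input. -/
def chanTo₂ (v₁ : V₁) (x₂ : X₂) (y₂ : Y₂) : ℝ :=
  ∑ x₁, ∑ y₁, ∑ z, Q₁.chan v₁ x₁ * W x₁ x₂ (y₁, y₂, z)

/-- Channel from the letter of the second user to the first user, given the own input. -/
def chanTo₁ (v₂ : V₂) (x₁ : X₁) (y₁ : Y₁) : ℝ :=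
  ∑ x₂, ∑ y₂, ∑ z, Q₂.chan v₂ x₂ * W x₁ x₂ (y₁, y₂, z)

omit [Fintype X₂] in
lemma chanTo₂_nonneg (v₁ : V₁) (x₂ : X₂) (y₂ : Y₂) : 0 ≤ chanTo₂ W Q₁ v₁ x₂ y₂ :=
  sum_nonneg fun _ _ => sum_nonneg fun _ _ => sum_nonneg fun _ _ =>
    mul_nonneg (simplex_nonneg _ _) (simplex_nonneg _ _)

omit [Fintype X₁] in
lemma chanTo₁_nonneg (v₂ : V₂) (x₁ : X₁) (y₁ : Y₁) : 0 ≤ chanTo₁ W Q₂ v₂ x₁ y₁ :=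
  sum_nonneg fun _ _ => sum_nonneg fun _ _ => sum_nonneg fun _ _ =>
    mul_nonneg (simplex_nonneg _ _) (simplex_nonneg _ _)

lemma sum_triple {A B C : Type*} [Fintype A] [Fintype B] [Fintype C]
    (p : stdSimplex ℝ (A × B × C)) : ∑ a, ∑ b, ∑ c, p (a, b, c) = 1 := by
  rw [← sum_simplex p, Fintype.sum_prod_type]
  exact sum_congr rfl fun a _ => (Fintype.sum_prod_type fun y => p (a, y)).symm

omit [Fintype X₂] in
lemma sum_chanTo₂ (v₁ : V₁) (x₂ : X₂) : ∑ y₂, chanTo₂ W Q₁ v₁ x₂ y₂ = 1 := by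
  unfold chanTo₂
  rw [sum_comm, ← sum_simplex (Q₁.chan v₁)]
  refine sum_congr rfl fun x₁ _ => ?_
  rw [sum_comm]
  simp only [← mul_sum, sum_triple, mul_one]

omit [Fintype X₁] in
lemma sum_chanTo₁ (v₂ : V₂) (x₁ : X₁) : ∑ y₁, chanTo₁ W Q₂ v₂ x₁ y₁ = 1 := by
  unfold chanTo₁
  rw [sum_comm, ← sum_simplex (Q₂.chan v₂)]
  refine sum_congr rfl fun x₂ _ => ?_
  simp only [← mul_sum, sum_triple, mul_one]

lemma push_letterLaw₂ (v₁ : V₁) (v₂ : V₂) (x₂ : X₂) (y₂ : Y₂) :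
    push (fun a : (X₁ × X₂) × (Y₁ × Y₂ × Z) => (a.1.2, a.2.2.1)) (letterLaw W Q₁ Q₂ v₁ v₂) (x₂, y₂) =
      Q₂.chan v₂ x₂ * chanTo₂ W Q₁ v₁ x₂ y₂ := by
  classical
  rw [push_eq_sum_ite]
  simp only [Fintype.sum_prod_type, letterLaw, chanTo₂, Prod.mk.injEq, ite_and, mul_sum]
  refine sum_congr rfl fun x₁ _ => ?_
  rw [Fintype.sum_eq_single x₂ (fun x h => by simp [h])]
  simp only [if_true]
  refine sum_congr rfl fun y₁ _ => ?_
  rw [Fintype.sum_eq_single y₂ (fun x h => by simp [h])]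
  simp only [if_true]
  exact sum_congr rfl fun z _ => by ring

lemma push_letterLaw₁ (v₁ : V₁) (v₂ : V₂) (x₁ : X₁) (y₁ : Y₁) :
    push (fun a : (X₁ × X₂) × (Y₁ × Y₂ × Z) => (a.1.1, a.2.1)) (letterLaw W Q₁ Q₂ v₁ v₂) (x₁, y₁) =
      Q₁.chan v₁ x₁ * chanTo₁ W Q₂ v₂ x₁ y₁ := by
  classical
  rw [push_eq_sum_ite]
  simp only [Fintype.sum_prod_type, letterLaw, chanTo₁, Prod.mk.injEq, ite_and, mul_sum]
  rw [Fintype.sum_eq_single x₁ (fun x h => by simp [h])]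
  simp only [if_true]
  refine sum_congr rfl fun x₂ _ => ?_
  rw [Fintype.sum_eq_single y₁ (fun x h => by simp [h])]
  simp only [if_true]
  exact sum_congr rfl fun y₂ _ => sum_congr rfl fun z _ => by ring

/-- The first user of a code with maximum likelihood decoding. -/
def mlUser₁ (c₁ : Index N₁ → Fin n → V₁) (c₂ : Index N₂ → Fin n → V₂) :
    BlockUser V₁ X₁ Y₁ N₁ N₂ n where
  word := c₁
  dec := mlDec (prodChan (chanTo₁ W Q₂)) c₂

/-- The second user of a code with maximum likelihood decoding. -/
def mlUser₂ (c₁ : Index N₁ → Fin n → V₁) (c₂ : Index N₂ → Fin n → V₂) :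
    BlockUser V₂ X₂ Y₂ N₂ N₁ n where
  word := c₂
  dec := mlDec (prodChan (chanTo₂ W Q₁)) c₁

/-- Law of a user's channel input. -/
def inputLaw (Q : InputLaw V₁ X₁) (x : X₁) : ℝ := ∑ v, Q.law v * Q.chan v x

lemma sum_inputLaw : ∑ x, inputLaw Q₁ x = 1 := by
  unfold inputLaw
  rw [sum_comm]
  simp only [← mul_sum, sum_simplex, mul_one]

theorem sum_codes_blockError_le {s : ℝ} (hs : 0 < s) (hs1 : s ≤ 1) :
    ∑ c₁ : Index N₁ → Fin n → V₁, prodLaw (prodLaw Q₁.law) c₁ *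
      ∑ c₂ : Index N₂ → Fin n → V₂, prodLaw (prodLaw Q₂.law) c₂ *
        blockError W Q₁ Q₂ (mlUser₁ W Q₂ c₁ c₂) (mlUser₂ W Q₁ c₁ c₂) ≤
    (Fintype.card (Index N₁) : ℝ) ^ s *
        gallagerSum s Q₁.law (inputLaw Q₂) (chanTo₂ W Q₁) ^ n +
      (Fintype.card (Index N₂) : ℝ) ^ s *
        gallagerSum s Q₂.law (inputLaw Q₁) (chanTo₁ W Q₂) ^ n := by
  classical
  have h2 := fun i₁ i₂ => sum_codes_mlError_le (I := Index N₁) (I' := Index N₂) (n := n)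
    (simplex_nonneg Q₁.law) (sum_simplex Q₁.law) (simplex_nonneg Q₂.law) (sum_simplex Q₂.law)
    (fun v x => simplex_nonneg (Q₂.chan v) x) (chanTo₂_nonneg W Q₁) (push_letterLaw₂ W Q₁ Q₂)
    hs hs1 i₁ i₂
  have h1 := fun i₂ i₁ => sum_codes_mlError_le (I := Index N₂) (I' := Index N₁) (n := n)
    (k := fun v₂ v₁ => letterLaw W Q₁ Q₂ v₁ v₂)
    (simplex_nonneg Q₂.law) (sum_simplex Q₂.law) (simplex_nonneg Q₁.law) (sum_simplex Q₁.law)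
    (fun v x => simplex_nonneg (Q₁.chan v) x) (chanTo₁_nonneg W Q₂)
    (fun v₂ v₁ => push_letterLaw₁ W Q₁ Q₂ v₁ v₂) hs hs1 i₂ i₁
  unfold blockError
  rw [sum_mul_sum_mul_expect]
  refine (expect_le_expect fun i₁ _ => expect_le_expect fun i₂ _ => ?_).trans
    (le_of_eq ((expect_congr rfl fun _ _ => Fintype.expect_const _).trans
      (Fintype.expect_const _)))
  refine le_trans (le_of_eq ?_) (add_le_add (h2 i₁ i₂) (h1 i₂ i₁))
  unfold indexError wrongCount
  simp only [mul_add, sum_add_distrib]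
  congr 1
  simp only [mul_sum (s := (univ : Finset (Index N₂ → Fin n → V₂))),
    mul_sum (s := (univ : Finset (Index N₁ → Fin n → V₁)))]
  rw [sum_comm]
  exact sum_congr rfl fun _ _ => sum_congr rfl fun _ _ => mul_left_comm _ _ _

end Error

/-! ### Error and leakage terms of a single letter -/

section Terms

variable {V₁ V₂ X₁ X₂ Y₁ Y₂ Z : Type*}
  [Fintype V₁] [Fintype V₂] [Fintype X₁] [Fintype X₂] [Fintype Y₁] [Fintype Y₂] [Fintype Z]
  (W : X₁ → X₂ → stdSimplex ℝ (Y₁ × Y₂ × Z)) (Q₁ : InputLaw V₁ X₁) (Q₂ : InputLaw V₂ X₂)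

lemma eveChan_nonneg (v₁ : V₁) (v₂ : V₂) (z : Z) : 0 ≤ eveChan W Q₁ Q₂ v₁ v₂ z := by
  rw [← push_letterLaw_eve]
  exact push_nonneg _ (letterLaw_nonneg W Q₁ Q₂ v₁ v₂) z

lemma sum_eveChan (v₁ : V₁) (v₂ : V₂) : ∑ z, eveChan W Q₁ Q₂ v₁ v₂ z = 1 := by
  simp only [← push_letterLaw_eve, sum_push, sum_letterLaw]

lemma push_singleLaw_user₂ (y₂ : Y₂) (v₁ : V₁) (x₂ : X₂) :
    push (fun ⟨v₁, _, _, x₂, _, y₂, _⟩ => (y₂, v₁, x₂)) (singleLaw W Q₁ Q₂) (y₂, v₁, x₂) =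
      Q₁.law v₁ * inputLaw Q₂ x₂ * chanTo₂ W Q₁ v₁ x₂ y₂ := by
  classical
  simp only [push_eq_sum_ite, Fintype.sum_prod_type, Prod.mk.injEq, singleLaw, inputLaw, chanTo₂]
  rw [Fintype.sum_eq_single v₁ (fun v h => by simp [h])]
  rw [mul_sum (a := Q₁.law v₁), sum_mul]
  refine sum_congr rfl fun v₂ _ => ?_
  rw [mul_sum]
  refine sum_congr rfl fun x₁ _ => ?_
  rw [Fintype.sum_eq_single x₂ (fun x h => by simp [h]), mul_sum]
  refine sum_congr rfl fun y₁ _ => ?_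
  rw [Fintype.sum_eq_single y₂ (fun x h => by simp [h]), mul_sum]
  exact sum_congr rfl fun z _ => by simp only [and_self, if_true]; ring

lemma push_singleLaw_user₁ (y₁ : Y₁) (v₂ : V₂) (x₁ : X₁) :
    push (fun ⟨_, v₂, x₁, _, y₁, _, _⟩ => (y₁, v₂, x₁)) (singleLaw W Q₁ Q₂) (y₁, v₂, x₁) =
      Q₂.law v₂ * inputLaw Q₁ x₁ * chanTo₁ W Q₂ v₂ x₁ y₁ := by
  classical
  simp only [push_eq_sum_ite, Fintype.sum_prod_type, Prod.mk.injEq, singleLaw, inputLaw, chanTo₁]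
  rw [mul_sum (a := Q₂.law v₂), sum_mul]
  refine sum_congr rfl fun v₁ _ => ?_
  rw [Fintype.sum_eq_single v₂ (fun v h => by simp [h])]
  rw [Fintype.sum_eq_single x₁ (fun x h => by simp [h]), mul_sum]
  refine sum_congr rfl fun x₂ _ => ?_
  rw [Fintype.sum_eq_single y₁ (fun x h => by simp [h]), mul_sum]
  refine sum_congr rfl fun y₂ _ => ?_
  rw [mul_sum]
  exact sum_congr rfl fun z _ => by simp only [and_self, if_true]; ring

lemma push_singleLaw_eve₁ (z : Z) (v₁ : V₁) :
    push (fun ⟨v₁, _, _, _, _, _, z⟩ => (z, v₁)) (singleLaw W Q₁ Q₂) (z, v₁) =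
      Q₁.law v₁ * chanFst Q₂.law (eveChan W Q₁ Q₂) v₁ z := by
  classical
  simp only [push_eq_sum_ite, Fintype.sum_prod_type, Prod.mk.injEq, singleLaw, chanFst, eveChan,
    mul_sum]
  rw [Fintype.sum_eq_single v₁ (fun v h => by simp [h])]
  refine sum_congr rfl fun v₂ _ => sum_congr rfl fun x₁ _ => sum_congr rfl fun x₂ _ =>
    sum_congr rfl fun y₁ _ => sum_congr rfl fun y₂ _ => ?_
  rw [Fintype.sum_eq_single z (fun x h => by simp [h])]
  simp only [and_self, if_true]
  ring

lemma push_singleLaw_eve₂ (z : Z) (v₂ : V₂) :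
    push (fun ⟨_, v₂, _, _, _, _, z⟩ => (z, v₂)) (singleLaw W Q₁ Q₂) (z, v₂) =
      Q₂.law v₂ * chanSnd Q₁.law (eveChan W Q₁ Q₂) v₂ z := by
  classical
  simp only [push_eq_sum_ite, Fintype.sum_prod_type, Prod.mk.injEq, singleLaw, chanSnd, eveChan,
    mul_sum]
  refine sum_congr rfl fun v₁ _ => ?_
  rw [Fintype.sum_eq_single v₂ (fun v h => by simp [h])]
  refine sum_congr rfl fun x₁ _ => sum_congr rfl fun x₂ _ =>
    sum_congr rfl fun y₁ _ => sum_congr rfl fun y₂ _ => ?_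
  rw [Fintype.sum_eq_single z (fun x h => by simp [h])]
  simp only [and_self, if_true]
  ring

lemma push_singleLaw_eve (z : Z) (v : V₁ × V₂) :
    push (fun ⟨v₁, v₂, _, _, _, _, z⟩ => (z, (v₁, v₂))) (singleLaw W Q₁ Q₂) (z, v) =
      Q₁.law v.1 * Q₂.law v.2 * eveChan W Q₁ Q₂ v.1 v.2 z := by
  classical
  obtain ⟨v₁, v₂⟩ := v
  simp only [push_eq_sum_ite, Fintype.sum_prod_type, Prod.mk.injEq, singleLaw, eveChan,
    mul_sum]
  rw [Fintype.sum_eq_single v₁ (fun v h => by simp [h])]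
  rw [Fintype.sum_eq_single v₂ (fun v h => by simp [h])]
  refine sum_congr rfl fun x₁ _ => sum_congr rfl fun x₂ _ =>
    sum_congr rfl fun y₁ _ => sum_congr rfl fun y₂ _ => ?_
  rw [Fintype.sum_eq_single z (fun x h => by simp [h])]
  simp only [and_self, if_true]
  ring

lemma inputLaw_nonneg (x : X₁) : 0 ≤ inputLaw Q₁ x :=
  sum_nonneg fun _ _ => mul_nonneg (simplex_nonneg _ _) (simplex_nonneg _ _)

lemma gallagerSum_nonneg {A B C : Type*} [Fintype A] [Fintype B] [Fintype C] (s : ℝ) {pB : B → ℝ}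
    {pC : C → ℝ} {w : B → C → A → ℝ} (hpB : ∀ b, 0 ≤ pB b) (hpC : ∀ c, 0 ≤ pC c)
    (hw : ∀ b c a, 0 ≤ w b c a) : 0 ≤ gallagerSum s pB pC w :=
  sum_nonneg fun c _ => mul_nonneg (hpC c) <| sum_nonneg fun _ _ => Real.rpow_nonneg
    (sum_nonneg fun b _ => mul_nonneg (hpB b) (Real.rpow_nonneg (hw _ _ _) _)) _

lemma rpow_mul_pow_le_exp {s M R I g : ℝ} (hs : 0 < s) {n : ℕ} (hM : 0 ≤ M)
    (h : M ≤ Real.exp (n * R)) (hg : 0 ≤ g) (hI : g ≤ Real.exp (-s * I)) :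
    M ^ s * g ^ n ≤ Real.exp (n * s * (R - I)) := by
  calc M ^ s * g ^ n ≤ Real.exp (n * R) ^ s * Real.exp (-s * I) ^ n := by gcongr
    _ = Real.exp (n * s * (R - I)) := by
        rw [← Real.exp_mul, ← Real.exp_nat_mul, ← Real.exp_add]
        ring_nf

theorem gallagerSum_add_le_errTerm {N₁ N₂ : Sizes} {n : ℕ} {R₁ R₂ : Rates} {s : ℝ} (hs : 0 < s)
    (h₁ : (Fintype.card (Index N₁) : ℝ) ≤ Real.exp (n * (R₁.main + R₁.aux)))
    (h₂ : (Fintype.card (Index N₂) : ℝ) ≤ Real.exp (n * (R₂.main + R₂.aux))) :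
    (Fintype.card (Index N₁) : ℝ) ^ s *
        gallagerSum s Q₁.law (inputLaw Q₂) (chanTo₂ W Q₁) ^ n +
      (Fintype.card (Index N₂) : ℝ) ^ s *
        gallagerSum s Q₂.law (inputLaw Q₁) (chanTo₁ W Q₂) ^ n ≤ errTerm W Q₁ Q₂ n R₁ R₂ s :=
  add_le_add
    (rpow_mul_pow_le_exp hs (Nat.cast_nonneg _) h₁
      (gallagerSum_nonneg s (simplex_nonneg _) (inputLaw_nonneg Q₂) (chanTo₂_nonneg W Q₁))
      (gallagerSum_le_exp hs (simplex_nonneg _) (sum_simplex _) (inputLaw_nonneg Q₂)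
        (sum_inputLaw Q₂) (chanTo₂_nonneg W Q₁) (sum_chanTo₂ W Q₁) (push_singleLaw_user₂ W Q₁ Q₂)))
    (rpow_mul_pow_le_exp hs (Nat.cast_nonneg _) h₂
      (gallagerSum_nonneg s (simplex_nonneg _) (inputLaw_nonneg Q₁) (chanTo₁_nonneg W Q₂))
      (gallagerSum_le_exp hs (simplex_nonneg _) (sum_simplex _) (inputLaw_nonneg Q₁)
        (sum_inputLaw Q₁) (chanTo₁_nonneg W Q₂) (sum_chanTo₁ W Q₂) (push_singleLaw_user₁ W Q₁ Q₂)))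

lemma infoSum_nonneg {V : Type*} [Fintype V] (s : ℝ) {p : V → ℝ} {w : V → Z → ℝ} {q : Z → ℝ}
    (hp : ∀ v, 0 ≤ p v) (hw : ∀ v z, 0 ≤ w v z) (hq : ∀ z, 0 ≤ q z) : 0 ≤ infoSum s p w q :=
  sum_nonneg fun v _ => mul_nonneg (hp v) <| sum_nonneg fun z _ =>
    mul_nonneg (hw v z) (Real.rpow_nonneg (div_nonneg (hw v z) (hq z)) _)

/-- The terms decrease in the amount of randomization, so lower bounds on `b₁` and `b₂` are enough.
This is the form needed for rounded sizes. -/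
theorem resolvTerm_le_leakTerm {n : ℕ} {a₁ a₂ b₁ b₂ s : ℝ} (hs : 0 < s)
    (h₁ : Real.exp (n * a₁) ≤ b₁) (h₂ : Real.exp (n * a₂) ≤ b₂) :
    resolvTerm s (prodLaw (I := Fin n) Q₁.law) (prodLaw Q₂.law) (prodChan (eveChan W Q₁ Q₂)) b₁ b₂ ≤
      leakTerm W Q₁ Q₂ n a₁ a₂ s := by
  have hp₁ := simplex_nonneg Q₁.law
  have hp₂ := simplex_nonneg Q₂.law
  have hw := eveChan_nonneg W Q₁ Q₂
  have hw1 := sum_eveChan W Q₁ Q₂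
  have hq := outLaw_nonneg hp₁ hp₂ hw
  have hp1 : ∑ v : V₁ × V₂, Q₁.law v.1 * Q₂.law v.2 = 1 := by
    rw [Fintype.sum_prod_type]
    simp only [← mul_sum, sum_simplex, mul_one]
  have hp : ∀ v : V₁ × V₂, 0 ≤ Q₁.law v.1 * Q₂.law v.2 := fun v => mul_nonneg (hp₁ _) (hp₂ _)
  have hf1 : ∀ v, ∑ z, chanFst Q₂.law (eveChan W Q₁ Q₂) v z = 1 := by
    intro v
    unfold chanFst
    rw [sum_comm]
    simp only [← mul_sum, hw1, mul_one, sum_simplex]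
  have hs1 : ∀ v, ∑ z, chanSnd Q₁.law (eveChan W Q₁ Q₂) v z = 1 := by
    intro v
    unfold chanSnd
    rw [sum_comm]
    simp only [← mul_sum, hw1, mul_one, sum_simplex]
  have e0 : Real.exp (n * (a₁ + a₂)) ≤ b₁ * b₂ := by
    rw [mul_add, Real.exp_add]
    exact mul_le_mul h₁ h₂ (Real.exp_nonneg _) ((Real.exp_nonneg _).trans h₁)
  rw [resolvTerm_prod s hp₁ hp₂ hw, Fintype.card_fin]
  have e1 := exp_renyiInfoUp (p := Q₁.law) (w := chanFst Q₂.law (eveChan W Q₁ Q₂))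
    (q := outLaw Q₁.law Q₂.law (eveChan W Q₁ Q₂)) hs hp₁ (sum_simplex _) (chanFst_nonneg hp₂ hw)
    hf1 (fun z => by rw [outLaw]) (push_singleLaw_eve₁ W Q₁ Q₂) n a₁
  have e2 := exp_renyiInfoUp (p := Q₂.law) (w := chanSnd Q₁.law (eveChan W Q₁ Q₂))
    (q := outLaw Q₁.law Q₂.law (eveChan W Q₁ Q₂)) hs hp₂ (sum_simplex _) (chanSnd_nonneg hp₁ hw)
    hs1 (fun z => outLaw_eq_sum_chanSnd z) (push_singleLaw_eve₂ W Q₁ Q₂) n a₂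
  have e3 := exp_renyiInfoUp (p := fun v : V₁ × V₂ => Q₁.law v.1 * Q₂.law v.2)
    (w := fun v => eveChan W Q₁ Q₂ v.1 v.2) (q := outLaw Q₁.law Q₂.law (eveChan W Q₁ Q₂)) hs hp hp1
    (fun v => hw v.1 v.2) (fun v => hw1 v.1 v.2)
    (fun z => by simp only [outLaw, chanFst, mul_sum, Fintype.sum_prod_type, mul_assoc])
    (push_singleLaw_eve W Q₁ Q₂) n (a₁ + a₂)
  unfold leakTerm
  rw [e1, e2, e3]
  have k : ∀ {F e b : ℝ}, 0 ≤ F → 0 < e → e ≤ b → F ^ n / b ^ s ≤ F ^ n / e ^ s := by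
    intro F e b hF he hb
    gcongr
  exact add_le_add (add_le_add
    (k (infoSum_nonneg s hp₁ (chanFst_nonneg hp₂ hw) hq) (Real.exp_pos _) h₁)
    (k (infoSum_nonneg s hp₂ (chanSnd_nonneg hp₁ hw) hq) (Real.exp_pos _) h₂))
    (k (infoSum_nonneg s hp (fun v z => hw _ _ _) hq) (Real.exp_pos _) e0)

end Terms

/-! ### Mean leakage of a random code -/

section Leakage

variable {V₁ V₂ X₁ X₂ Y₁ Y₂ Z : Type*}
  [Fintype V₁] [Fintype V₂] [Fintype X₁] [Fintype X₂] [Fintype Y₁] [Fintype Y₂] [Fintype Z]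
  (W : X₁ → X₂ → stdSimplex ℝ (Y₁ × Y₂ × Z)) (Q₁ : InputLaw V₁ X₁) (Q₂ : InputLaw V₂ X₂)
  {N₁ N₂ : Sizes} {n : ℕ}

/-- Channel from the indices of a non-adaptive code to the eavesdropper. -/
def eveBlock (c₁ : Index N₁ → Fin n → V₁) (c₂ : Index N₂ → Fin n → V₂) (i₁ : Index N₁)
    (i₂ : Index N₂) : (Fin n → Z) → ℝ :=
  prodChan (eveChan W Q₁ Q₂) (c₁ i₁) (c₂ i₂)

variable (n) in
/-- Law of the eavesdropper's block of observations for random codewords. -/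
def eveOut : (Fin n → Z) → ℝ :=
  outLaw (prodLaw Q₁.law) (prodLaw Q₂.law) (prodChan (eveChan W Q₁ Q₂))

lemma prodChan_eveChan_nonneg (v₁ : Fin n → V₁) (v₂ : Fin n → V₂) (z : Fin n → Z) :
    0 ≤ prodChan (eveChan W Q₁ Q₂) v₁ v₂ z :=
  prod_nonneg fun _ _ => eveChan_nonneg W Q₁ Q₂ _ _ _

lemma sum_prodChan_eveChan (v₁ : Fin n → V₁) (v₂ : Fin n → V₂) :
    ∑ z, prodChan (eveChan W Q₁ Q₂) v₁ v₂ z = 1 := by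
  unfold prodChan
  rw [sum_prod_eq_prod_sum fun i z => eveChan W Q₁ Q₂ (v₁ i) (v₂ i) z]
  simp only [sum_eveChan, prod_const_one]

lemma eveOut_nonneg (z : Fin n → Z) : 0 ≤ eveOut W Q₁ Q₂ n z :=
  outLaw_nonneg (prodLaw_nonneg (simplex_nonneg _)) (prodLaw_nonneg (simplex_nonneg _))
    (prodChan_eveChan_nonneg W Q₁ Q₂) z

lemma sum_eveOut : ∑ z, eveOut W Q₁ Q₂ n z = 1 :=
  sum_outLaw (sum_prodLaw (sum_simplex _)) (sum_prodLaw (sum_simplex _))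
    (sum_prodChan_eveChan W Q₁ Q₂)

lemma eveOut_pos {c₁ : Index N₁ → Fin n → V₁} {c₂ : Index N₂ → Fin n → V₂}
    (h₁ : 0 < prodLaw (prodLaw Q₁.law) c₁) (h₂ : 0 < prodLaw (prodLaw Q₂.law) c₂) (i₁ : Index N₁)
    (i₂ : Index N₂) (z : Fin n → Z) (h : 0 < eveBlock W Q₁ Q₂ c₁ c₂ i₁ i₂ z) :
    0 < eveOut W Q₁ Q₂ n z :=
  have h0 := prodLaw_nonneg (I := Fin n) (simplex_nonneg Q₁.law)
  have h0' := prodLaw_nonneg (I := Fin n) (simplex_nonneg Q₂.law)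
  outLaw_pos h0 h0' (prodChan_eveChan_nonneg W Q₁ Q₂) (pos_of_prodLaw_pos h0 h₁ i₁)
    (pos_of_prodLaw_pos h0' h₂ i₂) h

/-- Mean over random codes of the relative entropy between the output for `B₁` and `B₂` uniformly
chosen codewords and its mean. -/
lemma sum_codes_kl_le {B₁ B₂ : Type*} [Fintype B₁] [Fintype B₂] [Nonempty B₁] [Nonempty B₂]
    {β₁ : B₁ → Index N₁} {β₂ : B₂ → Index N₂} (hβ₁ : Function.Injective β₁)
    (hβ₂ : Function.Injective β₂) {a₁ a₂ : ℝ} (h₁ : Real.exp (n * a₁) ≤ Fintype.card B₁)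
    (h₂ : Real.exp (n * a₂) ≤ Fintype.card B₂) {s : ℝ} (hs : 0 < s) (hs1 : s ≤ 1) :
    ∑ c₁ : Index N₁ → Fin n → V₁, prodLaw (prodLaw Q₁.law) c₁ *
      ∑ c₂ : Index N₂ → Fin n → V₂, prodLaw (prodLaw Q₂.law) c₂ *
        kl (fun z => 𝔼 b₁, 𝔼 b₂, eveBlock W Q₁ Q₂ c₁ c₂ (β₁ b₁) (β₂ b₂) z) (eveOut W Q₁ Q₂ n) ≤
      1 / s * leakTerm W Q₁ Q₂ n a₁ a₂ s :=
  (sum_prodLaw_kl_le (prodLaw_nonneg (simplex_nonneg _)) (sum_prodLaw (sum_simplex _))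
    (prodLaw_nonneg (simplex_nonneg _)) (sum_prodLaw (sum_simplex _))
    (prodChan_eveChan_nonneg W Q₁ Q₂) hβ₁ hβ₂ hs hs1).trans
    (mul_le_mul_of_nonneg_left (resolvTerm_le_leakTerm W Q₁ Q₂ hs h₁ h₂) (by positivity))

lemma sum_codes_expect_le {A B : Type*} [Fintype A] [Fintype B] [Nonempty A] [Nonempty B]
    {C₁ C₂ : Type*} [Fintype C₁] [Fintype C₂] (p₁ : C₁ → ℝ) (p₂ : C₂ → ℝ)
    (F : C₁ → C₂ → A → B → ℝ) {b : ℝ}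
    (h : ∀ x y, ∑ c₁, p₁ c₁ * ∑ c₂, p₂ c₂ * F c₁ c₂ x y ≤ b) :
    ∑ c₁, p₁ c₁ * ∑ c₂, p₂ c₂ * (𝔼 x, 𝔼 y, F c₁ c₂ x y) ≤ b := by
  rw [sum_mul_sum_mul_expect]
  exact (expect_le_expect fun x _ => expect_le_expect fun y _ => h x y).trans
    (le_of_eq ((expect_congr rfl fun _ _ => Fintype.expect_const _).trans
      (Fintype.expect_const _)))

omit [Fintype Z] in
lemma expect_roundBoth (v : Index N₁ → Index N₂ → Z → ℝ) (s : Fin N₁.s × Fin N₂.s)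
    (k : ZMod N₁.k × ZMod N₂.k) (z : Z) :
    𝔼 e, roundBoth v s k e z = 𝔼 b₁ : ZMod N₁.e × Fin N₁.o, 𝔼 b₂ : ZMod N₂.e × Fin N₂.o,
      v (s.1, k.1, b₁) (s.2, k.2, b₂) z := by
  simp only [roundBoth, expect_prod_type]
  exact expect_congr rfl fun e₁ _ => expect_comm' _

omit [Fintype Z] in
lemma expect_roundFst (v : Index N₁ → Index N₂ → Z → ℝ) (s : Fin N₁.s)
    (k : ZMod N₁.k × ZMod N₂.k) (z : Z) :
    𝔼 e, roundFst v s k e z = 𝔼 b₁ : ZMod N₁.e × Fin N₁.o,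
      𝔼 b₂ : Fin N₂.s × ZMod N₂.e × Fin N₂.o, v (s, k.1, b₁) (b₂.1, k.2, b₂.2) z := by
  simp only [roundFst, expect_prod_type]

/-- Fixing the main parts leaves, for each user, a subcode indexed injectively by the auxiliary
part; its codewords are independent, and the resolvability bound applies. -/
theorem sum_codes_roundKlBoth_le {a₁ a₂ : ℝ}
    (h₁ : Real.exp (n * a₁) ≤ (N₁.e : ℕ) * (N₁.o : ℕ))
    (h₂ : Real.exp (n * a₂) ≤ (N₂.e : ℕ) * (N₂.o : ℕ)) {s : ℝ} (hs : 0 < s) (hs1 : s ≤ 1) :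
    ∑ c₁ : Index N₁ → Fin n → V₁, prodLaw (prodLaw Q₁.law) c₁ *
      ∑ c₂ : Index N₂ → Fin n → V₂, prodLaw (prodLaw Q₂.law) c₂ *
        roundKlBoth (eveBlock W Q₁ Q₂ c₁ c₂) (eveOut W Q₁ Q₂ n) ≤
      1 / s * leakTerm W Q₁ Q₂ n a₁ a₂ s := by
  simp only [roundKlBoth, expect_roundBoth]
  refine sum_codes_expect_le _ _ _ fun x k => ?_
  exact sum_codes_kl_le W Q₁ Q₂ (β₁ := fun b : ZMod N₁.e × Fin N₁.o => (x.1, k.1, b))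
    (β₂ := fun b : ZMod N₂.e × Fin N₂.o => (x.2, k.2, b))
    (fun _ _ h => by simpa using h) (fun _ _ h => by simpa using h)
    (by simpa [ZMod.card] using h₁) (by simpa [ZMod.card] using h₂) hs hs1

/-- For the second user only the key is fixed, so the secret part joins the randomization. -/
theorem sum_codes_roundKlFst_le {a₁ a₂ : ℝ}
    (h₁ : Real.exp (n * a₁) ≤ (N₁.e : ℕ) * (N₁.o : ℕ))
    (h₂ : Real.exp (n * a₂) ≤ (N₂.s : ℕ) * ((N₂.e : ℕ) * (N₂.o : ℕ))) {s : ℝ} (hs : 0 < s)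
    (hs1 : s ≤ 1) :
    ∑ c₁ : Index N₁ → Fin n → V₁, prodLaw (prodLaw Q₁.law) c₁ *
      ∑ c₂ : Index N₂ → Fin n → V₂, prodLaw (prodLaw Q₂.law) c₂ *
        roundKlFst (eveBlock W Q₁ Q₂ c₁ c₂) (eveOut W Q₁ Q₂ n) ≤
      1 / s * leakTerm W Q₁ Q₂ n a₁ a₂ s := by
  simp only [roundKlFst, expect_roundFst]
  refine sum_codes_expect_le _ _ _ fun x k => ?_
  exact sum_codes_kl_le W Q₁ Q₂ (β₁ := fun b : ZMod N₁.e × Fin N₁.o => (x, k.1, b))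
    (β₂ := fun b : Fin N₂.s × ZMod N₂.e × Fin N₂.o => (b.1, k.2, b.2))
    (fun _ _ h => by simpa using h) (fun _ _ h => by simpa [Prod.ext_iff] using h)
    (by simpa [ZMod.card] using h₁) (by simpa [ZMod.card] using h₂) hs hs1

theorem sum_codes_roundKlSnd_le {a₁ a₂ : ℝ}
    (h₁ : Real.exp (n * a₁) ≤ (N₁.s : ℕ) * ((N₁.e : ℕ) * (N₁.o : ℕ)))
    (h₂ : Real.exp (n * a₂) ≤ (N₂.e : ℕ) * (N₂.o : ℕ)) {s : ℝ} (hs : 0 < s) (hs1 : s ≤ 1) :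
    ∑ c₁ : Index N₁ → Fin n → V₁, prodLaw (prodLaw Q₁.law) c₁ *
      ∑ c₂ : Index N₂ → Fin n → V₂, prodLaw (prodLaw Q₂.law) c₂ *
        roundKlFst (fun i₂ i₁ => eveBlock W Q₁ Q₂ c₁ c₂ i₁ i₂) (eveOut W Q₁ Q₂ n) ≤
      1 / s * leakTerm W Q₁ Q₂ n a₁ a₂ s := by
  simp only [roundKlFst, expect_roundFst]
  refine sum_codes_expect_le _ _ _ fun x k => ?_
  -- With the users swapped in `roundKlFst`, the two means appear in the opposite order from the
  -- resolvability bound.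
  simp only [fun c₁ c₂ z => expect_comm' fun (b₂ : ZMod N₂.e × Fin N₂.o)
    (b₁ : Fin N₁.s × ZMod N₁.e × Fin N₁.o) =>
      eveBlock W Q₁ Q₂ (n := n) c₁ c₂ (b₁.1, k.2, b₁.2) (x, k.1, b₂) z]
  exact sum_codes_kl_le W Q₁ Q₂ (β₁ := fun b : Fin N₁.s × ZMod N₁.e × Fin N₁.o => (b.1, k.2, b.2))
    (β₂ := fun b : ZMod N₂.e × Fin N₂.o => (x, k.1, b))
    (fun _ _ h => by simpa [Prod.ext_iff] using h) (fun _ _ h => by simpa using h)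
    (by simpa [ZMod.card] using h₁) (by simpa [ZMod.card] using h₂) hs hs1

/-! ### Bounds for a given code -/

lemma mutualInfo_comp_equiv {M A B : Type*} [Fintype M] [Fintype A] [Fintype B] (e : A ≃ B)
    (p : M × B → ℝ) : mutualInfo (fun a : M × A => p (a.1, e a.2)) = mutualInfo p := by
  simp only [mutualInfo, Fintype.sum_prod_type, push_fst, push_snd]
  refine sum_congr rfl fun m _ => ?_
  rw [← e.sum_comp]
  exact sum_congr rfl fun a _ => by rw [e.sum_comp fun b => p (m, b)]

lemma push_fst_pair {A B C : Type*} [Fintype A] [Fintype B] [Fintype C] (p : (A × B) × C → ℝ)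
    (a : A) (c : C) : push (fun x => (x.1.1, x.2)) p (a, c) = ∑ b, p ((a, b), c) := by
  classical
  simp only [push_eq_sum_ite, Fintype.sum_prod_type, Prod.mk.injEq]
  rw [Fintype.sum_eq_single a (fun a' h => by simp [h])]
  exact sum_congr rfl fun b _ => by simp

lemma push_snd_pair {A B C : Type*} [Fintype A] [Fintype B] [Fintype C] (p : (A × B) × C → ℝ)
    (b : B) (c : C) : push (fun x => (x.1.2, x.2)) p (b, c) = ∑ a, p ((a, b), c) := by
  classical
  simp only [push_eq_sum_ite, Fintype.sum_prod_type, Prod.mk.injEq]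
  refine sum_congr rfl fun a _ => ?_
  rw [Fintype.sum_eq_single b (fun b' h => by simp [h])]
  simp

variable (h₁₂ : (N₁.e : ℕ) ∣ N₂.k) (h₂₁ : (N₂.e : ℕ) ∣ N₁.k) (τ : ℕ)
  (B₁ : BlockUser V₁ X₁ Y₁ N₁ N₂ n) (B₂ : BlockUser V₂ X₂ Y₂ N₂ N₁ n)

lemma idealEveLaw_eq (a : (Msg N₁ τ × Msg N₂ τ) × (Times τ n → Z)) :
    idealEveLaw W Q₁ Q₂ B₁ B₂ h₁₂ h₂₁ τ a = (Fintype.card (Msg N₁ τ × Msg N₂ τ) : ℝ)⁻¹ *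
      idealCond (eveBlock W Q₁ Q₂ B₁.word B₂.word) h₁₂ h₂₁ a.1.1 a.1.2
        (blockEquiv τ n Z a.2) := by
  obtain ⟨⟨m₁, m₂⟩, z⟩ := a
  unfold idealEveLaw idealCond
  dsimp only
  simp only [expect_eq_sum_inv_mul, ← mul_sum]
  rw [Fintype.card_prod (Msg N₁ τ), Nat.cast_mul, mul_inv,
    mul_assoc (Fintype.card (Priv N₁ τ) : ℝ)⁻¹]
  rfl

lemma leak₁₂_idealEveLaw_le (hac : ∀ i₁ i₂ z, 0 < eveBlock W Q₁ Q₂ B₁.word B₂.word i₁ i₂ z →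
      0 < eveOut W Q₁ Q₂ n z) :
    leak₁₂ (idealEveLaw W Q₁ Q₂ B₁ B₂ h₁₂ h₂₁ τ) ≤
      (τ + 1) * roundKlBoth (eveBlock W Q₁ Q₂ B₁.word B₂.word) (eveOut W Q₁ Q₂ n) := by
  refine le_of_eq_of_le ?_ (mutualInfo_idealCond_le (fun _ _ => prodChan_eveChan_nonneg W Q₁ Q₂ _ _)
    (fun _ _ => sum_prodChan_eveChan W Q₁ Q₂ _ _) (eveOut_nonneg W Q₁ Q₂) (sum_eveOut W Q₁ Q₂) hac
    h₁₂ h₂₁ τ)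
  rw [← mutualInfo_comp_equiv (blockEquiv τ n Z)]
  exact congrArg mutualInfo (funext fun a => idealEveLaw_eq W Q₁ Q₂ h₁₂ h₂₁ τ B₁ B₂ a)

lemma leak₁_idealEveLaw_le (hac : ∀ i₁ i₂ z, 0 < eveBlock W Q₁ Q₂ B₁.word B₂.word i₁ i₂ z →
      0 < eveOut W Q₁ Q₂ n z) :
    leak₁ (idealEveLaw W Q₁ Q₂ B₁ B₂ h₁₂ h₂₁ τ) ≤
      (τ + 1) * roundKlFst (eveBlock W Q₁ Q₂ B₁.word B₂.word) (eveOut W Q₁ Q₂ n) := by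
  classical
  refine le_of_eq_of_le ?_ (mutualInfo_expect_idealCond_le
    (fun _ _ => prodChan_eveChan_nonneg W Q₁ Q₂ _ _)
    (fun _ _ => sum_prodChan_eveChan W Q₁ Q₂ _ _) (eveOut_nonneg W Q₁ Q₂) (sum_eveOut W Q₁ Q₂) hac
    h₁₂ h₂₁ τ)
  rw [← mutualInfo_comp_equiv (blockEquiv τ n Z)]
  refine congrArg mutualInfo (funext fun ⟨m, z⟩ => ?_)
  rw [push_fst_pair]
  simp only [idealEveLaw_eq, expect_eq_sum_inv_mul, ← mul_sum]
  rw [Fintype.card_prod (Msg N₁ τ), Nat.cast_mul, mul_inv, mul_assoc]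
  rfl

lemma leak₂_idealEveLaw_le (hac : ∀ i₁ i₂ z, 0 < eveBlock W Q₁ Q₂ B₁.word B₂.word i₁ i₂ z →
      0 < eveOut W Q₁ Q₂ n z) :
    leak₂ (idealEveLaw W Q₁ Q₂ B₁ B₂ h₁₂ h₂₁ τ) ≤
      (τ + 1) * roundKlFst (fun i₂ i₁ => eveBlock W Q₁ Q₂ B₁.word B₂.word i₁ i₂)
        (eveOut W Q₁ Q₂ n) := by
  classical
  refine le_of_eq_of_le ?_ (mutualInfo_expect_idealCond_le
    (fun _ _ => prodChan_eveChan_nonneg W Q₁ Q₂ _ _)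
    (fun _ _ => sum_prodChan_eveChan W Q₁ Q₂ _ _) (eveOut_nonneg W Q₁ Q₂) (sum_eveOut W Q₁ Q₂)
    (fun i₂ i₁ => hac i₁ i₂) h₂₁ h₁₂ τ)
  rw [← mutualInfo_comp_equiv (blockEquiv τ n Z)]
  refine congrArg mutualInfo (funext fun ⟨m, z⟩ => ?_)
  rw [push_snd_pair]
  simp only [idealEveLaw_eq, expect_eq_sum_inv_mul, ← mul_sum]
  rw [Fintype.card_prod (Msg N₁ τ), Nat.cast_mul, mul_inv, mul_comm (Fintype.card (Msg N₁ τ) : ℝ)⁻¹,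
    mul_assoc]
  refine congrArg _ (congrArg _ (sum_congr rfl fun m' _ => ?_))
  exact (idealCond_swap _ h₁₂ h₂₁ _ _ _).symm

end Leakage

/-! ### Existence of good codes -/

section Existence

variable {V₁ V₂ X₁ X₂ Y₁ Y₂ Z : Type*}
  [Fintype V₁] [Fintype V₂] [Fintype X₁] [Fintype X₂] [Fintype Y₁] [Fintype Y₂] [Fintype Z]
  (W : X₁ → X₂ → stdSimplex ℝ (Y₁ × Y₂ × Z)) (Q₁ : InputLaw V₁ X₁) (Q₂ : InputLaw V₂ X₂)
  {N₁ N₂ : Sizes} {n : ℕ}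

lemma nonempty_of_simplex {A : Type*} [Fintype A] (p : stdSimplex ℝ A) : Nonempty A := by
  by_contra h
  rw [not_nonempty_iff] at h
  simpa using sum_simplex p

include W Q₁ Q₂ in
lemma nonempty_letter : Nonempty ((X₁ × X₂) × (Y₁ × Y₂ × Z)) := by
  obtain ⟨v₁⟩ := nonempty_of_simplex Q₁.law
  obtain ⟨v₂⟩ := nonempty_of_simplex Q₂.law
  obtain ⟨x₁⟩ := nonempty_of_simplex (Q₁.chan v₁)
  obtain ⟨x₂⟩ := nonempty_of_simplex (Q₂.chan v₂)
  obtain ⟨y⟩ := nonempty_of_simplex (W x₁ x₂)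
  exact ⟨(x₁, x₂), y⟩

-- Bounds for every number of rounds from single-round quantities.

section Code

variable (h₁₂ : (N₁.e : ℕ) ∣ N₂.k) (h₂₁ : (N₂.e : ℕ) ∣ N₁.k) (τ : ℕ)
  (B₁ : BlockUser V₁ X₁ Y₁ N₁ N₂ n) (B₂ : BlockUser V₂ X₂ Y₂ N₂ N₁ n)

lemma sum_eq_one_of_push_fst {M R : Type*} [Fintype M] [Nonempty M] [Fintype R] {f : R → M}
    {p : R → ℝ} (h : ∀ m, push f p m = (Fintype.card M : ℝ)⁻¹) : ∑ r, p r = 1 := by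
  rw [← sum_push f]
  simp [h]

/-- No message is wrong on the event `AllCorrect`. The two run laws agree there and have the same
total mass, hence they give the complement the same mass, which the idealized protocol bounds. -/
lemma errorProb_keyExchange_le :
    errorProb W (keyExchange Q₁ B₁ h₁₂ h₂₁ τ) (keyExchange Q₂ B₂ h₂₁ h₁₂ τ) ≤
      (τ + 1) * blockError W Q₁ Q₂ B₁ B₂ := by
  classical
  have := nonempty_letter W Q₁ Q₂
  refine le_trans ?_ (sum_not_allCorrect_le W Q₁ Q₂ B₁ B₂ h₁₂ h₂₁ τ)
  set A₁ := keyExchange Q₁ B₁ h₁₂ h₂₁ τ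
  set A₂ := keyExchange Q₂ B₂ h₂₁ h₁₂ τ
  have h1 := sum_eq_one_of_push_fst (push_fst_runLaw W A₁ A₂)
  have h2 := sum_eq_one_of_push_fst (push_fst_idealRunLaw W Q₁ Q₂ h₁₂ h₂₁ τ B₁ B₂)
  rw [errorProb, sum_filter]
  calc _ ≤ ∑ r, (runLaw W A₁ A₂ r -
        (if AllCorrect h₁₂ h₂₁ τ B₁ B₂ r then idealRunLaw W Q₁ Q₂ h₁₂ h₂₁ τ B₁ B₂ r else 0)) := by
        refine sum_le_sum fun r _ => ?_
        by_cases hr : AllCorrect h₁₂ h₂₁ τ B₁ B₂ r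
        · have h3 := not_error_of_allCorrect Q₁ Q₂ h₁₂ h₂₁ τ B₁ B₂ r hr
          rw [if_neg (by rw [not_or, not_not, not_not]; exact h3), if_pos hr,
            ← runLaw_eq_idealRunLaw W Q₁ Q₂ h₁₂ h₂₁ τ B₁ B₂ r hr, sub_self]
        · rw [if_neg hr, sub_zero]
          split_ifs
          exacts [le_rfl, runLaw_nonneg W A₁ A₂ r]
    _ = ∑ r, (if AllCorrect h₁₂ h₂₁ τ B₁ B₂ r then 0
          else idealRunLaw W Q₁ Q₂ h₁₂ h₂₁ τ B₁ B₂ r) := by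
        rw [sum_sub_distrib, h1, ← h2, ← sum_sub_distrib]
        exact sum_congr rfl fun r _ => by split_ifs <;> simp

variable {τ} {η : ℝ} (hη : (τ + 1) * blockError W Q₁ Q₂ B₁ B₂ ≤ η)

include hη

lemma leak₁₂_eveLaw_le :
    leak₁₂ (eveLaw W (keyExchange Q₁ B₁ h₁₂ h₂₁ τ) (keyExchange Q₂ B₂ h₂₁ h₁₂ τ)) ≤
      leak₁₂ (idealEveLaw W Q₁ Q₂ B₁ B₂ h₁₂ h₂₁ τ) +
        keyErrorTerm η (Fintype.card (Msg N₁ τ × Msg N₂ τ)) := by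
  classical
  have := nonempty_letter W Q₁ Q₂
  rw [← push_idealRunLaw]
  exact mutualInfo_push_le _ _ (runLaw_nonneg W _ _) (idealRunLaw_nonneg W Q₁ Q₂ h₁₂ h₂₁ τ B₁ B₂)
    (AllCorrect h₁₂ h₂₁ τ B₁ B₂) (runLaw_eq_idealRunLaw W Q₁ Q₂ h₁₂ h₂₁ τ B₁ B₂)
    (push_fst_runLaw W _ _) (push_fst_idealRunLaw W Q₁ Q₂ h₁₂ h₂₁ τ B₁ B₂)
    ((sum_not_allCorrect_le W Q₁ Q₂ B₁ B₂ h₁₂ h₂₁ τ).trans hη)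

lemma leak₁_eveLaw_le :
    leak₁ (eveLaw W (keyExchange Q₁ B₁ h₁₂ h₂₁ τ) (keyExchange Q₂ B₂ h₂₁ h₁₂ τ)) ≤
      leak₁ (idealEveLaw W Q₁ Q₂ B₁ B₂ h₁₂ h₂₁ τ) + keyErrorTerm η (Fintype.card (Msg N₁ τ)) := by
  classical
  have := nonempty_letter W Q₁ Q₂
  rw [← push_idealRunLaw, leak₁, leak₁, eveLaw, push_push, push_push]
  exact mutualInfo_push_le _ _ (runLaw_nonneg W _ _) (idealRunLaw_nonneg W Q₁ Q₂ h₁₂ h₂₁ τ B₁ B₂)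
    (AllCorrect h₁₂ h₂₁ τ B₁ B₂) (runLaw_eq_idealRunLaw W Q₁ Q₂ h₁₂ h₂₁ τ B₁ B₂)
    (push_fst_of_uniform (push_fst_runLaw W _ _))
    (push_fst_of_uniform (push_fst_idealRunLaw W Q₁ Q₂ h₁₂ h₂₁ τ B₁ B₂))
    ((sum_not_allCorrect_le W Q₁ Q₂ B₁ B₂ h₁₂ h₂₁ τ).trans hη)

lemma leak₂_eveLaw_le :
    leak₂ (eveLaw W (keyExchange Q₁ B₁ h₁₂ h₂₁ τ) (keyExchange Q₂ B₂ h₂₁ h₁₂ τ)) ≤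
      leak₂ (idealEveLaw W Q₁ Q₂ B₁ B₂ h₁₂ h₂₁ τ) + keyErrorTerm η (Fintype.card (Msg N₂ τ)) := by
  classical
  have := nonempty_letter W Q₁ Q₂
  rw [← push_idealRunLaw, leak₂, leak₂, eveLaw, push_push, push_push]
  exact mutualInfo_push_le _ _ (runLaw_nonneg W _ _) (idealRunLaw_nonneg W Q₁ Q₂ h₁₂ h₂₁ τ B₁ B₂)
    (AllCorrect h₁₂ h₂₁ τ B₁ B₂) (runLaw_eq_idealRunLaw W Q₁ Q₂ h₁₂ h₂₁ τ B₁ B₂)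
    (push_snd_of_uniform (push_fst_runLaw W _ _))
    (push_snd_of_uniform (push_fst_idealRunLaw W Q₁ Q₂ h₁₂ h₂₁ τ B₁ B₂))
    ((sum_not_allCorrect_le W Q₁ Q₂ B₁ B₂ h₁₂ h₂₁ τ).trans hη)

omit hη

variable (hac : ∀ i₁ i₂ z, 0 < eveBlock W Q₁ Q₂ B₁.word B₂.word i₁ i₂ z → 0 < eveOut W Q₁ Q₂ n z)
  {R₁ R₂ : Rates}

include hac

/-- The hypotheses concern one block and involve no number of rounds; linear growth in $t$ comes
from the union bound and from the chain bound. -/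
lemma jointBounds_of
    (he : ∀ s, 0 < s → s ≤ 1 → blockError W Q₁ Q₂ B₁ B₂ ≤ 2 * errTerm W Q₁ Q₂ n R₁ R₂ s)
    (hl : ∀ s, 0 < s → s ≤ 1 →
      roundKlBoth (eveBlock W Q₁ Q₂ B₁.word B₂.word) (eveOut W Q₁ Q₂ n) ≤
        2 * (1 / s * leakTerm W Q₁ Q₂ n R₁.aux R₂.aux s)) :
    JointBounds W Q₁ Q₂ h₁₂ h₂₁ R₁ R₂ B₁ B₂ := by
  intro τ s hs hs1
  have ht : (0 : ℝ) ≤ τ + 1 := by positivity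
  have hη : (τ + 1) * blockError W Q₁ Q₂ B₁ B₂ ≤ 2 * (τ + 1) * errTerm W Q₁ Q₂ n R₁ R₂ s :=
    (mul_le_mul_of_nonneg_left (he s hs hs1) ht).trans (le_of_eq (by ring))
  refine ⟨(errorProb_keyExchange_le W Q₁ Q₂ h₁₂ h₂₁ τ B₁ B₂).trans hη, ?_,
    leak₁₂_eveLaw_le W Q₁ Q₂ h₁₂ h₂₁ B₁ B₂ hη⟩
  exact (leak₁₂_idealEveLaw_le W Q₁ Q₂ h₁₂ h₂₁ τ B₁ B₂ hac).trans
    ((mul_le_mul_of_nonneg_left (hl s hs hs1) ht).trans (le_of_eq (by ring)))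

lemma individualBounds_of
    (he : ∀ s, 0 < s → s ≤ 1 → blockError W Q₁ Q₂ B₁ B₂ ≤ 3 * errTerm W Q₁ Q₂ n R₁ R₂ s)
    (hl₁ : ∀ s, 0 < s → s ≤ 1 →
      roundKlFst (eveBlock W Q₁ Q₂ B₁.word B₂.word) (eveOut W Q₁ Q₂ n) ≤
        3 * (1 / s * leakTerm W Q₁ Q₂ n R₁.aux (R₂.aux + R₂.s) s))
    (hl₂ : ∀ s, 0 < s → s ≤ 1 →
      roundKlFst (fun i₂ i₁ => eveBlock W Q₁ Q₂ B₁.word B₂.word i₁ i₂) (eveOut W Q₁ Q₂ n) ≤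
        3 * (1 / s * leakTerm W Q₁ Q₂ n (R₁.aux + R₁.s) R₂.aux s)) :
    IndividualBounds W Q₁ Q₂ h₁₂ h₂₁ R₁ R₂ B₁ B₂ := by
  intro τ s hs hs1
  have ht : (0 : ℝ) ≤ τ + 1 := by positivity
  have hη : (τ + 1) * blockError W Q₁ Q₂ B₁ B₂ ≤ 3 * (τ + 1) * errTerm W Q₁ Q₂ n R₁ R₂ s :=
    (mul_le_mul_of_nonneg_left (he s hs hs1) ht).trans (le_of_eq (by ring))
  refine ⟨(errorProb_keyExchange_le W Q₁ Q₂ h₁₂ h₂₁ τ B₁ B₂).trans hη, ?_, ?_,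
    leak₁_eveLaw_le W Q₁ Q₂ h₁₂ h₂₁ B₁ B₂ hη, leak₂_eveLaw_le W Q₁ Q₂ h₁₂ h₂₁ B₁ B₂ hη⟩
  · exact (leak₁_idealEveLaw_le W Q₁ Q₂ h₁₂ h₂₁ τ B₁ B₂ hac).trans
      ((mul_le_mul_of_nonneg_left (hl₁ s hs hs1) ht).trans (le_of_eq (by ring)))
  · exact (leak₂_idealEveLaw_le W Q₁ Q₂ h₁₂ h₂₁ τ B₁ B₂ hac).trans
      ((mul_le_mul_of_nonneg_left (hl₂ s hs hs1) ht).trans (le_of_eq (by ring)))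

end Code

/-- The weighted means of finitely many functions of random codes are nearly attained at one pair
of codes. -/
lemma exists_codes_le_card_mul_mean {ι : Type*} [Fintype ι] [Nonempty ι]
    (F : ι → (Index N₁ → Fin n → V₁) → (Index N₂ → Fin n → V₂) → ℝ)
    (hF : ∀ i c₁ c₂, 0 < prodLaw (prodLaw Q₁.law) c₁ → 0 < prodLaw (prodLaw Q₂.law) c₂ →
      0 ≤ F i c₁ c₂) :
    ∃ c₁ c₂, 0 < prodLaw (prodLaw Q₁.law) c₁ ∧ 0 < prodLaw (prodLaw Q₂.law) c₂ ∧
      ∀ i, F i c₁ c₂ ≤ Fintype.card ι * ∑ c₁, prodLaw (prodLaw Q₁.law) c₁ *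
        ∑ c₂, prodLaw (prodLaw Q₂.law) c₂ * F i c₁ c₂ := by
  have h₁ := prodLaw_nonneg (I := Index N₁) (prodLaw_nonneg (I := Fin n) (simplex_nonneg Q₁.law))
  have h₂ := prodLaw_nonneg (I := Index N₂) (prodLaw_nonneg (I := Fin n) (simplex_nonneg Q₂.law))
  have s₁ : ∑ c : Index N₁ → Fin n → V₁, prodLaw (prodLaw Q₁.law) c = 1 :=
    sum_prodLaw (sum_prodLaw (sum_simplex _))
  have s₂ : ∑ c : Index N₂ → Fin n → V₂, prodLaw (prodLaw Q₂.law) c = 1 :=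
    sum_prodLaw (sum_prodLaw (sum_simplex _))
  have hpos : ∀ ω : (Index N₁ → Fin n → V₁) × (Index N₂ → Fin n → V₂),
      0 < prodLaw (prodLaw Q₁.law) ω.1 * prodLaw (prodLaw Q₂.law) ω.2 →
      0 < prodLaw (prodLaw Q₁.law) ω.1 ∧ 0 < prodLaw (prodLaw Q₂.law) ω.2 := fun ω h =>
    ⟨pos_of_mul_pos_left h (h₂ _), pos_of_mul_pos_right h (h₁ _)⟩
  obtain ⟨ω, hω, h⟩ := exists_le_card_mul_mean (ι := ι)
    (fun ω : (Index N₁ → Fin n → V₁) × (Index N₂ → Fin n → V₂) =>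
      prodLaw (prodLaw Q₁.law) ω.1 * prodLaw (prodLaw Q₂.law) ω.2)
    (fun ω => mul_nonneg (h₁ _) (h₂ _))
    (by rw [Fintype.sum_prod_type]; simp only [← mul_sum, s₂, mul_one, s₁])
    (fun i ω => F i ω.1 ω.2) (fun i ω hω => hF i _ _ (hpos ω hω).1 (hpos ω hω).2)
  refine ⟨ω.1, ω.2, (hpos ω hω).1, (hpos ω hω).2, fun i => (h i).trans (le_of_eq ?_)⟩
  rw [Fintype.sum_prod_type]
  simp only [mul_sum, mul_assoc]

lemma exists_codes_le_two_mul_mean {F G : (Index N₁ → Fin n → V₁) → (Index N₂ → Fin n → V₂) → ℝ}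
    (hF : ∀ c₁ c₂, 0 ≤ F c₁ c₂)
    (hG : ∀ c₁ c₂, 0 < prodLaw (prodLaw Q₁.law) c₁ → 0 < prodLaw (prodLaw Q₂.law) c₂ →
      0 ≤ G c₁ c₂) :
    ∃ c₁ c₂, 0 < prodLaw (prodLaw Q₁.law) c₁ ∧ 0 < prodLaw (prodLaw Q₂.law) c₂ ∧
      F c₁ c₂ ≤ 2 * ∑ c₁, prodLaw (prodLaw Q₁.law) c₁ *
        ∑ c₂, prodLaw (prodLaw Q₂.law) c₂ * F c₁ c₂ ∧
      G c₁ c₂ ≤ 2 * ∑ c₁, prodLaw (prodLaw Q₁.law) c₁ *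
        ∑ c₂, prodLaw (prodLaw Q₂.law) c₂ * G c₁ c₂ := by
  obtain ⟨c₁, c₂, h₁, h₂, h⟩ := exists_codes_le_card_mul_mean (ι := Fin 2) Q₁ Q₂ ![F, G] (by
    intro i c₁ c₂ h₁ h₂
    fin_cases i
    exacts [hF c₁ c₂, hG c₁ c₂ h₁ h₂])
  refine ⟨c₁, c₂, h₁, h₂, ?_, ?_⟩
  · simpa using h 0
  · simpa using h 1

lemma exists_codes_le_three_mul_mean
    {F G H : (Index N₁ → Fin n → V₁) → (Index N₂ → Fin n → V₂) → ℝ} (hF : ∀ c₁ c₂, 0 ≤ F c₁ c₂)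
    (hG : ∀ c₁ c₂, 0 < prodLaw (prodLaw Q₁.law) c₁ → 0 < prodLaw (prodLaw Q₂.law) c₂ →
      0 ≤ G c₁ c₂)
    (hH : ∀ c₁ c₂, 0 < prodLaw (prodLaw Q₁.law) c₁ → 0 < prodLaw (prodLaw Q₂.law) c₂ →
      0 ≤ H c₁ c₂) :
    ∃ c₁ c₂, 0 < prodLaw (prodLaw Q₁.law) c₁ ∧ 0 < prodLaw (prodLaw Q₂.law) c₂ ∧
      F c₁ c₂ ≤ 3 * ∑ c₁, prodLaw (prodLaw Q₁.law) c₁ *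
        ∑ c₂, prodLaw (prodLaw Q₂.law) c₂ * F c₁ c₂ ∧
      G c₁ c₂ ≤ 3 * ∑ c₁, prodLaw (prodLaw Q₁.law) c₁ *
        ∑ c₂, prodLaw (prodLaw Q₂.law) c₂ * G c₁ c₂ ∧
      H c₁ c₂ ≤ 3 * ∑ c₁, prodLaw (prodLaw Q₁.law) c₁ *
        ∑ c₂, prodLaw (prodLaw Q₂.law) c₂ * H c₁ c₂ := by
  obtain ⟨c₁, c₂, h₁, h₂, h⟩ := exists_codes_le_card_mul_mean (ι := Fin 3) Q₁ Q₂ ![F, G, H] (by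
    intro i c₁ c₂ h₁ h₂
    fin_cases i
    exacts [hF c₁ c₂, hG c₁ c₂ h₁ h₂, hH c₁ c₂ h₁ h₂])
  refine ⟨c₁, c₂, h₁, h₂, ?_, ?_, ?_⟩
  · simpa using h 0
  · simpa using h 1
  · simpa using h 2

-- Nonnegativity of the divergences, as the selection argument requires.

section Nonneg

variable {c₁ : Index N₁ → Fin n → V₁} {c₂ : Index N₂ → Fin n → V₂}
  (h₁ : 0 < prodLaw (prodLaw Q₁.law) c₁) (h₂ : 0 < prodLaw (prodLaw Q₂.law) c₂)

include h₁ h₂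

/-- Positive probability of both codes makes every codeword possible, so the output is absolutely
continuous with respect to `eveOut`. This excludes the default values of the logarithm and of
division. -/
lemma kl_eveBlock_nonneg {B₁ B₂ : Type*} [Fintype B₁] [Fintype B₂] [Nonempty B₁] [Nonempty B₂]
    (β₁ : B₁ → Index N₁) (β₂ : B₂ → Index N₂) :
    0 ≤ kl (fun z => 𝔼 b₁, 𝔼 b₂, eveBlock W Q₁ Q₂ c₁ c₂ (β₁ b₁) (β₂ b₂) z)
      (eveOut W Q₁ Q₂ n) := by
  refine kl_nonneg (fun z => expect_nonneg fun _ _ => expect_nonneg fun _ _ =>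
    prodChan_eveChan_nonneg W Q₁ Q₂ _ _ _) (eveOut_nonneg W Q₁ Q₂) (fun z hz => ?_) ?_
    (sum_eveOut W Q₁ Q₂).le
  · by_contra h
    have h3 : ∀ i₁ i₂, eveBlock W Q₁ Q₂ c₁ c₂ i₁ i₂ z = 0 := fun i₁ i₂ =>
      le_antisymm (not_lt.1 fun h' => h (eveOut_pos W Q₁ Q₂ h₁ h₂ i₁ i₂ z h'))
        (prodChan_eveChan_nonneg W Q₁ Q₂ _ _ _)
    simp [h3] at hz
  · simp only [← expect_sum_comm]
    refine (expect_congr rfl fun _ _ => (expect_congr rfl fun _ _ => ?_).trans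
      (Fintype.expect_const 1)).trans (Fintype.expect_const 1)
    exact sum_prodChan_eveChan W Q₁ Q₂ _ _

lemma roundKlBoth_nonneg : 0 ≤ roundKlBoth (eveBlock W Q₁ Q₂ c₁ c₂) (eveOut W Q₁ Q₂ n) := by
  simp only [roundKlBoth, expect_roundBoth]
  exact expect_nonneg fun x _ => expect_nonneg fun k _ => kl_eveBlock_nonneg W Q₁ Q₂ h₁ h₂
    (fun b : ZMod N₁.e × Fin N₁.o => (x.1, k.1, b)) (fun b : ZMod N₂.e × Fin N₂.o => (x.2, k.2, b))

lemma roundKlFst_nonneg : 0 ≤ roundKlFst (eveBlock W Q₁ Q₂ c₁ c₂) (eveOut W Q₁ Q₂ n) := by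
  simp only [roundKlFst, expect_roundFst]
  exact expect_nonneg fun x _ => expect_nonneg fun k _ => kl_eveBlock_nonneg W Q₁ Q₂ h₁ h₂
    (fun b : ZMod N₁.e × Fin N₁.o => (x, k.1, b))
    (fun b : Fin N₂.s × ZMod N₂.e × Fin N₂.o => (b.1, k.2, b.2))

lemma roundKlSnd_nonneg :
    0 ≤ roundKlFst (fun i₂ i₁ => eveBlock W Q₁ Q₂ c₁ c₂ i₁ i₂) (eveOut W Q₁ Q₂ n) := by
  simp only [roundKlFst, expect_roundFst]
  refine expect_nonneg fun x _ => expect_nonneg fun k _ => ?_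
  simp only [fun z => expect_comm' fun (b₂ : ZMod N₂.e × Fin N₂.o)
    (b₁ : Fin N₁.s × ZMod N₁.e × Fin N₁.o) =>
      eveBlock W Q₁ Q₂ (n := n) c₁ c₂ (b₁.1, k.2, b₁.2) (x, k.1, b₂) z]
  exact kl_eveBlock_nonneg W Q₁ Q₂ h₁ h₂
    (fun b : Fin N₁.s × ZMod N₁.e × Fin N₁.o => (b.1, k.2, b.2))
    (fun b : ZMod N₂.e × Fin N₂.o => (x, k.1, b))

end Nonneg

variable (h₁₂ : (N₁.e : ℕ) ∣ N₂.k) (h₂₁ : (N₂.e : ℕ) ∣ N₁.k) {R₁ R₂ : Rates}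
  (hI₁ : (Fintype.card (Index N₁) : ℝ) ≤ Real.exp (n * (R₁.main + R₁.aux)))
  (hI₂ : (Fintype.card (Index N₂) : ℝ) ≤ Real.exp (n * (R₂.main + R₂.aux)))
  (ha₁ : Real.exp (n * R₁.aux) ≤ (N₁.e : ℕ) * (N₁.o : ℕ))
  (ha₂ : Real.exp (n * R₂.aux) ≤ (N₂.e : ℕ) * (N₂.o : ℕ))

include hI₁ hI₂ ha₁ ha₂

theorem exists_jointBounds :
    ∃ (B₁ : BlockUser V₁ X₁ Y₁ N₁ N₂ n) (B₂ : BlockUser V₂ X₂ Y₂ N₂ N₁ n),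
      JointBounds W Q₁ Q₂ h₁₂ h₂₁ R₁ R₂ B₁ B₂ := by
  -- The code is selected before `s`: it is compared with the exact means, which are afterwards
  -- bounded for each `s`.
  obtain ⟨c₁, c₂, hc₁, hc₂, h0, h1⟩ := exists_codes_le_two_mul_mean Q₁ Q₂
    (fun c₁ c₂ => blockError_nonneg W Q₁ Q₂ (mlUser₁ W Q₂ c₁ c₂) (mlUser₂ W Q₁ c₁ c₂))
    (fun c₁ c₂ => roundKlBoth_nonneg W Q₁ Q₂ (n := n) (c₁ := c₁) (c₂ := c₂))
  exact ⟨mlUser₁ W Q₂ c₁ c₂, mlUser₂ W Q₁ c₁ c₂,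
    jointBounds_of W Q₁ Q₂ h₁₂ h₂₁ _ _ (eveOut_pos W Q₁ Q₂ hc₁ hc₂)
    (fun s hs hs1 => h0.trans (mul_le_mul_of_nonneg_left
      ((sum_codes_blockError_le W Q₁ Q₂ hs hs1).trans
        (gallagerSum_add_le_errTerm W Q₁ Q₂ hs hI₁ hI₂)) zero_le_two))
    (fun s hs hs1 => h1.trans (mul_le_mul_of_nonneg_left
      (sum_codes_roundKlBoth_le W Q₁ Q₂ ha₁ ha₂ hs hs1) zero_le_two))⟩

theorem exists_individualBounds (hs₁ : Real.exp (n * R₁.s) ≤ (N₁.s : ℕ))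
    (hs₂ : Real.exp (n * R₂.s) ≤ (N₂.s : ℕ)) :
    ∃ (B₁ : BlockUser V₁ X₁ Y₁ N₁ N₂ n) (B₂ : BlockUser V₂ X₂ Y₂ N₂ N₁ n),
      IndividualBounds W Q₁ Q₂ h₁₂ h₂₁ R₁ R₂ B₁ B₂ := by
  obtain ⟨c₁, c₂, hc₁, hc₂, h0, h1, h2⟩ := exists_codes_le_three_mul_mean Q₁ Q₂
    (fun c₁ c₂ => blockError_nonneg W Q₁ Q₂ (mlUser₁ W Q₂ c₁ c₂) (mlUser₂ W Q₁ c₁ c₂))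
    (fun c₁ c₂ => roundKlFst_nonneg W Q₁ Q₂ (n := n) (c₁ := c₁) (c₂ := c₂))
    (fun c₁ c₂ => roundKlSnd_nonneg W Q₁ Q₂ (n := n) (c₁ := c₁) (c₂ := c₂))
  have k₁ : Real.exp (n * (R₁.aux + R₁.s)) ≤ (N₁.s : ℕ) * ((N₁.e : ℕ) * (N₁.o : ℕ)) := by
    rw [add_comm, mul_add, Real.exp_add]
    exact mul_le_mul hs₁ ha₁ (Real.exp_nonneg _) (Nat.cast_nonneg _)
  have k₂ : Real.exp (n * (R₂.aux + R₂.s)) ≤ (N₂.s : ℕ) * ((N₂.e : ℕ) * (N₂.o : ℕ)) := by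
    rw [add_comm, mul_add, Real.exp_add]
    exact mul_le_mul hs₂ ha₂ (Real.exp_nonneg _) (Nat.cast_nonneg _)
  exact ⟨mlUser₁ W Q₂ c₁ c₂, mlUser₂ W Q₁ c₁ c₂,
    individualBounds_of W Q₁ Q₂ h₁₂ h₂₁ _ _ (eveOut_pos W Q₁ Q₂ hc₁ hc₂)
    (fun s hs hs1 => h0.trans (mul_le_mul_of_nonneg_left
      ((sum_codes_blockError_le W Q₁ Q₂ hs hs1).trans
        (gallagerSum_add_le_errTerm W Q₁ Q₂ hs hI₁ hI₂)) zero_le_three))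
    (fun s hs hs1 => h1.trans (mul_le_mul_of_nonneg_left
      (sum_codes_roundKlFst_le W Q₁ Q₂ ha₁ k₂ hs hs1) zero_le_three))
    (fun s hs hs1 => h2.trans (mul_le_mul_of_nonneg_left
      (sum_codes_roundKlSnd_le W Q₁ Q₂ k₁ ha₂ hs hs1) zero_le_three))⟩

end Existence

/-! ### Rates and rounding of sizes -/

lemma overallRate_eq (N : Sizes) (n τ : ℕ) :
    overallRate N n τ = (N.rates n).s + (N.rates n).e * ((τ : ℝ) / (τ + 1)) := by
  have h1 : ((N.s : ℕ) : ℝ) ≠ 0 := by simp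
  have h2 : ((N.e : ℕ) : ℝ) ≠ 0 := by simp
  have h3 : (τ : ℝ) + 1 ≠ 0 := by positivity
  have h4 : Real.log (Fintype.card (Msg N τ)) =
      (τ + 1) * Real.log (N.s : ℕ) + τ * Real.log (N.e : ℕ) := by
    rw [Fintype.card_prod, Fintype.card_fun, Fintype.card_fun, Fintype.card_fin, Fintype.card_fin,
      ZMod.card, Fintype.card_fin]
    push_cast
    rw [Real.log_mul (pow_ne_zero _ h1) (pow_ne_zero _ h2), Real.log_pow, Real.log_pow]
    push_cast
    rfl
  rw [overallRate, h4]
  simp only [Sizes.rates]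
  rcases eq_or_ne (n : ℝ) 0 with hn | hn
  · simp [hn]
  · field_simp

lemma tendsto_rounds : Tendsto (fun τ : ℕ => (τ : ℝ) / (τ + 1)) atTop (𝓝 1) :=
  tendsto_natCast_div_add_atTop 1

lemma exp_mul_log_div {n : ℕ} (hn : 0 < n) (N : ℕ+) :
    Real.exp (n * (Real.log (N : ℕ) / n)) = (N : ℕ) := by
  rw [mul_div_cancel₀ _ (by positivity), Real.exp_log (by simp)]

lemma card_index (N : Sizes) :
    (Fintype.card (Index N) : ℝ) = (N.s : ℕ) * ((N.k : ℕ) * ((N.e : ℕ) * (N.o : ℕ))) := by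
  simp [Fintype.card_prod, ZMod.card]

lemma card_index_le_exp_rates {n : ℕ} (hn : 0 < n) (N : Sizes) :
    (Fintype.card (Index N) : ℝ) ≤
      Real.exp (n * ((N.rates n).main + (N.rates n).aux)) := by
  simp only [Rates.main, Rates.aux, Sizes.rates, mul_add, Real.exp_add, exp_mul_log_div hn,
    card_index]
  exact le_of_eq (by ring)

lemma exp_aux_rates_le {n : ℕ} (hn : 0 < n) (N : Sizes) :
    Real.exp (n * (N.rates n).aux) ≤ (N.e : ℕ) * (N.o : ℕ) := by
  simp only [Rates.aux, Sizes.rates, mul_add, Real.exp_add, exp_mul_log_div hn, le_refl]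

/-- A positive integer between `x` and `x + 1`. -/
def roundUp (x : ℝ) : ℕ+ := Nat.succPNat ⌊x⌋₊

lemma le_roundUp (x : ℝ) : x ≤ (roundUp x : ℕ) := by
  simpa [roundUp] using (Nat.lt_floor_add_one x).le

lemma roundUp_le {x : ℝ} (hx : 0 ≤ x) : ((roundUp x : ℕ) : ℝ) ≤ x + 1 := by
  simpa [roundUp] using Nat.floor_le hx

/-- Rounded sizes for real rates; `e'` is the size of the encrypted part of the other user. -/
def roundedSizes (R : Rates) (e' : ℕ+) (n : ℕ) : Sizes where
  -- Secrecy asks for a large secret size and a large product of encrypted and open sizes,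
  -- reliability for a small total size. The key size carries the slack of a factor 16. The
  -- encrypted size is shrunk by the same factor because it must divide the other key size, and the
  -- open size compensates for this. The encrypted size does not involve `e'`, so there is no
  -- circularity between the users.
  s := roundUp (Real.exp (n * R.s))
  k := e' * roundUp (Real.exp (n * R.k) / (16 * (e' : ℕ)))
  e := roundUp (Real.exp (n * R.e) / 16)
  o := roundUp (Real.exp (n * R.aux) / (roundUp (Real.exp (n * R.e) / 16) : ℕ))

lemma one_le_exp_natCast_mul (n : ℕ) {r : ℝ} (hr : 0 ≤ r) : 1 ≤ Real.exp (n * r) :=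
  Real.one_le_exp (by positivity)

-- Two-sided estimates of the rounded sizes.

section Rounded

variable {R : Rates} {e' : ℕ+} {n : ℕ}

lemma roundedSizes_s_le (hs : 0 ≤ R.s) :
    (((roundedSizes R e' n).s : ℕ) : ℝ) ≤ 2 * Real.exp (n * R.s) := by
  have h1 := one_le_exp_natCast_mul n hs
  have h2 := roundUp_le (Real.exp_nonneg (n * R.s))
  change ((roundUp (Real.exp (n * R.s)) : ℕ) : ℝ) ≤ _
  linarith

lemma le_roundedSizes_s : Real.exp (n * R.s) ≤ ((roundedSizes R e' n).s : ℕ) := le_roundUp _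

lemma roundedSizes_e_le (he : 0 ≤ R.e) :
    (((roundedSizes R e' n).e : ℕ) : ℝ) ≤ 17 / 16 * Real.exp (n * R.e) := by
  have h1 := one_le_exp_natCast_mul n he
  have h2 := roundUp_le (x := Real.exp (n * R.e) / 16) (by positivity)
  change ((roundUp (Real.exp (n * R.e) / 16) : ℕ) : ℝ) ≤ _
  linarith

lemma le_roundedSizes_e : 1 / 16 * Real.exp (n * R.e) ≤ ((roundedSizes R e' n).e : ℕ) := by
  have h2 := le_roundUp (Real.exp (n * R.e) / 16)
  change _ ≤ ((roundUp (Real.exp (n * R.e) / 16) : ℕ) : ℝ)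
  linarith

lemma le_roundedSizes_k :
    1 / 16 * Real.exp (n * R.k) ≤ ((roundedSizes R e' n).k : ℕ) := by
  have h0 : (0 : ℝ) < (e' : ℕ) := by simp
  have h2 := le_roundUp (Real.exp (n * R.k) / (16 * (e' : ℕ)))
  rw [div_le_iff₀ (by positivity)] at h2
  have h3 : (((roundedSizes R e' n).k : ℕ) : ℝ) =
    (e' : ℕ) * (roundUp (Real.exp (n * R.k) / (16 * (e' : ℕ))) : ℕ) := by
    simp [roundedSizes]
  rw [h3]
  linarith

/-- Rounding up to a multiple of `e'` adds at most `e'`, which is at most $e^{nR_k}/16+1$; the last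
1 is at most another $e^{nR_k}/16$ by `hk`. Here `r` is the rate of the other user's encrypted part.
-/
lemma roundedSizes_k_le {r : ℝ} (hr : r ≤ R.k)
    (he' : ((e' : ℕ) : ℝ) ≤ Real.exp (n * r) / 16 + 1) (hk : 16 ≤ Real.exp (n * R.k)) :
    (((roundedSizes R e' n).k : ℕ) : ℝ) ≤ 3 / 16 * Real.exp (n * R.k) := by
  have h0 : (0 : ℝ) < (e' : ℕ) := by simp
  have h2 := roundUp_le (x := Real.exp (n * R.k) / (16 * (e' : ℕ))) (by positivity)
  have h3 : (((roundedSizes R e' n).k : ℕ) : ℝ) =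
    (e' : ℕ) * (roundUp (Real.exp (n * R.k) / (16 * (e' : ℕ))) : ℕ) := by
    simp [roundedSizes]
  have h4 : Real.exp (n * r) ≤ Real.exp (n * R.k) := by gcongr
  rw [h3]
  calc _ ≤ ((e' : ℕ) : ℝ) * (Real.exp (n * R.k) / (16 * (e' : ℕ)) + 1) := by gcongr
    _ = Real.exp (n * R.k) / 16 + (e' : ℕ) := by field_simp
    _ ≤ _ := by linarith

lemma exp_aux_le_roundedSizes :
    Real.exp (n * R.aux) ≤ ((roundedSizes R e' n).e : ℕ) * ((roundedSizes R e' n).o : ℕ) := by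
  have h2 := le_roundUp (Real.exp (n * R.aux) / (roundUp (Real.exp (n * R.e) / 16) : ℕ))
  rw [div_le_iff₀ (by simp)] at h2
  exact h2.trans_eq (mul_comm _ _)

lemma roundedSizes_e_mul_o_le (he : 0 ≤ R.e) (ho : 0 ≤ R.o) :
    (((roundedSizes R e' n).e : ℕ) : ℝ) * ((roundedSizes R e' n).o : ℕ) ≤
      33 / 16 * Real.exp (n * R.aux) := by
  have h0 : (0 : ℝ) < ((roundedSizes R e' n).e : ℕ) := by simp
  have h1 := roundedSizes_e_le (e' := e') (n := n) he
  have h2 := roundUp_le (x := Real.exp (n * R.aux) / ((roundedSizes R e' n).e : ℕ)) (by positivity)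
  have h3 : Real.exp (n * R.e) ≤ Real.exp (n * R.aux) := by
    unfold Rates.aux
    gcongr
    linarith
  calc _ ≤ (((roundedSizes R e' n).e : ℕ) : ℝ) *
        (Real.exp (n * R.aux) / ((roundedSizes R e' n).e : ℕ) + 1) := by
        gcongr
        exact h2
    _ = Real.exp (n * R.aux) + ((roundedSizes R e' n).e : ℕ) := by field_simp
    _ ≤ _ := by linarith

lemma roundedSizes_o_le (ho : 0 ≤ R.o) :
    (((roundedSizes R e' n).o : ℕ) : ℝ) ≤ 17 * Real.exp (n * R.o) := by
  have h1 := one_le_exp_natCast_mul n ho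
  have h0 : (0 : ℝ) < ((roundedSizes R e' n).e : ℕ) := by simp
  have h2 := roundUp_le (x := Real.exp (n * R.aux) / ((roundedSizes R e' n).e : ℕ)) (by positivity)
  have h3 := le_roundedSizes_e (R := R) (e' := e') (n := n)
  have h4 : Real.exp (n * R.aux) / ((roundedSizes R e' n).e : ℕ) ≤ 16 * Real.exp (n * R.o) := by
    rw [div_le_iff₀ h0, Rates.aux, mul_add, Real.exp_add]
    nlinarith [Real.exp_pos (n * R.o)]
  refine le_trans h2 ?_
  linarith

lemma le_roundedSizes_o (he : 0 ≤ R.e) :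
    16 / 17 * Real.exp (n * R.o) ≤ ((roundedSizes R e' n).o : ℕ) := by
  have h1 := roundedSizes_e_le (e' := e') (n := n) he
  have h2 := exp_aux_le_roundedSizes (R := R) (e' := e') (n := n)
  rw [Rates.aux, mul_add, Real.exp_add] at h2
  have h3 := Real.exp_pos (n * R.e)
  have h4 : (0 : ℝ) ≤ ((roundedSizes R e' n).o : ℕ) := Nat.cast_nonneg _
  have h5 : Real.exp (n * R.e) * Real.exp (n * R.o) ≤
      Real.exp (n * R.e) * (17 / 16 * ((roundedSizes R e' n).o : ℕ)) :=
    h2.trans ((mul_le_mul_of_nonneg_right h1 h4).trans (le_of_eq (by ring)))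
  have h6 := le_of_mul_le_mul_left h5 h3
  linarith

/-- The three excess factors multiply to $2\cdot\frac3{16}\cdot\frac{33}{16}=\frac{198}{256}<1$, so
the total never exceeds its nominal value. -/
lemma card_index_roundedSizes_le (hs : 0 ≤ R.s) (he : 0 ≤ R.e) (ho : 0 ≤ R.o) {r : ℝ}
    (hr : r ≤ R.k) (he' : ((e' : ℕ) : ℝ) ≤ Real.exp (n * r) / 16 + 1)
    (hk : 16 ≤ Real.exp (n * R.k)) :
    (Fintype.card (Index (roundedSizes R e' n)) : ℝ) ≤ Real.exp (n * (R.main + R.aux)) := by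
  rw [card_index]
  calc _ ≤ 2 * Real.exp (n * R.s) * (3 / 16 * Real.exp (n * R.k) *
        (33 / 16 * Real.exp (n * R.aux))) := by
        refine mul_le_mul (roundedSizes_s_le hs) (mul_le_mul (roundedSizes_k_le hr he' hk)
          (roundedSizes_e_mul_o_le he ho) ?_ ?_) ?_ ?_ <;> positivity
    _ = 198 / 256 * Real.exp (n * (R.main + R.aux)) := by
        rw [Rates.main, mul_add, mul_add, Real.exp_add, Real.exp_add]
        ring
    _ ≤ _ := by linarith [Real.exp_pos (n * (R.main + R.aux))]

end Rounded

/-- Constant factors change a rate only by $O(1/n)$. -/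
lemma tendsto_log_div {N : ℕ → ℕ} {r c C : ℝ} (hc : 0 < c) (hC : 0 < C)
    (h1 : ∀ᶠ n : ℕ in atTop, c * Real.exp (n * r) ≤ N n)
    (h2 : ∀ᶠ n : ℕ in atTop, (N n : ℝ) ≤ C * Real.exp (n * r)) :
    Tendsto (fun n : ℕ => Real.log (N n) / n) atTop (𝓝 r) := by
  have h3 : ∀ a : ℝ, Tendsto (fun n : ℕ => Real.log a / n + r) atTop (𝓝 r) := fun a => by
    simpa using (tendsto_const_div_atTop_nhds_zero_nat (Real.log a)).add_const r
  have h4 : ∀ {a : ℝ} {n : ℕ}, 0 < a → 0 < n →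
      Real.log a / n + r = Real.log (a * Real.exp (n * r)) / n := by
    intro a n ha hn
    rw [Real.log_mul ha.ne' (Real.exp_ne_zero _), Real.log_exp, add_div,
      mul_div_cancel_left₀ _ (by positivity)]
  refine tendsto_of_tendsto_of_tendsto_of_le_of_le' (h3 c) (h3 C) ?_ ?_
  · filter_upwards [h1, eventually_gt_atTop 0] with n hn hn0
    rw [h4 hc hn0]
    gcongr
  · filter_upwards [h1, h2, eventually_gt_atTop 0] with n hn hn' hn0
    rw [h4 hC hn0]
    have : (0 : ℝ) < N n := lt_of_lt_of_le (by positivity) hn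
    gcongr

lemma eventually_le_exp {r : ℝ} (hr : 0 < r) : ∀ᶠ n : ℕ in atTop, 16 ≤ Real.exp (n * r) :=
  (Real.tendsto_exp_atTop.comp
    (tendsto_natCast_atTop_atTop.atTop_mul_const hr)).eventually_ge_atTop 16

lemma tendsto_rates_roundedSizes {R : Rates} {r : ℝ} {e' : ℕ → ℕ+} (hs : 0 ≤ R.s) (hk : 0 < R.k)
    (he : 0 ≤ R.e) (ho : 0 ≤ R.o) (hr : r ≤ R.k)
    (he' : ∀ n, ((e' n : ℕ) : ℝ) ≤ Real.exp (n * r) / 16 + 1) :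
    Tendsto (fun n => ((roundedSizes R (e' n) n).rates n).s) atTop (𝓝 R.s) ∧
      Tendsto (fun n => ((roundedSizes R (e' n) n).rates n).k) atTop (𝓝 R.k) ∧
      Tendsto (fun n => ((roundedSizes R (e' n) n).rates n).e) atTop (𝓝 R.e) ∧
      Tendsto (fun n => ((roundedSizes R (e' n) n).rates n).o) atTop (𝓝 R.o) := by
  refine ⟨tendsto_log_div one_pos two_pos
      (Eventually.of_forall fun n => (one_mul _).trans_le le_roundedSizes_s)
      (Eventually.of_forall fun n => roundedSizes_s_le hs),
    tendsto_log_div (c := 1 / 16) (C := 3 / 16) (by norm_num) (by norm_num)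
      (Eventually.of_forall fun n => le_roundedSizes_k)
      ((eventually_le_exp hk).mono fun n hn => roundedSizes_k_le hr (he' n) hn),
    tendsto_log_div (c := 1 / 16) (C := 17 / 16) (by norm_num) (by norm_num)
      (Eventually.of_forall fun n => le_roundedSizes_e)
      (Eventually.of_forall fun n => roundedSizes_e_le he),
    tendsto_log_div (c := 16 / 17) (C := 17) (by norm_num) (by norm_num)
      (Eventually.of_forall fun n => le_roundedSizes_o he)
      (Eventually.of_forall fun n => roundedSizes_o_le ho)⟩

lemma tendsto_overallRate {N : ℕ → Sizes} {a b : ℝ}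
    (hs : Tendsto (fun n => ((N n).rates n).s) atTop (𝓝 a))
    (he : Tendsto (fun n => ((N n).rates n).e) atTop (𝓝 b)) :
    Tendsto (fun x : ℕ × ℕ => overallRate (N x.1) x.1 x.2) (atTop ×ˢ atTop) (𝓝 (a + b)) := by
  simp only [overallRate_eq]
  simpa using (hs.comp tendsto_fst).add ((he.comp tendsto_fst).mul (tendsto_rounds.comp tendsto_snd))

end TwoWayWiretap

end

-- Assembly of the theorem.

open TwoWayWiretap in
theorem mainTheorem2 {V₁ V₂ X₁ X₂ Y₁ Y₂ Z : Type*}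
    [Fintype V₁] [Fintype V₂] [Fintype X₁] [Fintype X₂] [Fintype Y₁] [Fintype Y₂] [Fintype Z]
    (W : X₁ → X₂ → stdSimplex ℝ (Y₁ × Y₂ × Z)) (Q₁ : InputLaw V₁ X₁) (Q₂ : InputLaw V₂ X₂) :
    -- every block length and all integer part sizes `e^{nR}`
    (∀ (n : ℕ) (N₁ N₂ : Sizes) (h₁₂ : (N₁.e : ℕ) ∣ N₂.k) (h₂₁ : (N₂.e : ℕ) ∣ N₁.k), 0 < n →
      (∃ (B₁ : BlockUser V₁ X₁ Y₁ N₁ N₂ n) (B₂ : BlockUser V₂ X₂ Y₂ N₂ N₁ n),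
        JointBounds W Q₁ Q₂ h₁₂ h₂₁ (N₁.rates n) (N₂.rates n) B₁ B₂) ∧
      (∃ (B₁ : BlockUser V₁ X₁ Y₁ N₁ N₂ n) (B₂ : BlockUser V₂ X₂ Y₂ N₂ N₁ n),
        IndividualBounds W Q₁ Q₂ h₁₂ h₂₁ (N₁.rates n) (N₂.rates n) B₁ B₂) ∧
      Tendsto (fun τ => overallRate N₁ n τ) atTop (𝓝 ((N₁.rates n).s + (N₁.rates n).e)) ∧
      Tendsto (fun τ => overallRate N₂ n τ) atTop (𝓝 ((N₂.rates n).s + (N₂.rates n).e))) ∧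
    -- arbitrary real rates, with rounded part sizes
    (∀ R₁ R₂ : Rates,
      0 ≤ R₁.s → 0 < R₁.k → 0 ≤ R₁.e → 0 ≤ R₁.o →
      0 ≤ R₂.s → 0 < R₂.k → 0 ≤ R₂.e → 0 ≤ R₂.o →
      R₁.e ≤ R₂.k → R₂.e ≤ R₁.k →
      ∃ (N₁ N₂ : ℕ → Sizes) (h₁₂ : ∀ n, ((N₁ n).e : ℕ) ∣ (N₂ n).k)
        (h₂₁ : ∀ n, ((N₂ n).e : ℕ) ∣ (N₁ n).k),
        (Tendsto (fun n => ((N₁ n).rates n).s) atTop (𝓝 R₁.s) ∧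
          Tendsto (fun n => ((N₁ n).rates n).k) atTop (𝓝 R₁.k) ∧
          Tendsto (fun n => ((N₁ n).rates n).e) atTop (𝓝 R₁.e) ∧
          Tendsto (fun n => ((N₁ n).rates n).o) atTop (𝓝 R₁.o)) ∧
        (Tendsto (fun n => ((N₂ n).rates n).s) atTop (𝓝 R₂.s) ∧
          Tendsto (fun n => ((N₂ n).rates n).k) atTop (𝓝 R₂.k) ∧
          Tendsto (fun n => ((N₂ n).rates n).e) atTop (𝓝 R₂.e) ∧
          Tendsto (fun n => ((N₂ n).rates n).o) atTop (𝓝 R₂.o)) ∧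
        Tendsto (fun x : ℕ × ℕ => overallRate (N₁ x.1) x.1 x.2) (atTop ×ˢ atTop)
          (𝓝 (R₁.s + R₁.e)) ∧
        Tendsto (fun x : ℕ × ℕ => overallRate (N₂ x.1) x.1 x.2) (atTop ×ˢ atTop)
          (𝓝 (R₂.s + R₂.e)) ∧
        ∀ᶠ n in atTop,
          (∃ (B₁ : BlockUser V₁ X₁ Y₁ (N₁ n) (N₂ n) n) (B₂ : BlockUser V₂ X₂ Y₂ (N₂ n) (N₁ n) n),
            JointBounds W Q₁ Q₂ (h₁₂ n) (h₂₁ n) R₁ R₂ B₁ B₂) ∧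
          (∃ (B₁ : BlockUser V₁ X₁ Y₁ (N₁ n) (N₂ n) n) (B₂ : BlockUser V₂ X₂ Y₂ (N₂ n) (N₁ n) n),
            IndividualBounds W Q₁ Q₂ (h₁₂ n) (h₂₁ n) R₁ R₂ B₁ B₂)) := by
  refine ⟨fun n N₁ N₂ h₁₂ h₂₁ hn => ⟨?_, ?_, ?_, ?_⟩, fun R₁ R₂ s₁ k₁ e₁ o₁ s₂ k₂ e₂ o₂ h₁ h₂ => ?_⟩
  · exact exists_jointBounds W Q₁ Q₂ h₁₂ h₂₁ (card_index_le_exp_rates hn N₁)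
      (card_index_le_exp_rates hn N₂) (exp_aux_rates_le hn N₁) (exp_aux_rates_le hn N₂)
  · exact exists_individualBounds W Q₁ Q₂ h₁₂ h₂₁ (card_index_le_exp_rates hn N₁)
      (card_index_le_exp_rates hn N₂) (exp_aux_rates_le hn N₁) (exp_aux_rates_le hn N₂)
      (exp_mul_log_div hn N₁.s).le (exp_mul_log_div hn N₂.s).le
  · simpa only [overallRate_eq, mul_one] using (tendsto_rounds.const_mul _).const_add _
  · simpa only [overallRate_eq, mul_one] using (tendsto_rounds.const_mul _).const_add _
  · obtain ⟨E₁, hE₁⟩ : ∃ E : ℕ → ℕ+, ∀ n, E n = roundUp (Real.exp (n * R₁.e) / 16) :=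
      ⟨_, fun _ => rfl⟩
    obtain ⟨E₂, hE₂⟩ : ∃ E : ℕ → ℕ+, ∀ n, E n = roundUp (Real.exp (n * R₂.e) / 16) :=
      ⟨_, fun _ => rfl⟩
    have he₁ : ∀ n : ℕ, ((E₁ n : ℕ) : ℝ) ≤ Real.exp (n * R₁.e) / 16 + 1 := fun n => by
      rw [hE₁]
      exact roundUp_le (by positivity)
    have he₂ : ∀ n : ℕ, ((E₂ n : ℕ) : ℝ) ≤ Real.exp (n * R₂.e) / 16 + 1 := fun n => by
      rw [hE₂]
      exact roundUp_le (by positivity)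
    have d₁₂ : ∀ n, ((roundedSizes R₁ (E₂ n) n).e : ℕ) ∣ (roundedSizes R₂ (E₁ n) n).k := fun n =>
      ⟨_, by rw [roundedSizes, roundedSizes, ← hE₁, PNat.mul_coe]⟩
    have d₂₁ : ∀ n, ((roundedSizes R₂ (E₁ n) n).e : ℕ) ∣ (roundedSizes R₁ (E₂ n) n).k := fun n =>
      ⟨_, by rw [roundedSizes, roundedSizes, ← hE₂, PNat.mul_coe]⟩
    have t₁ := tendsto_rates_roundedSizes s₁ k₁ e₁ o₁ h₂ he₂
    have t₂ := tendsto_rates_roundedSizes s₂ k₂ e₂ o₂ h₁ he₁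
    refine ⟨fun n => roundedSizes R₁ (E₂ n) n, fun n => roundedSizes R₂ (E₁ n) n, d₁₂, d₂₁, t₁, t₂,
      tendsto_overallRate (N := fun n => roundedSizes R₁ (E₂ n) n) t₁.1 t₁.2.2.1,
      tendsto_overallRate (N := fun n => roundedSizes R₂ (E₁ n) n) t₂.1 t₂.2.2.1, ?_⟩
    -- Positive key rates enter here: for large `n` the nominal key sizes are at least 16, which
    -- pays for the rounding.
    filter_upwards [eventually_le_exp k₁, eventually_le_exp k₂] with n hn₁ hn₂
    have i₁ := card_index_roundedSizes_le s₁ e₁ o₁ h₂ (he₂ n) hn₁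
    have i₂ := card_index_roundedSizes_le s₂ e₂ o₂ h₁ (he₁ n) hn₂
    exact ⟨exists_jointBounds W Q₁ Q₂ (d₁₂ n) (d₂₁ n) i₁ i₂ exp_aux_le_roundedSizes
        exp_aux_le_roundedSizes,
      exists_individualBounds W Q₁ Q₂ (d₁₂ n) (d₂₁ n) i₁ i₂ exp_aux_le_roundedSizes
        exp_aux_le_roundedSizes le_roundedSizes_s le_roundedSizes_s⟩
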